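/- Let $\lambda>0$, $R>0$, $\alpha>2$, $\sigma\in\mathbb R$, $T>0$ and let $L\ge 1$ be an integer. Base stations (BSs) form a homogeneous Poisson point process $\Phi_b$ of intensity $\lambda$ in $\mathbb R^2$; the typical user $u$ is uniformly distributed in the cluster $D_c=\mathcal B(0,R)$; the fading coefficients $h_y$, $y\in\Phi_b$, from the BSs to the user are i.i.d. $\mathcal{CN}(0,1)$; $\Phi_b$, $u$ and the fading are independent. The user is served by its nearest BS $b$ (wherever it lies), and with limited feedback the interference of the $L$ in-cluster interferers $x_1,\dots,x_L\in D_c\cap\Phi_b\setminus\{b\}$ nearest to $u$ (of all in-cluster interferers, if there are fewer than $L$) is cancelled, so that $$\mathtt{SINR}=\frac{|h_b|^2\|b-u\|^{-\alpha}}{\sigma^2+\sum_{y\in\Phi_b\setminus\{b,x_1,\dots,x_L\}}|h_y|^2\|y-u\|^{-\alpha}} .$$ Let $P_{c,R}(T)=\mathbb P[\mathtt{SINR}>T]$ be the coverage probability, let $r_u=\|u\|$, let $r_b$ be the distance from $u$ to its nearest BS, and $r_l$ the distance from $u$ to its $L$-th nearest interferer, i.e. to the $L$-th nearest, among all BSs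 of the plane, other than $b$. Then $r_u$ is independent of $(r_b,r_l)$ and has density $f(r_u)=2r_u/R^2$ on $[0,R]$, $r_b$ has density $f(r_b)=2\pi\lambda r_be^{-\lambda\pi r_b^2}$ on $[0,\infty)$, and the conditional density of $r_l$ given $r_b$ is $$f(r_l\mid r_b)=\frac{2(\pi\lambda)^L}{(L-1)!}(r_l^2-r_b^2)^{L-1}\,r_l\,e^{-\pi\lambda(r_l^2-r_b^2)},\qquad r_l\ge r_b .$$ Moreover $$P_{c,R}(T)\ \ge\ \mathbb E\big[P_1(T)\mathbf 1(r_b<R-r_u,\ r_b<r_l<R-r_u)\big]+\mathbb E\big[P_2(T)\mathbf 1(r_b<R-r_u,\ R-r_u<r_l<R+r_u)\big]+\mathbb E\big[P_3(T)\mathbf 1(R-r_u<r_b<R+r_u,\ r_b\le r_l\le R+r_u)\big],$$ where all three expectations, over $(r_u,r_b,r_l)$, are well defined (the integrands are integrable) and $$P_1(T)=e^{-Tr_b^\alpha\sigma^2}\exp\Big(-2\pi\lambda\frac{Tr_b^\alpha r_l^{2-\alpha}\Lambda(r_b/r_l,T)}{\alpha-2}\Big),$$ $$P_2(T)=e^{-Tr_b^\alpha\sigma^2}\exp\Big(-\lambda\int_{-\Theta_2}^{\Theta_2}\frac{Tr_b^\alpha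 R'(\varphi)^{2-\alpha}\Lambda(r_b/R'(\varphi),T)}{\alpha-2}\,d\varphi\Big)\exp\Big(-2\lambda(\pi-\Theta_2)\frac{Tr_b^\alpha r_l^{2-\alpha}\Lambda(r_b/r_l,T)}{\alpha-2}\Big),$$ $$P_3(T)=e^{-Tr_b^\alpha\sigma^2}\exp\Big(-2\lambda\int_{\Theta_1}^{\Theta_2}\frac{Tr_b^\alpha R'(\varphi)^{2-\alpha}\Lambda(r_b/R'(\varphi),T)}{\alpha-2}\,d\varphi\Big)\exp\Big(-2\lambda\Theta_1\frac{Tr_b^2\Lambda(1,T)}{\alpha-2}\Big)\exp\Big(-\lambda\int_{\Theta_2}^{2\pi-\Theta_2}\frac{Tr_b^\alpha r_l^{2-\alpha}\Lambda(r_b/r_l,T)}{\alpha-2}\,d\varphi\Big).$$ Here $\Lambda(\rho,T)={}_2F_1\big(1,\tfrac{\alpha-2}{\alpha};2-\tfrac2\alpha;-\rho^\alpha T\big)$ with ${}_2F_1$ the Gauss hypergeometric function (principal branch), $R'(\varphi)=\sqrt{r_u^2\cos^2\varphi-r_u^2+R^2}-r_u\cos\varphi$, $\Theta_1=\pi-\arccos\frac{r_b^2+r_u^2-R^2}{2r_br_u}$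 and $\Theta_2=\pi-\arccos\frac{r_l^2+r_u^2-R^2}{2r_lr_u}$. -/

import Mathlib

open MeasureTheory ProbabilityTheory Real Set
open scoped ENNReal

namespace CloudRadio

noncomputable section

/-! ### Special functions -/

/-- The Gauss hypergeometric function `₂F₁(a, b; c; z)` of a real variable `z < 1`, for `0 < b < c`,
on its principal branch, given by Euler's integral.  (Mathlib's `₂F₁` is the sum of the
hypergeometric power series, which is the hypergeometric function only on `|z| < 1`; arguments
`z ≤ -1` are needed here.) -/
def hyp2F1 (a b c z : ℝ) : ℝ :=
  Gamma c / (Gamma b * Gamma (c - b)) *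
    ∫ t in (0 : ℝ)..1, t ^ (b - 1) * (1 - t) ^ (c - b - 1) * (1 - z * t) ^ (-a)

/-- On `|z| < 1` the function above is the sum of the hypergeometric series
(for the parameters `(1, b; b + 1)`, the only ones used below). -/
theorem hyp2F1_eq_series {b z : ℝ} (hb : 0 < b) (hz : |z| < 1) :
    hyp2F1 1 b (b + 1) z = ordinaryHypergeometric (1 : ℝ) b (b + 1) z := by
  have hint : ∀ n : ℕ, ∫ t in (0 : ℝ)..1, z ^ n * t ^ (b - 1 + n) = z ^ n / (b + n) := by
    intro n
    have hn : (0 : ℝ) ≤ n := n.cast_nonneg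
    rw [intervalIntegral.integral_const_mul, integral_rpow (Or.inl (by linarith)),
      one_rpow, zero_rpow (by linarith)]
    rw [sub_zero, show b - 1 + (n : ℝ) + 1 = b + n by ring, mul_one_div]
  have key : HasSum (fun n : ℕ => ∫ t in (0 : ℝ)..1, z ^ n * t ^ (b - 1 + n))
      (∫ t in (0 : ℝ)..1, t ^ (b - 1) * (1 - z * t)⁻¹) := by
    refine intervalIntegral.hasSum_integral_of_dominated_convergence
      (fun n t => |z| ^ n * t ^ (b - 1)) ?_ ?_ ?_ ?_ ?_
    · intro n
      fun_prop
    · intro n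
      refine .of_forall fun t ht => ?_
      rw [uIoc_of_le zero_le_one] at ht
      rw [norm_mul, norm_pow, norm_eq_abs, norm_of_nonneg (rpow_nonneg ht.1.le _)]
      refine mul_le_mul_of_nonneg_left ?_ (by positivity)
      exact rpow_le_rpow_of_exponent_ge ht.1 ht.2 (le_add_of_nonneg_right n.cast_nonneg)
    · refine .of_forall fun t _ => ?_
      exact (summable_geometric_of_lt_one (abs_nonneg z) hz).mul_right _
    · simp_rw [tsum_mul_right]
      exact (intervalIntegral.intervalIntegrable_rpow' (by linarith)).const_mul _
    · refine .of_forall fun t ht => ?_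
      rw [uIoc_of_le zero_le_one] at ht
      have h1 : |z * t| < 1 := by
        rw [abs_mul, abs_of_pos ht.1]
        nlinarith [abs_nonneg z, ht.1, ht.2]
      have := (hasSum_geometric_of_abs_lt_one h1).mul_left (t ^ (b - 1))
      refine this.congr_fun ?_ |> id
      intro n
      rw [rpow_add_natCast ht.1.ne', mul_pow]
      ring
  have hG : Gamma (b + 1) / (Gamma b * Gamma (b + 1 - b)) = b := by
    rw [Gamma_add_one hb.ne', add_sub_cancel_left, Gamma_one, mul_one,
      mul_div_cancel_right₀ _ (Gamma_pos_of_pos hb).ne']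
  have hE : hyp2F1 1 b (b + 1) z = b * ∫ t in (0 : ℝ)..1, t ^ (b - 1) * (1 - z * t)⁻¹ := by
    rw [hyp2F1, hG]
    simp [rpow_neg_one]
  rw [hE, ← key.tsum_eq, ← tsum_mul_left, ordinaryHypergeometric_eq_tsum]
  refine tsum_congr fun n => ?_
  have hp : (ascPochhammer ℝ n).eval (b + 1) * b = (ascPochhammer ℝ n).eval b * (b + n) := by
    have h1 := ascPochhammer_succ_eval n b
    have h2 : (ascPochhammer ℝ (n + 1)).eval b = b * (ascPochhammer ℝ n).eval (b + 1) := by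
      rw [ascPochhammer_succ_left]; simp
    rw [← h1, h2, mul_comm]
  have hpos : 0 < (ascPochhammer ℝ n).eval (b + 1) := ascPochhammer_pos n _ (by linarith)
  have hbn : 0 < b + n := by positivity
  rw [hint, ascPochhammer_eval_one, smul_eq_mul]
  have hf : (n.factorial : ℝ) ≠ 0 := by positivity
  field_simp
  linear_combination (z ^ n) * hp

/-- `Λ(ρ, T) = ₂F₁(1, (α - 2)/α; 2 - 2/α; -ρ^α T)`. -/
def Lam (α ρ T : ℝ) : ℝ :=
  hyp2F1 1 ((α - 2) / α) (2 - 2 / α) (-(ρ ^ α * T))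

/-! ### The network -/

/-- The Euclidean plane. -/
abbrev Plane : Type := EuclideanSpace ℝ (Fin 2)

/-- The number (possibly infinite) of points of the sequence `x` in the set `B`. -/
def count (x : ℕ → Plane) (B : Set Plane) : ℕ∞ := {n | x n ∈ B}.encard

/-- The random points `X 0, X 1, …` form a homogeneous Poisson point process of intensity `lam`
on the plane: the number of points in a Borel set of finite area is Poisson distributed with mean
`lam` times the area, and the numbers of points in disjoint sets are independent. -/
structure IsPoissonProcess {Ω : Type*} [MeasurableSpace Ω] (P : Measure Ω) (lam : ℝ)
    (X : ℕ → Ω → Plane) : Prop where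
  measurable : ∀ n, Measurable (X n)
  count_law : ∀ B : Set Plane, MeasurableSet B → volume B ≠ ∞ → ∀ k : ℕ,
    P {ω | count (fun n => X n ω) B = k} =
      ENNReal.ofReal (exp (-(lam * volume.real B)) * (lam * volume.real B) ^ k / (k.factorial : ℝ))
  count_indep : ∀ (m : ℕ) (B : Fin m → Set Plane), (∀ i, MeasurableSet (B i)) →
    (∀ i, volume (B i) ≠ ∞) → Pairwise (fun i j => Disjoint (B i) (B j)) →
    iIndepFun (fun i ω => count (fun n => X n ω) (B i)) P

/-- The circularly symmetric complex Gaussian law `𝒞𝒩(0, 1)`: independent centred real Gaussian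
real and imaginary parts, of variance `1/2` each. -/
def stdComplexGaussian : Measure ℂ :=
  ((gaussianReal 0 (1 / 2)).prod (gaussianReal 0 (1 / 2))).map (fun p : ℝ × ℝ => (⟨p.1, p.2⟩ : ℂ))

/-- The cluster: the disc of radius `R` around the origin. -/
def cluster (R : ℝ) : Set Plane := Metric.ball 0 R

/-- The model: the base stations `X n` form a Poisson process of intensity `lam`; the channel from
base station `n` to the typical user has fading coefficient `h n`, i.i.d. `𝒞𝒩(0, 1)` (Rayleigh
fading, `|h n|²` has mean `1`); the typical user `U` is dropped uniformly in the cluster; base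
stations, fading and user are independent. -/
structure IsNetwork {Ω : Type*} [MeasurableSpace Ω] (P : Measure Ω) (lam R : ℝ)
    (X : ℕ → Ω → Plane) (h : ℕ → Ω → ℂ) (U : Ω → Plane) : Prop where
  poisson : IsPoissonProcess P lam X
  fading_measurable : ∀ n, Measurable (h n)
  fading_law : ∀ n, P.map (h n) = stdComplexGaussian
  fading_indep : iIndepFun h P
  user_measurable : Measurable U
  user_uniform : pdf.IsUniform U (cluster R) P volume
  indep_fading_stations : IndepFun (fun ω n => h n ω) (fun ω n => X n ω) P
  indep_user : IndepFun U (fun ω => ((fun n => h n ω), (fun n => X n ω))) P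

/-! ### SINR and coverage.  Here `x n` are the base stations, `g n` the fading coefficients and
`u` the user, for one realization of the network. -/

/-- The user is connected to base station `b`: it is the strictly nearest one. -/
def IsServing (x : ℕ → Plane) (u : Plane) (b : ℕ) : Prop :=
  ∀ j, j ≠ b → dist u (x b) < dist u (x j)

/-- The interferers cancelled by precoding for a user served by `b`: the `L` base stations
nearest to the user among the interfering ones (those other than `b`) in the cluster; all the
in-cluster interferers, if there are fewer than `L`. -/
def cancelled (R : ℝ) (L : ℕ) (x : ℕ → Plane) (u : Plane) (b : ℕ) : Set ℕ :=
  {j | j ≠ b ∧ x j ∈ cluster R ∧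
    {k | k ≠ b ∧ x k ∈ cluster R ∧ dist u (x k) < dist u (x j)}.encard < L}

/-- Power of the residual interference: the sum of `|g j|² ‖x j - u‖^(-α)` over the base stations
`j` that neither serve the user nor are cancelled. -/
def interference (α R : ℝ) (L : ℕ) (x : ℕ → Plane) (g : ℕ → ℂ) (u : Plane) (b : ℕ) : ℝ≥0∞ :=
  ∑' j : {j : ℕ // j ≠ b ∧ j ∉ cancelled R L x u b}, ‖g j‖ₑ ^ 2 * edist u (x j) ^ (-α)

/-- Signal to interference and noise ratio of a user served by `b`, with noise variance `σ²`. -/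
def sinr (α σ R : ℝ) (L : ℕ) (x : ℕ → Plane) (g : ℕ → ℂ) (u : Plane) (b : ℕ) : ℝ≥0∞ :=
  ‖g b‖ₑ ^ 2 * edist u (x b) ^ (-α) /
    (ENNReal.ofReal (σ ^ 2) + interference α R L x g u b)

/-- Coverage probability: the probability that the SINR of the typical user, connected to its
nearest base station, exceeds `T`. -/
def coverage {Ω : Type*} [MeasurableSpace Ω] (P : Measure Ω) (α σ R : ℝ) (L : ℕ) (T : ℝ)
    (X : ℕ → Ω → Plane) (h : ℕ → Ω → ℂ) (U : Ω → Plane) : ℝ :=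
  P.real {ω | ∃ b, IsServing (fun n => X n ω) (U ω) b ∧
    ENNReal.ofReal T < sinr α σ R L (fun n => X n ω) (fun n => h n ω) (U ω) b}

/-! ### Distances and their densities -/

/-- The distance from `u` to the `k`-th nearest of the points `x n` of the plane (`1 ≤ k`). -/
def nthDist (k : ℕ) (x : ℕ → Plane) (u : Plane) : ℝ :=
  sInf {r : ℝ | (k : ℕ∞) ≤ {n | dist u (x n) ≤ r}.encard}

/-- Distance of the user from the centre of the cluster. -/
def rUser {Ω : Type*} (U : Ω → Plane) (ω : Ω) : ℝ := ‖U ω‖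

/-- Distance from the user to its nearest base station. -/
def rServing {Ω : Type*} (X : ℕ → Ω → Plane) (U : Ω → Plane) (ω : Ω) : ℝ :=
  nthDist 1 (fun n => X n ω) (U ω)

/-- Distance from the user to its `L`-th nearest interferer, that is, to the `L`-th nearest of the
base stations other than the serving (nearest) one. -/
def rInterferer {Ω : Type*} (L : ℕ) (X : ℕ → Ω → Plane) (U : Ω → Plane) (ω : Ω) : ℝ :=
  nthDist (L + 1) (fun n => X n ω) (U ω)

/-- Density of `r_u`. -/
def pdfUser (R r : ℝ) : ℝ := if 0 ≤ r ∧ r ≤ R then 2 * r / R ^ 2 else 0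

/-- Density of `r_b`. -/
def pdfServing (lam r : ℝ) : ℝ :=
  if 0 ≤ r then 2 * π * lam * r * exp (-(lam * π * r ^ 2)) else 0

/-- Density of `r_l` given `r_b`. -/
def pdfInterferer (lam : ℝ) (L : ℕ) (rb rl : ℝ) : ℝ :=
  if rb ≤ rl then
    2 * (π * lam) ^ L / ((L - 1).factorial : ℝ) * (rl ^ 2 - rb ^ 2) ^ (L - 1) * rl *
      exp (-(π * lam * (rl ^ 2 - rb ^ 2)))
  else 0

/-! ### The bounds -/

/-- `R'`: the distance from the user to the boundary of the cluster, in the direction at angle `φ`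
from the outward radial direction. -/
def bdryDist (R ru φ : ℝ) : ℝ := √(cos φ ^ 2 * ru ^ 2 - ru ^ 2 + R ^ 2) - cos φ * ru

/-- `π - arccos ((r² + r_u² - R²) / (2 r r_u))`: the angle at the user between the outward radial
direction and the intersection of the boundary of the cluster with the circle of radius `r` around
the user. -/
def crossAngle (R ru r : ℝ) : ℝ := π - arccos ((r ^ 2 + ru ^ 2 - R ^ 2) / (2 * r * ru))

/-- `P₁(T)`: disc of radius `r_l` around the user inside the cluster. -/
def P1 (α lam σ T rb rl : ℝ) : ℝ :=
  exp (-(T * rb ^ α * σ ^ 2)) *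
    exp (-(2 * π * lam * (T * rb ^ α * rl ^ (2 - α) * Lam α (rb / rl) T / (α - 2))))

/-- `P₂(T)`: only the disc of radius `r_b` around the user inside the cluster
(`Θ = crossAngle R ru rl`). -/
def P2 (α lam σ R T ru rb rl : ℝ) : ℝ :=
  exp (-(T * rb ^ α * σ ^ 2)) *
    exp (-(lam * ∫ φ in (-crossAngle R ru rl)..(crossAngle R ru rl),
      T * rb ^ α * bdryDist R ru φ ^ (2 - α) * Lam α (rb / bdryDist R ru φ) T / (α - 2))) *
    exp (-(lam * (2 * (π - crossAngle R ru rl)) *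
      (T * rb ^ α * rl ^ (2 - α) * Lam α (rb / rl) T / (α - 2))))

/-- `P₃(T)`: both circles cross the boundary of the cluster (`Θ₁ = crossAngle R ru rb`,
`Θ₂ = crossAngle R ru rl`). -/
def P3 (α lam σ R T ru rb rl : ℝ) : ℝ :=
  exp (-(T * rb ^ α * σ ^ 2)) *
    exp (-(2 * lam * ∫ φ in (crossAngle R ru rb)..(crossAngle R ru rl),
      T * rb ^ α * bdryDist R ru φ ^ (2 - α) * Lam α (rb / bdryDist R ru φ) T / (α - 2))) *
    exp (-(lam * (2 * crossAngle R ru rb) * (T * rb ^ 2 * Lam α 1 T / (α - 2)))) *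
    exp (-(lam * ∫ _φ in (crossAngle R ru rl)..(2 * π - crossAngle R ru rl),
      T * rb ^ α * rl ^ (2 - α) * Lam α (rb / rl) T / (α - 2)))

open scoped Classical in
/-- The integrand `P₁(T) 1(r_b < R - r_u, r_b < r_l < R - r_u)`. -/
def term1 (α lam σ R T ru rb rl : ℝ) : ℝ :=
  if rb < R - ru ∧ rb < rl ∧ rl < R - ru then P1 α lam σ T rb rl else 0

open scoped Classical in
/-- The integrand `P₂(T) 1(r_b < R - r_u, R - r_u < r_l < R + r_u)`. -/
def term2 (α lam σ R T ru rb rl : ℝ) : ℝ :=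
  if rb < R - ru ∧ R - ru < rl ∧ rl < R + ru then P2 α lam σ R T ru rb rl else 0

open scoped Classical in
/-- The integrand `P₃(T) 1(R - r_u < r_b < R + r_u, r_b ≤ r_l ≤ R + r_u)`. -/
def term3 (α lam σ R T ru rb rl : ℝ) : ℝ :=
  if (R - ru < rb ∧ rb < R + ru) ∧ rb ≤ rl ∧ rl ≤ R + ru then P3 α lam σ R T ru rb rl else 0

end

end CloudRadio

/-! Fix the user at `u`, let `s` and `t` be its distances to the nearest and to the `L + 1`-st
nearest station, and put `c = T s^α`. Under Rayleigh fading `|h_b|²` is exponential, so for given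
stations the event SINR > T has probability `e^{-cσ²} ∏ 1 / (1 + c d_j^{-α})`, the product running
over the distances `d_j` of the uncancelled stations (`le_measure_sinr` is the half that is needed).
Such a station lies beyond `s` and, if it is in the cluster, beyond the `L`-th nearest in-cluster
interferer, whose distance is at least `t`, because `t` counts interferers of the whole plane.
Charging instead for every Poisson point beyond `s` that is outside the cluster or beyond `t` can
only lower the product; averaging with the Laplace functional of the Poisson process gives
`covBound`.

The Poisson hypothesis speaks only of counts in fixed sets, whereas `s` and `t` are random. So a
disc of radius `M` is cut into `N` annuli of equal area, and configurations are sorted by the annuli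
that contain the serving station and the `L`-th in-cluster interferer (`IsBin`). A bin is an event
about counts in four sets disjoint from the residual region taken at the outer radii, hence
independent of the points there (`laplace_le`, `mul_covBound_le`). Rounding the radii is absorbed by
`relaxedBound`, which keeps the true distances and only enlarges the threshold. The configurations
outside all bins have probability at most `e^{-λπM²} + (λπM²)²/N`. Letting `N → ∞` and then `M → ∞`
yields `lintegral_covBound_le`, and independence of the user allows integration over `u`.

In polar coordinates at the user, measured from the outward radial direction, the ray at angle `φ`
meets the residual region in a half-line starting at `max s (min (R' φ) t)` (`exponent_eq`), and the
integral along the ray is the hypergeometric expression (`radial_eq`). The crossing angles split the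
circle according to which of the three quantities is the starting point, so each of P₁, P₂, P₃
equals `covBound` on its own region. These regions are disjoint and `covBound` is nonnegative
(`add_terms_le`).

For the densities, independence of counts in a disc and in the surrounding annulus gives the
probability of `s ≤ r_b, t ≤ r_l`, which the proposed density reproduces (`distLaw_Ici`,
`map_nthDist`). This law does not depend on `u`, hence the independence from the user's position. -/

namespace CloudRadio

/-! ### Exponentials of possibly infinite exponents. -/

/-- The decreasing exponential `x ↦ exp (-x)` on `[0, ∞]`. -/
noncomputable def eneg (x : ℝ≥0∞) : ℝ≥0∞ := EReal.exp (-(x : EReal))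

@[simp] lemma eneg_zero : eneg 0 = 1 := by simp [eneg]

@[simp] lemma eneg_top : eneg ∞ = 0 := by simp [eneg]

lemma eneg_ofReal {x : ℝ} (hx : 0 ≤ x) : eneg (ENNReal.ofReal x) = ENNReal.ofReal (exp (-x)) := by
  rw [eneg, EReal.coe_ennreal_ofReal, max_eq_left hx, ← EReal.coe_neg, EReal.exp_coe]

lemma eneg_antitone : Antitone eneg := fun x y h => by
  unfold eneg
  exact EReal.exp_monotone (EReal.neg_le_neg_iff.2 (by exact_mod_cast h))

lemma eneg_le_one (x : ℝ≥0∞) : eneg x ≤ 1 := by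
  simpa using eneg_antitone (zero_le (a := x))

lemma eneg_ne_top (x : ℝ≥0∞) : eneg x ≠ ∞ := ((eneg_le_one x).trans_lt ENNReal.one_lt_top).ne

lemma eneg_add (x y : ℝ≥0∞) : eneg (x + y) = eneg x * eneg y := by
  rw [eneg, eneg, eneg, ← EReal.exp_add, EReal.coe_ennreal_add, EReal.neg_add]
  · rfl
  · left; simp
  · right; simp

lemma eneg_sum {ι : Type*} (s : Finset ι) (f : ι → ℝ≥0∞) :
    eneg (∑ i ∈ s, f i) = ∏ i ∈ s, eneg (f i) := by
  classical
  induction s using Finset.induction_on with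
  | empty => simp
  | insert a s ha ih => rw [Finset.sum_insert ha, eneg_add, ih, Finset.prod_insert ha]

lemma eneg_natCast_mul (k : ℕ) (x : ℝ≥0∞) : eneg (k * x) = eneg x ^ k := by
  induction k with
  | zero => simp
  | succ k ih => rw [Nat.cast_succ, add_mul, one_mul, eneg_add, ih, pow_succ]

lemma continuous_eneg : Continuous eneg := by
  have h1 : Continuous EReal.exp := by
    have : (EReal.exp : EReal → ℝ≥0∞) = EReal.expOrderIso := rfl
    rw [this]; exact EReal.expOrderIso.continuous
  exact h1.comp (continuous_neg.comp continuous_coe_ennreal_ereal)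

@[fun_prop] lemma measurable_eneg : Measurable eneg := continuous_eneg.measurable

/-- `eneg` of a countable sum is the limit of the products. -/
lemma tendsto_eneg_sum_range (f : ℕ → ℝ≥0∞) :
    Filter.Tendsto (fun n => eneg (∑ j ∈ Finset.range n, f j)) Filter.atTop
      (nhds (eneg (∑' j, f j))) :=
  (continuous_eneg.tendsto _).comp ENNReal.summable.hasSum.tendsto_sum_nat

/-! ### Rayleigh fading -/

lemma integral_rayleigh {b : ℝ} (hb : 0 < b) {t : ℝ} :
    ∫⁻ r in Ioi t, ENNReal.ofReal (2 * r * exp (-(b * r ^ 2))) ∂(volume.restrict (Ioi 0)) =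
      ENNReal.ofReal (exp (-(b * (max t 0) ^ 2)) / b) := by
  rw [Measure.restrict_restrict measurableSet_Ioi, Ioi_inter_Ioi]
  change ∫⁻ r in Ioi (max t 0), _ = _
  set a := max t 0
  have ha : 0 ≤ a := le_max_right _ _
  have hd : ∀ x : ℝ, HasDerivAt (fun r => -(exp (-(b * r ^ 2)) / b)) (2 * x * exp (-(b * x ^ 2))) x := by
    intro x
    have := ((((hasDerivAt_pow 2 x).const_mul b).neg).exp.div_const b).neg
    refine HasDerivAt.congr_deriv (f := fun r => -(exp (-(b * r ^ 2)) / b)) this ?_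
    simp only [Pi.neg_apply]
    field_simp
    norm_num
    ring
  have hnn : ∀ x ∈ Ioi a, 0 ≤ 2 * x * exp (-(b * x ^ 2)) := fun x hx => by
    have : 0 < x := ha.trans_lt hx
    positivity
  have hl : Filter.Tendsto (fun r => -(exp (-(b * r ^ 2)) / b)) Filter.atTop (nhds 0) := by
    have : Filter.Tendsto (fun r : ℝ => -(b * r ^ 2)) Filter.atTop Filter.atBot :=
      Filter.tendsto_neg_atTop_atBot.comp
        ((Filter.tendsto_pow_atTop two_ne_zero).const_mul_atTop hb)
    simpa using ((tendsto_exp_atBot.comp this).div_const b).neg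
  have hi := integrableOn_Ioi_deriv_of_nonneg (hd a).continuousAt.continuousWithinAt
    (fun x _ => hd x) hnn hl
  rw [← ofReal_integral_eq_lintegral_ofReal hi
    ((ae_restrict_iff' measurableSet_Ioi).2 (.of_forall hnn)),
    integral_Ioi_of_hasDerivAt_of_nonneg (hd a).continuousAt.continuousWithinAt
    (fun x _ => hd x) hnn hl]
  simp

/-- In polar coordinates the planar density `e^{-r²}/π` does not depend on the angle, and
integrating the angle out contributes `2π`. -/
lemma lintegral_stdComplexGaussian {f : ℝ → ℝ≥0∞} (hf : Measurable f) :
    ∫⁻ z, f (‖z‖ ^ 2) ∂stdComplexGaussian =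
      ∫⁻ r in Ioi (0 : ℝ), ENNReal.ofReal (2 * r * exp (-(r ^ 2))) * f (r ^ 2) := by
  have hm : Measurable (fun p : ℝ × ℝ => (⟨p.1, p.2⟩ : ℂ)) :=
    Complex.measurableEquivRealProd.symm.measurable
  have hv : ((1 / 2 : NNReal)) ≠ 0 := by norm_num
  rw [stdComplexGaussian, lintegral_map (by fun_prop) hm, gaussianReal_of_var_ne_zero _ hv,
    prod_withDensity (measurable_gaussianPDF _ _) (measurable_gaussianPDF _ _),
    ← Measure.volume_eq_prod,
    lintegral_withDensity_eq_lintegral_mul _ (by fun_prop) (by fun_prop),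
    ← lintegral_comp_polarCoord_symm, polarCoord_target, Measure.volume_eq_prod,
    ← Measure.prod_restrict, lintegral_prod _ (by fun_prop)]
  refine lintegral_congr_ae ((ae_restrict_iff' measurableSet_Ioi).2 (.of_forall fun r hr => ?_))
  have hr : 0 < r := hr
  have h1 : ∀ φ : ℝ, ENNReal.ofReal r • (((fun z : ℝ × ℝ => gaussianPDF 0 (1 / 2) z.1 * gaussianPDF 0 (1 / 2) z.2) *
      fun a : ℝ × ℝ => f (‖(⟨a.1, a.2⟩ : ℂ)‖ ^ 2)) (polarCoord.symm (r, φ))) =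
      ENNReal.ofReal (r * (π⁻¹ * exp (-(r ^ 2)))) * f (r ^ 2) := by
    intro φ
    rw [ENNReal.ofReal_mul hr.le, smul_eq_mul, mul_assoc]
    congr 1
    simp only [polarCoord_symm_apply, Pi.mul_apply]
    have hs : ‖(⟨r * cos φ, r * sin φ⟩ : ℂ)‖ ^ 2 = r ^ 2 := by
      rw [← Complex.normSq_eq_norm_sq, Complex.normSq_mk]
      nlinarith [sin_sq_add_cos_sq φ]
    rw [hs]
    congr 1
    rw [gaussianPDF, gaussianPDF, ← ENNReal.ofReal_mul (gaussianPDFReal_nonneg _ _ _)]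
    congr 1
    simp only [gaussianPDFReal]
    have h2 : (2 * π * ((1 / 2 : NNReal) : ℝ)) = π := by push_cast; ring
    rw [h2, mul_mul_mul_comm, ← mul_inv, mul_self_sqrt pi_pos.le, ← exp_add]
    congr 2
    push_cast
    field_simp
    nlinarith [sin_sq_add_cos_sq φ]
  dsimp only
  rw [lintegral_congr h1, setLIntegral_const, Real.volume_Ioo, mul_right_comm,
    ← ENNReal.ofReal_mul (by positivity)]
  congr 2
  field_simp
  ring

/-- The factor `e^{-a r²}` merges with the Gaussian density. The case `a = 0` is the tail of the
fading power, the case `t = 0` its Laplace transform. -/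
lemma lintegral_fading {t a : ℝ} (ht : 0 ≤ t) (ha : 0 ≤ a) :
    ∫⁻ z, (Ioi t).indicator (fun v => ENNReal.ofReal (exp (-(a * v)))) (‖z‖ ^ 2) ∂stdComplexGaussian =
      ENNReal.ofReal (exp (-((1 + a) * t)) / (1 + a)) := by
  have h1 : 0 < 1 + a := by linarith
  rw [lintegral_stdComplexGaussian ((by fun_prop : Measurable fun v => ENNReal.ofReal
    (exp (-(a * v)))).indicator measurableSet_Ioi)]
  have := integral_rayleigh h1 (t := √t)
  rw [max_eq_left (sqrt_nonneg t), sq_sqrt ht] at this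
  rw [← this, ← lintegral_indicator (s := Ioi √t) measurableSet_Ioi]
  refine lintegral_congr_ae ((ae_restrict_iff' measurableSet_Ioi).2 (.of_forall fun (r : ℝ) hr => ?_))
  have hr : 0 < r := hr
  by_cases h : √t < r
  · have h' : t < r ^ 2 := (sqrt_lt' hr).1 h
    simp only [indicator, mem_Ioi, h, h', if_true]
    rw [← ENNReal.ofReal_mul (by positivity), mul_assoc, ← exp_add]
    congr 4; ring
  · have h' : ¬ t < r ^ 2 := fun h' => h ((sqrt_lt' hr).2 h')
    simp only [indicator, mem_Ioi, h, h', if_false, mul_zero]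

instance : IsProbabilityMeasure stdComplexGaussian := by
  unfold stdComplexGaussian
  exact Measure.isProbabilityMeasure_map
    Complex.measurableEquivRealProd.symm.measurable.aemeasurable

lemma fading_tail {x : ℝ≥0∞} :
    stdComplexGaussian {z | x < ‖z‖ₑ ^ 2} = eneg x := by
  induction x with
  | top => simp
  | coe x =>
    have := lintegral_fading x.coe_nonneg le_rfl
    simp only [zero_mul, neg_zero, exp_zero, ENNReal.ofReal_one, add_zero, one_mul, div_one] at this
    have h2 : (x : ℝ≥0∞) = ENNReal.ofReal x := by simp
    rw [h2, eneg_ofReal x.coe_nonneg]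
    refine Eq.trans ?_ this
    have hs : MeasurableSet {z : ℂ | (x : ℝ) < ‖z‖ ^ 2} :=
      measurableSet_lt measurable_const ((continuous_norm (E := ℂ)).pow 2).measurable
    have h3 : {z : ℂ | ENNReal.ofReal x < ‖z‖ₑ ^ 2} = {z : ℂ | (x : ℝ) < ‖z‖ ^ 2} := by
      ext z
      rw [mem_ofPred_eq, mem_ofPred_eq, ← ofReal_norm, ← ENNReal.ofReal_pow (norm_nonneg _),
        ENNReal.ofReal_lt_ofReal_iff_of_nonneg x.coe_nonneg]
    rw [h3, ← lintegral_indicator_one hs]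
    rfl

/-- The value `1 / (1 + a)` is kept as an exponential of a logarithm so that the product over
interferers becomes `eneg` of a sum over the points. -/
lemma fading_laplace {a : ℝ} (ha : 0 ≤ a) :
    ∫⁻ z, eneg (ENNReal.ofReal a * ‖z‖ₑ ^ 2) ∂stdComplexGaussian =
      eneg (ENNReal.ofReal (log (1 + a))) := by
  have h1 : 0 < 1 + a := by linarith
  rw [eneg_ofReal (log_nonneg (by linarith)), exp_neg, exp_log h1]
  have := lintegral_fading le_rfl ha
  rw [mul_zero, neg_zero, exp_zero, one_div] at this
  rw [← this, lintegral_stdComplexGaussian ((by fun_prop : Measurable fun v => ENNReal.ofReal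
    (exp (-(a * v)))).indicator measurableSet_Ioi)]
  have h0 : ∀ z : ℂ, eneg (ENNReal.ofReal a * ‖z‖ₑ ^ 2) =
      (fun v => ENNReal.ofReal (exp (-(a * v)))) (‖z‖ ^ 2) := fun z => by
    rw [← ofReal_norm, ← ENNReal.ofReal_pow (norm_nonneg _), ← ENNReal.ofReal_mul ha,
      eneg_ofReal (by positivity)]
  rw [lintegral_congr h0,
    lintegral_stdComplexGaussian (f := fun v => ENNReal.ofReal (exp (-(a * v)))) (by fun_prop)]
  refine lintegral_congr_ae ((ae_restrict_iff' measurableSet_Ioi).2 (.of_forall fun r hr => ?_))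
  have hr : 0 < r ^ 2 := pow_pos hr 2
  simp [indicator, hr]

end CloudRadio

/-! ### Coverage probability for fixed path losses. -/

namespace CloudRadio

variable {Ω : Type*} [MeasurableSpace Ω] {P : Measure Ω}

/-- For an independent family, one member is independent of any functional of the others. -/
lemma indepFun_of_measurable_compl {β γ : Type*} [MeasurableSpace β] [MeasurableSpace γ]
    {h : ℕ → Ω → β} (hm : ∀ n, Measurable (h n))
    (hi : iIndepFun h P) (b : ℕ) {I : Ω → γ}
    (hI : Measurable[⨆ i ∈ ({b}ᶜ : Set ℕ), MeasurableSpace.comap (h i) inferInstance] I) :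
    IndepFun (h b) I P := by
  rw [IndepFun_iff_Indep]
  have := indep_iSup_of_disjoint (fun i => (hm i).comap_le) hi.iIndep
    (disjoint_compl_right (a := ({b} : Set ℕ)))
  refine indep_of_indep_of_le_left (indep_of_indep_of_le_right this hI.comap_le) ?_
  simp

/-- The tail of the fading power of one station at an independent random level. -/
lemma measure_lt_fading_of_indepFun [IsProbabilityMeasure P] {g : Ω → ℂ} {Y : Ω → ℝ≥0∞}
    (hg : Measurable g) (hY : Measurable Y) (hlaw : P.map g = stdComplexGaussian)
    (hi : IndepFun g Y P) : P {ω | Y ω < ‖g ω‖ₑ ^ 2} = ∫⁻ ω, eneg (Y ω) ∂P := by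
  have hs : MeasurableSet {p : ℂ × ℝ≥0∞ | p.2 < ‖p.1‖ₑ ^ 2} :=
    measurableSet_lt (by fun_prop) (by fun_prop)
  have h1 := (indepFun_iff_map_prod_eq_prod_map_map hg.aemeasurable hY.aemeasurable).1 hi
  have h2 : P {ω | Y ω < ‖g ω‖ₑ ^ 2} = P.map (fun ω => (g ω, Y ω)) {p | p.2 < ‖p.1‖ₑ ^ 2} := by
    rw [Measure.map_apply (hg.prodMk hY) hs]; rfl
  have : IsProbabilityMeasure (P.map Y) := Measure.isProbabilityMeasure_map hY.aemeasurable
  rw [h2, h1, hlaw, Measure.prod_apply_symm hs, lintegral_map (measurable_measure_prodMk_right hs) hY]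
  exact lintegral_congr fun ω => fading_tail

/-- The measurable space is arbitrary so that it can be taken to be the σ-algebra generated by the
fading of all stations but one, as independence from that one requires. -/
lemma measurable_tsum_fading {α : Type*} [MeasurableSpace α] {h : ℕ → α → ℂ} {S : Set ℕ}
    {w : ℕ → ℝ≥0∞} (hm : ∀ j ∈ S, Measurable (h j)) :
    Measurable fun ω => ∑' j, S.indicator (fun j => ‖h j ω‖ₑ ^ 2 * w j) j := by
  refine Measurable.tsum fun j => ?_
  by_cases hj : j ∈ S
  · simp only [indicator_of_mem hj]
    exact ((hm j hj).enorm.pow_const 2).mul_const _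
  · simp only [indicator_of_notMem hj]
    exact measurable_const

/-- Rayleigh fading: lower bound for the probability that the SINR exceeds a threshold, given the
path losses. -/
lemma le_measure_sinr [IsProbabilityMeasure P] {h : ℕ → Ω → ℂ} (hm : ∀ n, Measurable (h n))
    (hlaw : ∀ n, P.map (h n) = stdComplexGaussian) (hi : iIndepFun h P)
    (b : ℕ) (S : Set ℕ) (hb : b ∉ S) (w f : ℕ → ℝ≥0∞) (hw0 : w b ≠ 0) (hw1 : w b ≠ ∞)
    {T c : ℝ} (hT : 0 < T) (hc : 0 ≤ c) (hcT : ENNReal.ofReal T ≤ ENNReal.ofReal c * w b)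
    (hf : ∀ j ∈ S, ∃ v : ℝ, 0 ≤ v ∧ w j = ENNReal.ofReal v ∧ ENNReal.ofReal (log (1 + c * v)) ≤ f j)
    (σ2 : ℝ≥0∞) :
    eneg (ENNReal.ofReal c * σ2) * eneg (∑' j, f j) ≤
      P {ω | ENNReal.ofReal T < ‖h b ω‖ₑ ^ 2 * w b / (σ2 + ∑' j : S, ‖h j ω‖ₑ ^ 2 * w j)} := by
  classical
  set I : Ω → ℝ≥0∞ := fun ω => ∑' j, S.indicator (fun j => ‖h j ω‖ₑ ^ 2 * w j) j with hI
  have hImeas : Measurable[⨆ i ∈ ({b}ᶜ : Set ℕ), MeasurableSpace.comap (h i) inferInstance] I := by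
    refine @measurable_tsum_fading Ω (_) h S w fun j hj => ?_
    have hjb : j ∈ ({b}ᶜ : Set ℕ) := fun h => hb (h ▸ hj)
    exact (comap_measurable (h j)).mono (le_iSup₂_of_le j hjb le_rfl) le_rfl
  have hImeas' : Measurable I := hImeas.mono (iSup₂_le fun i _ => (hm i).comap_le) le_rfl
  have hind : IndepFun (h b) (fun ω => ENNReal.ofReal c * (σ2 + I ω)) P :=
    (indepFun_of_measurable_compl hm hi b hImeas).comp measurable_id
      (by fun_prop : Measurable fun x : ℝ≥0∞ => ENNReal.ofReal c * (σ2 + x))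
  -- Since `T ≤ c * w b`, it suffices that the fading power of `b` exceeds a level that does not
  -- involve `h b`.
  have hsub : {ω | ENNReal.ofReal c * (σ2 + I ω) < ‖h b ω‖ₑ ^ 2} ⊆
      {ω | ENNReal.ofReal T < ‖h b ω‖ₑ ^ 2 * w b / (σ2 + ∑' j : S, ‖h j ω‖ₑ ^ 2 * w j)} := by
    intro ω hω
    have hω : ENNReal.ofReal c * (σ2 + I ω) < ‖h b ω‖ₑ ^ 2 := hω
    change ENNReal.ofReal T < _
    rw [tsum_subtype S fun j => ‖h j ω‖ₑ ^ 2 * w j]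
    rw [ENNReal.lt_div_iff_mul_lt (Or.inr ENNReal.ofReal_ne_top) (Or.inr (by simpa using hT))]
    calc ENNReal.ofReal T * (σ2 + I ω) ≤ ENNReal.ofReal c * w b * (σ2 + I ω) := by gcongr
      _ = ENNReal.ofReal c * (σ2 + I ω) * w b := by ring
      _ < ‖h b ω‖ₑ ^ 2 * w b := ENNReal.mul_lt_mul_left hw0 hw1 hω
  refine le_trans ?_ (measure_mono hsub)
  rw [measure_lt_fading_of_indepFun (hm b) (by fun_prop) (hlaw b) hind]
  have hexp : ∀ ω, eneg (ENNReal.ofReal c * (σ2 + I ω)) =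
      eneg (ENNReal.ofReal c * σ2) * eneg (ENNReal.ofReal c * I ω) := fun ω => by
    rw [mul_add, eneg_add]
  rw [lintegral_congr hexp, lintegral_const_mul _ (by fun_prop)]
  gcongr
  set F : ℕ → Ω → ℝ≥0∞ := fun j ω =>
    eneg (ENNReal.ofReal c * S.indicator (fun j => ‖h j ω‖ₑ ^ 2 * w j) j) with hF
  have hFform : ∀ j, F j = (fun z : ℂ => eneg (ENNReal.ofReal c * (S.indicator (fun j => ‖z‖ₑ ^ 2 * w j) j)))
      ∘ h j := by
    intro j; ext ω
    by_cases hj : j ∈ S <;> simp [hF, hj]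
  have hφ : ∀ j, Measurable
      (fun z : ℂ => eneg (ENNReal.ofReal c * (S.indicator (fun j => ‖z‖ₑ ^ 2 * w j) j))) := by
    intro j
    by_cases hj : j ∈ S <;> simp only [hj, indicator_of_mem, indicator_of_notMem, not_false_eq_true] <;>
      fun_prop
  have hFm : ∀ j, Measurable (F j) := fun j => by rw [hFform]; exact (hφ j).comp (hm j)
  have hFi : iIndepFun F P := by
    have := hi.comp _ hφ
    rwa [← funext hFform] at this
  -- On `S` the exact exponent is `log (1 + c v)`, which `f j` dominates; off `S` the factor is `1`,
  -- so `f j` can only lower the bound.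
  have hFint : ∀ j, eneg (f j) ≤ ∫⁻ ω, F j ω ∂P := by
    intro j
    rw [hFform]
    simp only [Function.comp_apply]
    rw [← lintegral_map (hφ j) (hm j), hlaw]
    by_cases hj : j ∈ S
    · obtain ⟨v, hv0, hv, hvf⟩ := hf j hj
      simp only [indicator_of_mem hj]
      refine (eneg_antitone hvf).trans ?_
      rw [← fading_laplace (mul_nonneg hc hv0), hv]
      refine le_of_eq (lintegral_congr fun z => ?_)
      rw [ENNReal.ofReal_mul hc]; congr 1; ring
    · simp only [indicator_of_notMem hj, mul_zero, eneg_zero, lintegral_const, measure_univ]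
      simpa using eneg_le_one _
  -- Independence factors finite products only; the infinite product is reached by dominated
  -- convergence, all partial products being at most `1`.
  have hlim : Filter.Tendsto (fun n => ∫⁻ ω, ∏ j ∈ Finset.range n, F j ω ∂P) Filter.atTop
      (nhds (∫⁻ ω, eneg (ENNReal.ofReal c * I ω) ∂P)) := by
    refine tendsto_lintegral_of_dominated_convergence (fun _ => 1)
      (fun n => Finset.measurable_prod _ fun j _ => hFm j) ?_ (by simp) ?_
    · intro n
      refine .of_forall fun ω => ?_
      exact Finset.prod_le_one' fun j _ => eneg_le_one _
    · refine .of_forall fun ω => ?_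
      simp only [hF, ← eneg_sum, hI, ← ENNReal.tsum_mul_left]
      exact tendsto_eneg_sum_range _
  refine ge_of_tendsto' hlim fun n => ?_
  rw [lintegral_prod_eq_prod_lintegral_of_indepFun _ _ hFi hFm]
  refine (eneg_antitone (ENNReal.sum_le_tsum (Finset.range n))).trans ?_
  rw [eneg_sum]
  exact Finset.prod_le_prod' fun j _ => hFint j

end CloudRadio

namespace CloudRadio

variable {Ω : Type*} [MeasurableSpace Ω] {P : Measure Ω}

/-! ### Poisson processes -/

lemma measurable_encard_setOf {α : Type*} [MeasurableSpace α] {p : ℕ → α → Prop}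
    (hp : ∀ n, MeasurableSet {a | p n a}) : Measurable fun a => {n | p n a}.encard :=
  measurable_encard.comp (measurable_set_iff.2 fun n => measurableSet_setOfPred.1 (hp n))

lemma measurable_count {X : ℕ → Ω → Plane} (hX : ∀ n, Measurable (X n)) {B : Set Plane}
    (hB : MeasurableSet B) : Measurable fun ω => count (fun n => X n ω) B :=
  measurable_encard_setOf fun n => hX n hB

lemma count_union (x : ℕ → Plane) {A B : Set Plane} (h : Disjoint A B) :
    count x (A ∪ B) = count x A + count x B := by
  rw [count, count, count, ← encard_union_eq]
  · rfl
  · exact Disjoint.preimage x h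

lemma count_mono (x : ℕ → Plane) {A B : Set Plane} (h : A ⊆ B) : count x A ≤ count x B :=
  encard_le_encard fun _ hn => h hn

lemma count_empty (x : ℕ → Plane) : count x ∅ = 0 := by simp [count]

namespace IsPoissonProcess

variable {lam : ℝ} {X : ℕ → Ω → Plane}

lemma count_indep_fintype (hX : IsPoissonProcess P lam X) {ι : Type*} [Fintype ι]
    {B : ι → Set Plane} (hB : ∀ i, MeasurableSet (B i)) (hv : ∀ i, volume (B i) ≠ ∞)
    (hd : Pairwise fun i j => Disjoint (B i) (B j)) :
    iIndepFun (fun i ω => count (fun n => X n ω) (B i)) P := by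
  have e := Fintype.equivFin ι
  have := hX.count_indep _ (fun i => B (e.symm i)) (fun _ => hB _) (fun _ => hv _)
    (fun i j hij => hd (e.symm.injective.ne hij))
  simpa using this.precomp e.injective

/-- The generating function of the Poisson law, `E q^N = e^{-μ(1-q)}` with `q = e^{-a}`. Only an
inequality is stated because the term of the value `∞` of the count is dropped. -/
lemma laplace_count_le [IsProbabilityMeasure P] (hX : IsPoissonProcess P lam X) (hlam : 0 ≤ lam)
    {B : Set Plane} (hB : MeasurableSet B) (hv : volume B ≠ ∞) (a : ℝ≥0∞) :
    eneg (ENNReal.ofReal lam * ((1 - eneg a) * volume B)) ≤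
      ∫⁻ ω, eneg ((count (fun n => X n ω) B : ℝ≥0∞) * a) ∂P := by
  set N := fun ω => count (fun n => X n ω) B
  have hN : Measurable N := measurable_count hX.measurable hB
  set μ := lam * volume.real B
  have hμ : 0 ≤ μ := by positivity
  set q := (eneg a).toReal
  have hq : eneg a = ENNReal.ofReal q := (ENNReal.ofReal_toReal (eneg_ne_top a)).symm
  have hq0 : 0 ≤ q := ENNReal.toReal_nonneg
  have hq1 : q ≤ 1 := ENNReal.toReal_le_of_le_ofReal zero_le_one (by simpa using eneg_le_one a)
  have h1 : ∫⁻ ω, eneg ((N ω : ℝ≥0∞) * a) ∂P = ∑' k : ℕ∞, eneg ((k : ℝ≥0∞) * a) * P.map N {k} := by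
    rw [← lintegral_countable', lintegral_map (Measurable.of_discrete) hN]
  have h2 : ∑' k : ℕ, ENNReal.ofReal (exp (-μ) * (μ * q) ^ k / k.factorial) ≤
      ∑' k : ℕ∞, eneg ((k : ℝ≥0∞) * a) * P.map N {k} := by
    refine le_trans (le_of_eq (tsum_congr fun k => ?_))
      (ENNReal.tsum_comp_le_tsum_of_injective (f := ((↑) : ℕ → ℕ∞)) (fun _ _ h => by simpa using h) _)
    have h3 : P.map N {(k : ℕ∞)} = ENNReal.ofReal (exp (-μ) * μ ^ k / k.factorial) := by
      rw [Measure.map_apply hN (measurableSet_singleton _)]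
      exact hX.count_law B hB hv k
    rw [h3, ENat.toENNReal_coe, eneg_natCast_mul, hq, ← ENNReal.ofReal_pow hq0,
      ← ENNReal.ofReal_mul (by positivity), mul_pow]
    congr 1; ring
  rw [h1]
  refine le_trans (le_of_eq ?_) h2
  have hs : HasSum (fun k : ℕ => exp (-μ) * (μ * q) ^ k / k.factorial) (exp (-μ) * exp (μ * q)) := by
    have := (NormedSpace.expSeries_div_hasSum_exp (μ * q)).mul_left (exp (-μ))
    rw [← Real.exp_eq_exp_ℝ] at this
    simpa only [mul_div_assoc] using this
  rw [← ENNReal.ofReal_tsum_of_nonneg (fun k => by positivity) hs.summable, hs.tsum_eq, ← exp_add]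
  have h4 : ENNReal.ofReal lam * ((1 - eneg a) * volume B) = ENNReal.ofReal (μ - μ * q) := by
    rw [hq, ← ENNReal.ofReal_one, ← ENNReal.ofReal_sub _ hq0, ← ENNReal.ofReal_toReal hv,
      ← ENNReal.ofReal_mul (by linarith), ← ENNReal.ofReal_mul hlam]
    congr 1
    simp only [μ, Measure.real]
    ring
  rw [h4, eneg_ofReal (by nlinarith)]
  congr 2; ring

end IsPoissonProcess

/-- Points are grouped by the value of `g`. The value `0` is left out: it contributes nothing, and
its level set may have infinite area, where the Poisson law says nothing. -/
lemma tsum_simpleFunc_eq (g : SimpleFunc Plane ℝ≥0∞) (x : ℕ → Plane) :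
    ∑' n, g (x n) = ∑ a ∈ g.range with a ≠ 0, (count x (g ⁻¹' {a}) : ℝ≥0∞) * a := by
  have h1 : ∀ n, g (x n) = ∑ a ∈ g.range with a ≠ 0, (x ⁻¹' (g ⁻¹' {a})).indicator (fun _ => a) n := by
    intro n
    by_cases h0 : g (x n) = 0
    · rw [h0, Finset.sum_eq_zero]
      intro a ha
      rw [indicator_of_notMem]
      intro h
      have h : g (x n) = a := h
      exact (Finset.mem_filter.1 ha).2 (h ▸ h0)
    · rw [Finset.sum_eq_single (g (x n))]
      · rw [indicator_of_mem]; rfl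
      · intro a _ hne
        rw [indicator_of_notMem]
        exact fun h => hne (show g (x n) = a from h).symm
      · intro h
        exact absurd (Finset.mem_filter.2 ⟨g.mem_range_self _, h0⟩) h
  simp_rw [h1]
  rw [Summable.tsum_finsetSum fun _ _ => ENNReal.summable]
  refine Finset.sum_congr rfl fun a _ => ?_
  rw [← tsum_subtype, ENNReal.tsum_set_const]
  rfl

namespace IsPoissonProcess

variable {lam : ℝ} {X : ℕ → Ω → Plane}

/-- As `g` vanishes on every `Q i`, these sets and the nonzero level sets of `g` are pairwise
disjoint, so all their counts are independent. The expectation factors into the probability of the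
event and one Poisson generating function per level. -/
lemma laplace_simpleFunc_le [IsProbabilityMeasure P] (hX : IsPoissonProcess P lam X) (hlam : 0 ≤ lam)
    {ι : Type*} [Fintype ι] {Q : ι → Set Plane} (hQ : ∀ i, MeasurableSet (Q i))
    (hv : ∀ i, volume (Q i) ≠ ∞) (hd : Pairwise fun i j => Disjoint (Q i) (Q j))
    (E : Set (ι → ℕ∞)) (g : SimpleFunc Plane ℝ≥0∞)
    (hg : ∀ a, a ≠ 0 → volume (g ⁻¹' {a}) ≠ ∞) (hgQ : ∀ i, ∀ y ∈ Q i, g y = 0) :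
    P {ω | (fun i => count (fun n => X n ω) (Q i)) ∈ E} *
        eneg (ENNReal.ofReal lam * ∫⁻ y, (1 - eneg (g y))) ≤
      ∫⁻ ω in {ω | (fun i => count (fun n => X n ω) (Q i)) ∈ E}, eneg (∑' n, g (X n ω)) ∂P := by
  classical
  set s := g.range.filter (· ≠ 0) with hs
  set D : ι ⊕ s → Set Plane := Sum.elim Q (fun a => g ⁻¹' {(a : ℝ≥0∞)}) with hD
  have hs0 : ∀ a : s, (a : ℝ≥0∞) ≠ 0 := fun a => (Finset.mem_filter.1 a.2).2
  have hDm : ∀ i, MeasurableSet (D i) := by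
    rintro (i | a)
    · exact hQ i
    · exact g.measurableSet_fiber _
  have hDd : Pairwise fun i j => Disjoint (D i) (D j) := by
    have key : ∀ (i : ι) (a : s), Disjoint (Q i) (g ⁻¹' {(a : ℝ≥0∞)}) := fun i a =>
      disjoint_left.2 fun y hy (hya : g y = a) => hs0 a (hya ▸ hgQ i y hy)
    rintro (i | a) (j | b) hij
    · exact hd (by simpa using hij)
    · exact key i b
    · exact (key j a).symm
    · refine disjoint_left.2 fun y (hy : g y = a) (hy' : g y = b) => hij ?_
      rw [Subtype.ext (hy.symm.trans hy')]
  have hind := hX.count_indep_fintype hDm (by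
    rintro (i | a)
    · exact hv i
    · exact hg _ (hs0 a)) hDd
  set N : ι ⊕ s → Ω → ℕ∞ := fun i ω => count (fun n => X n ω) (D i) with hN
  have hNm : ∀ i, Measurable (N i) := fun i => measurable_count hX.measurable (hDm i)
  have hpair := hind.indepFun_finset (Finset.univ.map Function.Embedding.inl)
    (Finset.univ.map Function.Embedding.inr) (by
      rw [Finset.disjoint_left]; simp) hNm
  have hA : MeasurableSet {ω | (fun i => count (fun n => X n ω) (Q i)) ∈ E} := by
    have : Measurable fun ω i => count (fun n => X n ω) (Q i) :=
      measurable_pi_lambda _ fun i => measurable_count hX.measurable (hQ i)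
    exact this (MeasurableSet.of_discrete)
  have hexp : ∀ ω, eneg (∑' n, g (X n ω)) = ∏ a : s, eneg ((N (Sum.inr a) ω : ℝ≥0∞) * a) := by
    intro ω
    rw [tsum_simpleFunc_eq, ← hs, ← Finset.sum_coe_sort, eneg_sum]
    rfl
  have hI1 : IndepFun (fun ω => ({ω | (fun i => count (fun n => X n ω) (Q i)) ∈ E}.indicator 1 ω : ℝ≥0∞))
      (fun ω => ∏ a : s, eneg ((N (Sum.inr a) ω : ℝ≥0∞) * a)) P := by
    refine hpair.comp
      (φ := fun v => (E.indicator 1 fun i => v ⟨Sum.inl i, by simp⟩ : ℝ≥0∞))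
      (ψ := fun v => ∏ a : s, eneg ((v ⟨Sum.inr a, by simp⟩ : ℝ≥0∞) * a)) ?_ ?_
    · exact Measurable.of_discrete
    · exact Measurable.of_discrete
  have hind2 : iIndepFun (fun (a : s) ω => eneg ((N (Sum.inr a) ω : ℝ≥0∞) * a)) P :=
    (hind.precomp Sum.inr_injective).comp (fun (a : s) k => eneg ((k : ℝ≥0∞) * a))
      fun _ => Measurable.of_discrete
  have hFm : ∀ a : s, Measurable fun ω => eneg ((N (Sum.inr a) ω : ℝ≥0∞) * a) := fun a =>
    (Measurable.of_discrete (f := fun k : ℕ∞ => eneg ((k : ℝ≥0∞) * a))).comp (hNm _)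
  rw [lintegral_congr hexp, ← lintegral_indicator hA]
  have h1 : ∀ ω, {ω | (fun i => count (fun n => X n ω) (Q i)) ∈ E}.indicator
      (fun ω => ∏ a : s, eneg ((N (Sum.inr a) ω : ℝ≥0∞) * a)) ω =
      ({ω | (fun i => count (fun n => X n ω) (Q i)) ∈ E}.indicator 1 ω : ℝ≥0∞) *
        ∏ a : s, eneg ((N (Sum.inr a) ω : ℝ≥0∞) * a) := by
    intro ω
    by_cases h : ω ∈ {ω | (fun i => count (fun n => X n ω) (Q i)) ∈ E} <;> simp [indicator, h]
  rw [lintegral_congr h1, lintegral_mul_eq_lintegral_mul_lintegral_of_indepFun''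
    (measurable_one.indicator hA).aemeasurable
    (Finset.measurable_prod _ fun a _ => hFm a).aemeasurable hI1, lintegral_indicator_one hA,
    lintegral_prod_eq_prod_lintegral_of_indepFun _ _ hind2 hFm]
  gcongr
  have h2 : ∫⁻ y, (1 - eneg (g y)) = ∑ a : s, (1 - eneg a) * volume (g ⁻¹' {(a : ℝ≥0∞)}) := by
    have := SimpleFunc.map_lintegral (μ := volume) (fun a => 1 - eneg a) g
    rw [← SimpleFunc.lintegral_eq_lintegral] at this
    refine (this.trans ?_)
    rw [Finset.sum_coe_sort s (fun a => (1 - eneg a) * volume (g ⁻¹' {(a : ℝ≥0∞)})), hs,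
      Finset.sum_filter]
    refine Finset.sum_congr rfl fun a _ => ?_
    by_cases ha : a = 0 <;> simp [ha]
  rw [h2, Finset.mul_sum, eneg_sum]
  exact Finset.prod_le_prod' fun a _ =>
    hX.laplace_count_le hlam (g.measurableSet_fiber _) (hg _ (hs0 a)) a

/-- Lower bound for the Laplace functional of a Poisson process, jointly with an event that depends
on the points in a disjoint set. -/
lemma laplace_le [IsProbabilityMeasure P] (hX : IsPoissonProcess P lam X) (hlam : 0 ≤ lam)
    {ι : Type*} [Fintype ι] {Q : ι → Set Plane} (hQ : ∀ i, MeasurableSet (Q i))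
    (hv : ∀ i, volume (Q i) ≠ ∞) (hd : Pairwise fun i j => Disjoint (Q i) (Q j))
    (E : Set (ι → ℕ∞)) {f : Plane → ℝ≥0∞} (hf : Measurable f) (hfQ : ∀ i, ∀ y ∈ Q i, f y = 0) :
    P {ω | (fun i => count (fun n => X n ω) (Q i)) ∈ E} *
        eneg (ENNReal.ofReal lam * ∫⁻ y, (1 - eneg (f y))) ≤
      ∫⁻ ω in {ω | (fun i => count (fun n => X n ω) (Q i)) ∈ E}, eneg (∑' n, f (X n ω)) ∂P := by
  -- Simple functions increasing to `f`, cut off to balls of radius `m` so that their nonzero level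
  -- sets have finite area.
  set g : ℕ → SimpleFunc Plane ℝ≥0∞ := fun m =>
    (SimpleFunc.eapprox f m).restrict (Metric.closedBall 0 m) with hg
  have hgapp : ∀ m y, g m y = (Metric.closedBall (0 : Plane) m).indicator (SimpleFunc.eapprox f m) y :=
    fun m y => SimpleFunc.restrict_apply _ Metric.isClosed_closedBall.measurableSet y
  have hle : ∀ m y, g m y ≤ f y := by
    intro m y
    rw [hgapp, ← SimpleFunc.iSup_eapprox_apply hf y]
    exact (indicator_le_self' (fun _ _ => zero_le) _).trans (le_iSup (fun n => SimpleFunc.eapprox f n y) m)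
  have hmono : ∀ y, Monotone fun m => g m y := by
    intro y m m' hmm
    simp only [hgapp]
    refine (indicator_le_indicator (SimpleFunc.monotone_eapprox f hmm y)).trans ?_
    exact indicator_le_indicator_of_subset
      (Metric.closedBall_subset_closedBall (by exact_mod_cast hmm)) (fun _ => zero_le) _
  have hlim : ∀ y, Filter.Tendsto (fun m => g m y) Filter.atTop (nhds (f y)) := by
    intro y
    have h1 : Filter.Tendsto (fun m => SimpleFunc.eapprox f m y) Filter.atTop (nhds (f y)) := by
      rw [← SimpleFunc.iSup_eapprox_apply hf y]
      exact tendsto_atTop_iSup fun m m' h => SimpleFunc.monotone_eapprox f h y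
    refine h1.congr' ?_
    filter_upwards [Filter.eventually_ge_atTop ⌈‖y‖⌉₊] with m hm
    rw [hgapp, indicator_of_mem]
    rw [mem_closedBall_zero_iff]
    exact Nat.ceil_le.1 hm
  have hsum : ∀ ω, Filter.Tendsto (fun m => ∑' n, g m (X n ω)) Filter.atTop
      (nhds (∑' n, f (X n ω))) := by
    intro ω
    simp only [← lintegral_count]
    exact lintegral_tendsto_of_tendsto_of_monotone (fun m => Measurable.of_discrete.aemeasurable)
      (.of_forall fun n => hmono _) (.of_forall fun n => hlim _)
  have hL : Filter.Tendsto (fun m => ∫⁻ ω in {ω | (fun i => count (fun n => X n ω) (Q i)) ∈ E},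
      eneg (∑' n, g m (X n ω)) ∂P) Filter.atTop
      (nhds (∫⁻ ω in {ω | (fun i => count (fun n => X n ω) (Q i)) ∈ E},
        eneg (∑' n, f (X n ω)) ∂P)) := by
    refine tendsto_lintegral_of_dominated_convergence (fun _ => 1) (fun m => ?_)
      (fun m => .of_forall fun _ => eneg_le_one _) (by simp)
      (.of_forall fun ω => (continuous_eneg.tendsto _).comp (hsum ω))
    exact measurable_eneg.comp (Measurable.tsum fun n => (g m).measurable.comp (hX.measurable n))
  -- Because `g m ≤ f`, the left side is already below the bound for each `g m`; only the right side
  -- needs a limit.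
  refine ge_of_tendsto' hL fun m => ?_
  refine le_trans ?_ (hX.laplace_simpleFunc_le hlam hQ hv hd E (g m) ?_ ?_)
  · gcongr
    refine eneg_antitone ?_
    gcongr with y
    exact eneg_antitone (hle m y)
  · intro a ha
    refine ne_top_of_le_ne_top (measure_closedBall_lt_top (x := (0 : Plane)) (r := m)).ne
      (measure_mono fun y (hy : g m y = a) => ?_)
    by_contra h
    rw [hgapp, indicator_of_notMem h] at hy
    exact ha hy.symm
  · intro i y hy
    exact le_antisymm ((hle m y).trans (hfQ i y hy).le) zero_le

end IsPoissonProcess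

end CloudRadio

namespace CloudRadio

/-! ### Ordered distances -/

section nthDist

variable {k : ℕ} {x : ℕ → Plane} {u : Plane}

lemma encard_dist_lt (x : ℕ → Plane) (u : Plane) (t : ℝ) :
    {n | dist u (x n) < t}.encard = count x (Metric.ball u t) := by
  simp only [count, Metric.mem_ball, dist_comm u]

lemma encard_dist_le (x : ℕ → Plane) (u : Plane) (t : ℝ) :
    {n | dist u (x n) ≤ t}.encard = count x (Metric.closedBall u t) := by
  simp only [count, Metric.mem_closedBall, dist_comm u]

lemma nonneg_of_le_encard (hk : 1 ≤ k) {r : ℝ} (h : (k : ℕ∞) ≤ {n | dist u (x n) ≤ r}.encard) :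
    0 ≤ r := by
  have h1 : {n | dist u (x n) ≤ r}.Nonempty := by
    rw [← one_le_encard_iff_nonempty]
    exact le_trans (by exact_mod_cast hk) h
  obtain ⟨n, hn⟩ := h1
  exact dist_nonneg.trans hn

lemma bddBelow_nthDist (hk : 1 ≤ k) (x : ℕ → Plane) (u : Plane) :
    BddBelow {r : ℝ | (k : ℕ∞) ≤ {n | dist u (x n) ≤ r}.encard} :=
  ⟨0, fun _ h => nonneg_of_le_encard hk h⟩

lemma nthDist_nonneg (hk : 1 ≤ k) (x : ℕ → Plane) (u : Plane) : 0 ≤ nthDist k x u :=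
  Real.sInf_nonneg fun _ h => nonneg_of_le_encard hk h

lemma nthDist_le (hk : 1 ≤ k) {r : ℝ} (h : (k : ℕ∞) ≤ {n | dist u (x n) ≤ r}.encard) :
    nthDist k x u ≤ r :=
  csInf_le (bddBelow_nthDist hk x u) h

/-- Among `k` points at distance less than `t` there is a farthest one, so the infimum is still less
than `t`. The assumption `hne` rules out the default value `sInf ∅ = 0`. -/
lemma nthDist_lt_iff (hk : 1 ≤ k) (hne : ∃ r : ℝ, (k : ℕ∞) ≤ {n | dist u (x n) ≤ r}.encard) {t : ℝ} :
    nthDist k x u < t ↔ (k : ℕ∞) ≤ {n | dist u (x n) < t}.encard := by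
  constructor
  · intro h
    obtain ⟨r, hr, hrt⟩ := exists_lt_of_csInf_lt hne h
    exact le_trans hr (encard_le_encard fun n (hn : dist u (x n) ≤ r) => hn.trans_lt hrt)
  · intro h
    obtain ⟨S, hS, hSk⟩ := exists_subset_encard_eq h
    have hfin : S.Finite := finite_of_encard_eq_coe hSk
    have hSne : S.Nonempty := by
      rw [← one_le_encard_iff_nonempty, hSk]
      exact_mod_cast hk
    obtain ⟨m, hm, hmax⟩ := hfin.exists_maximalFor (fun n => dist u (x n)) S hSne
    refine lt_of_le_of_lt (nthDist_le hk (r := dist u (x m)) ?_) (hS hm)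
    rw [← hSk]
    exact encard_le_encard fun n hn => (le_total (dist u (x n)) (dist u (x m))).elim id (hmax hn)

lemma le_nthDist_iff (hk : 1 ≤ k) (hne : ∃ r : ℝ, (k : ℕ∞) ≤ {n | dist u (x n) ≤ r}.encard) {t : ℝ} :
    t ≤ nthDist k x u ↔ count x (Metric.ball u t) < k := by
  rw [← not_lt, nthDist_lt_iff hk hne, encard_dist_lt, not_le]

lemma measurable_nthDist {α : Type*} [MeasurableSpace α] (hk : 1 ≤ k) {X : ℕ → α → Plane}
    {U : α → Plane} (hX : ∀ n, Measurable (X n)) (hU : Measurable U) :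
    Measurable fun a => nthDist k (fun n => X n a) (U a) := by
  refine measurable_of_Iio fun t => ?_
  have hd : ∀ n, Measurable fun a => dist (U a) (X n a) := fun n => hU.dist (hX n)
  have hle : ∀ r : ℝ, MeasurableSet {a | (k : ℕ∞) ≤ {n | dist (U a) (X n a) ≤ r}.encard} := fun r =>
    measurable_encard_setOf (fun n => measurableSet_le (hd n) measurable_const)
      (MeasurableSet.of_discrete (s := Ici (k : ℕ∞)))
  have hlt : MeasurableSet {a | (k : ℕ∞) ≤ {n | dist (U a) (X n a) < t}.encard} :=
    measurable_encard_setOf (fun n => measurableSet_lt (hd n) measurable_const)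
      (MeasurableSet.of_discrete (s := Ici (k : ℕ∞)))
  -- `N` is where the infimum runs over a nonempty set; off `N` the distance has the default value
  -- `0`, so a sublevel set there is everything or nothing.
  set N : Set α := ⋃ j : ℕ, {a | (k : ℕ∞) ≤ {n | dist (U a) (X n a) ≤ j}.encard} with hN
  have hNm : MeasurableSet N := MeasurableSet.iUnion fun j => hle j
  have hNe : ∀ a, a ∈ N ↔ ∃ r : ℝ, (k : ℕ∞) ≤ {n | dist (U a) (X n a) ≤ r}.encard := by
    intro a
    rw [hN, mem_iUnion]
    refine ⟨fun ⟨j, hj⟩ => ⟨j, hj⟩, fun ⟨r, hr⟩ => ⟨⌈r⌉₊, ?_⟩⟩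
    exact le_trans hr (encard_le_encard fun n (hn : _ ≤ r) => hn.trans (Nat.le_ceil r))
  have : (fun a => nthDist k (fun n => X n a) (U a)) ⁻¹' Iio t =
      (N ∩ {a | (k : ℕ∞) ≤ {n | dist (U a) (X n a) < t}.encard}) ∪ (Nᶜ ∩ {_a | 0 < t}) := by
    ext a
    by_cases ha : a ∈ N
    · have := nthDist_lt_iff hk ((hNe a).1 ha) (t := t)
      simpa [ha] using this
    · have h0 : nthDist k (fun n => X n a) (U a) = 0 := by
        rw [nthDist]
        convert Real.sInf_empty
        rw [eq_empty_iff_forall_notMem]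
        exact fun r hr => ha ((hNe a).2 ⟨r, hr⟩)
      simp [ha, h0]
  rw [this]
  exact (hNm.inter hlt).union (hNm.compl.inter (MeasurableSet.const _))

end nthDist

/-! ### Laws of the ordered distances -/

section calculus

lemma lintegral_Ici_deriv {G g : ℝ → ℝ} {a l : ℝ} (hd : ∀ x, HasDerivAt G (g x) x)
    (hnn : ∀ x ∈ Ioi a, 0 ≤ g x) (hl : Filter.Tendsto G Filter.atTop (nhds l)) :
    ∫⁻ x in Ici a, ENNReal.ofReal (g x) = ENNReal.ofReal (l - G a) := by
  have hi := integrableOn_Ioi_deriv_of_nonneg (hd a).continuousAt.continuousWithinAt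
    (fun x _ => hd x) hnn hl
  rw [← Measure.restrict_congr_set Ioi_ae_eq_Ici, ← ofReal_integral_eq_lintegral_ofReal hi
    ((ae_restrict_iff' measurableSet_Ioi).2 (.of_forall hnn)),
    integral_Ioi_of_hasDerivAt_of_nonneg (hd a).continuousAt.continuousWithinAt
    (fun x _ => hd x) hnn hl]

lemma lintegral_Ico_deriv {G g : ℝ → ℝ} {a b : ℝ} (hab : a ≤ b) (hd : ∀ x, HasDerivAt G (g x) x)
    (hg : Continuous g) (hnn : ∀ x ∈ Icc a b, 0 ≤ g x) :
    ∫⁻ x in Ico a b, ENNReal.ofReal (g x) = ENNReal.ofReal (G b - G a) := by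
  rw [Measure.restrict_congr_set (Ico_ae_eq_Ioc (μ := volume)),
    ← ofReal_integral_eq_lintegral_ofReal (hg.integrableOn_Icc.mono_set Ioc_subset_Icc_self)
    ((ae_restrict_iff' measurableSet_Ioc).2 (.of_forall fun x hx => hnn x (Ioc_subset_Icc_self hx))),
    ← intervalIntegral.integral_of_le hab,
    intervalIntegral.integral_eq_sub_of_hasDerivAt (fun x _ => hd x) (hg.intervalIntegrable _ _)]

/-- Partial sums of the exponential series. -/
noncomputable def expSum (n : ℕ) (v : ℝ) : ℝ := ∑ k ∈ Finset.range n, v ^ k / k.factorial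

lemma expSum_zero_right (n : ℕ) : expSum (n + 1) 0 = 1 := by
  simp [expSum, Finset.sum_range_succ']

lemma expSum_nonneg (n : ℕ) {v : ℝ} (hv : 0 ≤ v) : 0 ≤ expSum n v :=
  Finset.sum_nonneg fun _ _ => by positivity

lemma continuous_expSum (n : ℕ) : Continuous (expSum n) := by
  unfold expSum; fun_prop

lemma hasDerivAt_expSum (n : ℕ) (v : ℝ) : HasDerivAt (expSum (n + 1)) (expSum n v) v := by
  induction n with
  | zero =>
    have h0 : expSum (0 + 1) = fun _ => 1 := by ext v; simp [expSum]
    rw [h0]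
    simpa [expSum] using hasDerivAt_const v (1 : ℝ)
  | succ n ih =>
    have h1 : HasDerivAt (fun v : ℝ => v ^ (n + 1) / (n + 1).factorial) (v ^ n / n.factorial) v := by
      have := (hasDerivAt_pow (n + 1) v).div_const ((n + 1).factorial : ℝ)
      refine this.congr_deriv ?_
      rw [Nat.factorial_succ]
      push_cast
      field_simp
    have h2 : expSum (n + 1 + 1) = fun v => expSum (n + 1) v + v ^ (n + 1) / (n + 1).factorial := by
      ext v; simp [expSum, Finset.sum_range_succ _ (n + 1)]
    rw [h2]
    refine (ih.add h1).congr_deriv ?_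
    simp [expSum, Finset.sum_range_succ]

/-- The product rule telescopes. In probability: a Poisson variable of mean `v` is at most `n` with
probability `e^{-v}` times the partial sum, and differentiating in `v` gives minus the gamma
density. -/
lemma hasDerivAt_exp_neg_mul_expSum (n : ℕ) (v : ℝ) :
    HasDerivAt (fun v => exp (-v) * expSum (n + 1) v) (-(exp (-v) * (v ^ n / n.factorial))) v := by
  have := (hasDerivAt_neg v).exp.mul (hasDerivAt_expSum n v)
  refine this.congr_deriv ?_
  simp only [expSum, Finset.sum_range_succ]
  ring

lemma tendsto_exp_neg_mul_expSum (n : ℕ) :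
    Filter.Tendsto (fun v => exp (-v) * expSum n v) Filter.atTop (nhds 0) := by
  simp only [expSum, Finset.mul_sum]
  rw [← Finset.sum_const_zero (s := Finset.range n)]
  refine tendsto_finsetSum _ fun k _ => ?_
  have := (tendsto_pow_mul_exp_neg_atTop_nhds_zero k).div_const (k.factorial : ℝ)
  simp only [zero_div] at this
  refine this.congr fun v => ?_
  ring

variable {lam : ℝ}

/-- In the variable `v = πλ(y² - r²)`, the mean number of points between the circles of radii `r`
and `y`, the density is the gamma density of order `L`; its tail is the probability that a Poisson
variable of mean `v` is less than `L`. -/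
lemma lintegral_pdfInterferer (hlam : 0 < lam) {L : ℕ} (hL : 1 ≤ L) {r x : ℝ} (hr : 0 ≤ r) (hx : r ≤ x) :
    ∫⁻ y in Ici x, ENNReal.ofReal (pdfInterferer lam L r y) =
      ENNReal.ofReal (exp (-(π * lam * (x ^ 2 - r ^ 2))) * expSum L (π * lam * (x ^ 2 - r ^ 2))) := by
  obtain ⟨n, rfl⟩ : ∃ n, L = n + 1 := ⟨L - 1, by omega⟩
  set v : ℝ → ℝ := fun y => π * lam * (y ^ 2 - r ^ 2) with hv
  have hvd : ∀ y, HasDerivAt v (π * lam * (2 * y)) y := fun y => by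
    have := ((hasDerivAt_pow 2 y).sub_const (r ^ 2)).const_mul (π * lam)
    simpa using this
  have hd : ∀ y, HasDerivAt (fun y => -(exp (-(v y)) * expSum (n + 1) (v y)))
      (exp (-(v y)) * (v y ^ n / n.factorial) * (π * lam * (2 * y))) y := fun y => by
    have := ((hasDerivAt_exp_neg_mul_expSum n (v y)).comp y (hvd y)).neg
    refine HasDerivAt.congr_deriv (f := fun y => -(exp (-(v y)) * expSum (n + 1) (v y))) this ?_
    ring
  have hvlim : Filter.Tendsto v Filter.atTop Filter.atTop := by
    refine Filter.Tendsto.const_mul_atTop (by positivity) ?_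
    exact Filter.tendsto_atTop_add_const_right _ _ (Filter.tendsto_pow_atTop two_ne_zero)
  have hl := ((tendsto_exp_neg_mul_expSum (n + 1)).comp hvlim).neg
  have hnn : ∀ y ∈ Ioi x, 0 ≤ exp (-(v y)) * (v y ^ n / n.factorial) * (π * lam * (2 * y)) := by
    intro y hy
    have h1 : r ≤ y := hx.trans (le_of_lt hy)
    have h2 : 0 ≤ y := hr.trans h1
    have h3 : 0 ≤ v y := mul_nonneg (by positivity) (by nlinarith)
    positivity
  have := lintegral_Ici_deriv hd hnn hl
  simp only [neg_zero, sub_neg_eq_add, zero_add] at this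
  rw [← this]
  refine setLIntegral_congr_fun measurableSet_Ici fun y hy => ?_
  have h1 : r ≤ y := hx.trans hy
  simp only [pdfInterferer, h1, if_true, hv, Nat.add_sub_cancel]
  congr 1
  rw [mul_pow (π * lam), pow_succ (π * lam)]
  ring

lemma lintegral_pdfServing (hlam : 0 < lam) {t : ℝ} (ht : 0 ≤ t) :
    ∫⁻ r in Ici t, ENNReal.ofReal (pdfServing lam r) = ENNReal.ofReal (exp (-(π * lam * t ^ 2))) := by
  have hvd : ∀ y : ℝ, HasDerivAt (fun y => -exp (-(lam * π * y ^ 2)))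
      (2 * π * lam * y * exp (-(lam * π * y ^ 2))) y := fun y => by
    have := (((hasDerivAt_pow 2 y).const_mul (lam * π)).neg).exp.neg
    refine HasDerivAt.congr_deriv (f := fun y => -exp (-(lam * π * y ^ 2))) this ?_
    simp only [Pi.neg_apply]
    norm_num; ring
  have hl : Filter.Tendsto (fun y : ℝ => -exp (-(lam * π * y ^ 2))) Filter.atTop (nhds (-0)) := by
    refine (tendsto_exp_atBot.comp (Filter.tendsto_neg_atTop_atBot.comp ?_)).neg
    exact Filter.Tendsto.const_mul_atTop (by positivity) (Filter.tendsto_pow_atTop two_ne_zero)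
  have := lintegral_Ici_deriv (a := t) hvd (fun y (hy : t < y) => by
    have : 0 ≤ y := ht.trans hy.le
    positivity) hl
  rw [neg_zero, zero_sub, neg_neg, mul_comm lam π] at this
  rw [← this]
  refine setLIntegral_congr_fun measurableSet_Ici fun y hy => ?_
  have h1 : 0 ≤ y := ht.trans hy
  simp only [pdfServing, h1, if_true]
  rw [mul_comm lam π]

lemma measurable_pdfServing : Measurable (pdfServing lam) := by
  unfold pdfServing
  exact Measurable.ite measurableSet_Ici (by fun_prop) measurable_const

lemma measurable_pdfInterferer {L : ℕ} :
    Measurable (fun p : ℝ × ℝ => pdfInterferer lam L p.1 p.2) := by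
  unfold pdfInterferer
  exact Measurable.ite (measurableSet_le measurable_fst measurable_snd) (by fun_prop) measurable_const

lemma pdfServing_nonneg (hlam : 0 < lam) (r : ℝ) : 0 ≤ pdfServing lam r := by
  unfold pdfServing
  split_ifs <;> positivity

/-- The joint law of the distances to the nearest point and to the `L + 1`-st nearest point. -/
noncomputable def distLaw (lam : ℝ) (L : ℕ) : Measure (ℝ × ℝ) :=
  (volume : Measure (ℝ × ℝ)).withDensity
    fun p => ENNReal.ofReal (pdfServing lam p.1 * pdfInterferer lam L p.1 p.2)

lemma distLaw_prod {L : ℕ} (hlam : 0 < lam) {A B : Set ℝ} (hA : MeasurableSet A) (hB : MeasurableSet B) :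
    distLaw lam L (A ×ˢ B) = ∫⁻ r in A, ENNReal.ofReal (pdfServing lam r) *
      ∫⁻ y in B, ENNReal.ofReal (pdfInterferer lam L r y) := by
  have hm : Measurable fun p : ℝ × ℝ =>
      ENNReal.ofReal (pdfServing lam p.1 * pdfInterferer lam L p.1 p.2) :=
    ((measurable_pdfServing.comp measurable_fst).mul measurable_pdfInterferer).ennreal_ofReal
  rw [distLaw, withDensity_apply _ (hA.prod hB), Measure.volume_eq_prod, ← Measure.prod_restrict,
    lintegral_prod _ hm.aemeasurable]
  refine lintegral_congr fun r => ?_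
  rw [← lintegral_const_mul]
  · exact lintegral_congr fun y => ENNReal.ofReal_mul (pdfServing_nonneg hlam r)
  · exact (measurable_pdfInterferer.comp (measurable_const.prodMk measurable_id)).ennreal_ofReal

/-- The right side is the probability of no point within `s` and at most `L` points between `s` and
`t`. The integral over the first distance is split at `t`: beyond `t` the second density has mass
`1`, and below `t` its tail is a partial exponential sum, which can be integrated explicitly. -/
lemma distLaw_Ici (hlam : 0 < lam) {L : ℕ} (hL : 1 ≤ L) {s t : ℝ} (hs : 0 ≤ s) (hst : s ≤ t) :
    distLaw lam L (Ici s ×ˢ Ici t) =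
      ENNReal.ofReal (exp (-(π * lam * t ^ 2)) * expSum (L + 1) (π * lam * (t ^ 2 - s ^ 2))) := by
  have ht : 0 ≤ t := hs.trans hst
  rw [distLaw_prod hlam measurableSet_Ici measurableSet_Ici, ← Ico_union_Ici_eq_Ici hst,
    lintegral_union measurableSet_Ici (disjoint_left.2 fun x hx hx' => not_lt.2 hx' hx.2)]
  have h2 : ∫⁻ r in Ici t, ENNReal.ofReal (pdfServing lam r) *
      ∫⁻ y in Ici t, ENNReal.ofReal (pdfInterferer lam L r y) =
      ENNReal.ofReal (exp (-(π * lam * t ^ 2))) := by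
    rw [← lintegral_pdfServing hlam ht]
    refine setLIntegral_congr_fun measurableSet_Ici fun r hr => ?_
    have h0 : 0 ≤ r := ht.trans hr
    have h3 : ∫⁻ y in Ici t, ENNReal.ofReal (pdfInterferer lam L r y) = 1 := by
      have := lintegral_pdfInterferer hlam hL h0 le_rfl
      obtain ⟨n, rfl⟩ : ∃ n, L = n + 1 := ⟨L - 1, by omega⟩
      rw [sub_self, mul_zero, neg_zero, exp_zero, expSum_zero_right, mul_one, ENNReal.ofReal_one] at this
      rw [← this, ← Ico_union_Ici_eq_Ici (show t ≤ r from hr),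
        lintegral_union measurableSet_Ici (disjoint_left.2 fun x hx hx' => not_lt.2 hx' hx.2)]
      rw [setLIntegral_congr_fun (g := fun _ => 0) measurableSet_Ico, lintegral_zero, zero_add]
      intro y hy
      simp [pdfInterferer, not_le.2 hy.2]
    rw [h3, mul_one]
  have hvd : ∀ r, HasDerivAt (fun r : ℝ => π * lam * (t ^ 2 - r ^ 2)) (π * lam * (-(2 * r))) r := fun y => by
    have := ((hasDerivAt_pow 2 y).const_sub (t ^ 2)).const_mul (π * lam)
    simpa using this
  -- The product of the first density and the tail of the second has the constant exponential factor
  -- `e^{-πλt²}`, so a partial sum with one more term is a primitive.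
  have hd : ∀ r, HasDerivAt (fun r => -(exp (-(π * lam * t ^ 2)) *
      expSum (L + 1) (π * lam * (t ^ 2 - r ^ 2))))
      (exp (-(π * lam * t ^ 2)) * (expSum L (π * lam * (t ^ 2 - r ^ 2)) * (π * lam * (2 * r)))) r := fun r => by
    have := (((hasDerivAt_expSum L _).comp r (hvd r)).const_mul (exp (-(π * lam * t ^ 2)))).neg
    refine HasDerivAt.congr_deriv (f := fun r => -(exp (-(π * lam * t ^ 2)) *
      expSum (L + 1) (π * lam * (t ^ 2 - r ^ 2)))) this ?_
    ring
  have hvn : ∀ r ∈ Icc s t, 0 ≤ π * lam * (t ^ 2 - r ^ 2) := fun r hr =>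
    mul_nonneg (by positivity) (by nlinarith [hr.1, hr.2])
  have h1 : ∫⁻ r in Ico s t, ENNReal.ofReal (pdfServing lam r) *
      ∫⁻ y in Ici t, ENNReal.ofReal (pdfInterferer lam L r y) =
      ENNReal.ofReal (-exp (-(π * lam * t ^ 2)) +
        exp (-(π * lam * t ^ 2)) * expSum (L + 1) (π * lam * (t ^ 2 - s ^ 2))) := by
    have := lintegral_Ico_deriv hst hd
      (((continuous_expSum L).comp (by fun_prop)).mul (by fun_prop) |>.const_mul _) (fun r hr => by
        have h0 : 0 ≤ r := hs.trans hr.1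
        have := expSum_nonneg L (hvn r hr)
        positivity)
    rw [sub_self, mul_zero, expSum_zero_right, mul_one, sub_neg_eq_add] at this
    rw [← this]
    refine setLIntegral_congr_fun measurableSet_Ico fun r hr => ?_
    have h0 : 0 ≤ r := hs.trans hr.1
    rw [lintegral_pdfInterferer hlam hL h0 hr.2.le, ← ENNReal.ofReal_mul (pdfServing_nonneg hlam r)]
    congr 1
    simp only [pdfServing, h0, if_true]
    have h5 : exp (-(π * lam * t ^ 2)) = exp (-(lam * π * r ^ 2)) * exp (-(π * lam * (t ^ 2 - r ^ 2))) := by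
      rw [← exp_add]; congr 1; ring
    rw [h5]; ring
  rw [h1, h2, ← ENNReal.ofReal_add _ (exp_pos _).le]
  · congr 1; ring
  · have h6 : 1 ≤ expSum (L + 1) (π * lam * (t ^ 2 - s ^ 2)) := by
      have := hvn s ⟨le_rfl, hst⟩
      rw [expSum, Finset.sum_range_succ']
      simp only [pow_zero, Nat.factorial_zero, Nat.cast_one, div_one]
      linarith [Finset.sum_nonneg (s := Finset.range L) (f := fun k =>
        (π * lam * (t ^ 2 - s ^ 2)) ^ (k + 1) / ((k + 1).factorial : ℝ)) fun _ _ => by positivity]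
    nlinarith [exp_pos (-(π * lam * t ^ 2))]

lemma distLaw_compl {L : ℕ} : distLaw lam L {p | 0 ≤ p.1 ∧ p.1 ≤ p.2}ᶜ = 0 := by
  have hK : MeasurableSet {p : ℝ × ℝ | 0 ≤ p.1 ∧ p.1 ≤ p.2} :=
    (measurableSet_le measurable_const measurable_fst).inter
      (measurableSet_le measurable_fst measurable_snd)
  rw [distLaw, withDensity_apply _ hK.compl,
    setLIntegral_congr_fun (g := fun _ => 0) hK.compl, lintegral_zero]
  intro p hp
  simp only [mem_compl_iff, mem_ofPred_eq, not_and_or] at hp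
  rcases hp with hp | hp <;> simp [pdfServing, pdfInterferer, hp]

/-- Half-lines determine finite measures on the line. This is applied to the second marginal of the
restriction to a strip `Ici s ×ˢ univ`, and then, for fixed `B`, to the first marginal of the
restriction to `univ ×ˢ B`. -/
lemma ext_of_Ici_prod {μ ν : Measure (ℝ × ℝ)} [IsFiniteMeasure μ]
    (h : ∀ s t : ℝ, μ (Ici s ×ˢ Ici t) = ν (Ici s ×ˢ Ici t)) : μ = ν := by
  have h1 : ∀ (s : ℝ) (B : Set ℝ), MeasurableSet B → μ (Ici s ×ˢ B) = ν (Ici s ×ˢ B) := by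
    intro s B hB
    have hform : ∀ (κ : Measure (ℝ × ℝ)) (B : Set ℝ), MeasurableSet B →
        (κ.restrict (Ici s ×ˢ univ)).map Prod.snd B = κ (Ici s ×ˢ B) := by
      intro κ B hB
      rw [Measure.map_apply measurable_snd hB, Measure.restrict_apply (measurable_snd hB)]
      congr 1; ext p; simp [and_comm]
    have : (μ.restrict (Ici s ×ˢ univ)).map Prod.snd = (ν.restrict (Ici s ×ˢ univ)).map Prod.snd :=
      Measure.ext_of_Ici _ _ fun t => by
        rw [hform _ _ measurableSet_Ici, hform _ _ measurableSet_Ici, h]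
    rw [← hform μ B hB, this, hform ν B hB]
  refine Measure.ext_prod fun {A B} hA hB => ?_
  have hform : ∀ (κ : Measure (ℝ × ℝ)) (A : Set ℝ), MeasurableSet A →
      (κ.restrict (univ ×ˢ B)).map Prod.fst A = κ (A ×ˢ B) := by
    intro κ A hA
    rw [Measure.map_apply measurable_fst hA, Measure.restrict_apply (measurable_fst hA)]
    congr 1; ext p; simp
  have : (μ.restrict (univ ×ˢ B)).map Prod.fst = (ν.restrict (univ ×ˢ B)).map Prod.fst :=
    Measure.ext_of_Ici _ _ fun t => by
      rw [hform _ _ measurableSet_Ici, hform _ _ measurableSet_Ici, h1 t B hB]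
  rw [← hform μ A hA, this, hform ν A hA]

/-- On ordered nonnegative pairs, a quadrant is unchanged when its corner `(s, t)` is moved to `(max
s 0, max t (max s 0))`. -/
lemma ext_of_Ici_prod_of_ordered {μ ν : Measure (ℝ × ℝ)} [IsFiniteMeasure μ]
    (hμ : μ {p | 0 ≤ p.1 ∧ p.1 ≤ p.2}ᶜ = 0) (hν : ν {p | 0 ≤ p.1 ∧ p.1 ≤ p.2}ᶜ = 0)
    (h : ∀ s t : ℝ, 0 ≤ s → s ≤ t → μ (Ici s ×ˢ Ici t) = ν (Ici s ×ˢ Ici t)) : μ = ν := by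
  refine ext_of_Ici_prod fun s t => ?_
  have key : (Ici s ×ˢ Ici t) ∩ {p : ℝ × ℝ | 0 ≤ p.1 ∧ p.1 ≤ p.2} =
      (Ici (max s 0) ×ˢ Ici (max t (max s 0))) ∩ {p : ℝ × ℝ | 0 ≤ p.1 ∧ p.1 ≤ p.2} := by
    ext p
    simp only [mem_inter_iff, mem_prod, mem_Ici, mem_ofPred_eq, max_le_iff]
    constructor
    · rintro ⟨⟨h1, h2⟩, h3, h4⟩
      exact ⟨⟨⟨h1, h3⟩, h2, h1.trans h4, h3.trans h4⟩, h3, h4⟩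
    · rintro ⟨⟨⟨h1, h3⟩, h2, -⟩, h4⟩
      exact ⟨⟨h1, h2⟩, h4⟩
  have hform : ∀ κ : Measure (ℝ × ℝ), κ {p | 0 ≤ p.1 ∧ p.1 ≤ p.2}ᶜ = 0 →
      κ (Ici s ×ˢ Ici t) = κ (Ici (max s 0) ×ˢ Ici (max t (max s 0))) := by
    intro κ hκ
    rw [← measure_inter_conull hκ, key, measure_inter_conull hκ]
  rw [hform μ hμ, hform ν hν, h _ _ (le_max_right _ _) (le_max_right _ _)]

end calculus

end CloudRadio

/-! ### Small discs, large discs and nearest distances in a Poisson process. -/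

namespace CloudRadio

lemma volume_real_ball {u : Plane} {r : ℝ} (hr : 0 ≤ r) : volume.real (Metric.ball u r) = π * r ^ 2 := by
  rw [Measure.real, EuclideanSpace.volume_ball_fin_two, ENNReal.toReal_mul, ENNReal.toReal_pow,
    ENNReal.toReal_ofReal hr, ENNReal.toReal_ofReal pi_pos.le, mul_comm]

lemma volume_real_closedBall {u : Plane} {r : ℝ} (hr : 0 ≤ r) :
    volume.real (Metric.closedBall u r) = π * r ^ 2 := by
  rw [Measure.real, EuclideanSpace.volume_closedBall_fin_two, ENNReal.toReal_mul, ENNReal.toReal_pow,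
    ENNReal.toReal_ofReal hr, ENNReal.toReal_ofReal pi_pos.le, mul_comm]

namespace IsPoissonProcess

variable {Ω : Type*} [MeasurableSpace Ω] {P : Measure Ω} {lam : ℝ} {X : ℕ → Ω → Plane}

lemma measure_count_lt (hX : IsPoissonProcess P lam X) (hlam : 0 ≤ lam) {B : Set Plane}
    (hB : MeasurableSet B) (hv : volume B ≠ ∞) (n : ℕ) :
    P {ω | count (fun n => X n ω) B < n} =
      ENNReal.ofReal (exp (-(lam * volume.real B)) * expSum n (lam * volume.real B)) := by
  have hN := measurable_count hX.measurable hB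
  have hμ : 0 ≤ lam * volume.real B := by positivity
  induction n with
  | zero => simp [expSum]
  | succ n ih =>
    have h1 : {ω | count (fun n => X n ω) B < (n + 1 : ℕ)} =
        {ω | count (fun n => X n ω) B < n} ∪ {ω | count (fun n => X n ω) B = n} := by
      ext ω
      simp only [mem_ofPred_eq, mem_union, ← le_iff_lt_or_eq, Nat.cast_add, Nat.cast_one]
      exact ENat.lt_add_one_iff (ENat.natCast_ne_top n)
    have h2 : MeasurableSet {ω | count (fun n => X n ω) B = n} := hN (measurableSet_singleton _)
    rw [h1, measure_union _ h2, ih, hX.count_law B hB hv,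
      ← ENNReal.ofReal_add]
    · congr 1
      simp only [expSum, Finset.sum_range_succ]
      ring
    · have := expSum_nonneg n hμ
      positivity
    · positivity
    · exact disjoint_left.2 fun ω h h' => absurd h' (ne_of_lt h)

lemma measure_count_eq_zero (hX : IsPoissonProcess P lam X) {B : Set Plane}
    (hB : MeasurableSet B) (hv : volume B ≠ ∞) :
    P {ω | count (fun n => X n ω) B = 0} = ENNReal.ofReal (exp (-(lam * volume.real B))) := by
  simpa using hX.count_law B hB hv 0

/-- A set of small area rarely contains two points. -/
lemma measure_two_le_count_le [IsProbabilityMeasure P] (hX : IsPoissonProcess P lam X) (hlam : 0 ≤ lam)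
    {B : Set Plane} (hB : MeasurableSet B) (hv : volume B ≠ ∞) :
    P {ω | 2 ≤ count (fun n => X n ω) B} ≤ ENNReal.ofReal ((lam * volume.real B) ^ 2) := by
  have hN := measurable_count hX.measurable hB
  have hμ : 0 ≤ lam * volume.real B := by positivity
  have h1 : {ω | 2 ≤ count (fun n => X n ω) B} = {ω | count (fun n => X n ω) B < (2 : ℕ)}ᶜ := by
    ext ω
    exact (not_lt (a := count (fun n => X n ω) B) (b := 2)).symm
  have h2 : MeasurableSet {ω | count (fun n => X n ω) B < (2 : ℕ)} :=
    hN (MeasurableSet.of_discrete (s := Iio ((2 : ℕ) : ℕ∞)))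
  rw [h1, prob_compl_eq_one_sub h2,
    hX.measure_count_lt hlam hB hv]
  have h2 : expSum 2 (lam * volume.real B) = 1 + lam * volume.real B := by
    simp [expSum, Finset.sum_range_succ]
  rw [h2, ← ENNReal.ofReal_one, ← ENNReal.ofReal_sub _ (by positivity)]
  refine ENNReal.ofReal_le_ofReal ?_
  -- With mean `μ`, this gives `e^{-μ}(1 + μ) ≥ (1 - μ)(1 + μ) = 1 - μ²`.
  have := add_one_le_exp (-(lam * volume.real B))
  nlinarith

/-- The probability of fewer than `k` points in the disc of radius `j` tends to `0` as `j` grows.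
This removes the default value in `nthDist` almost surely. -/
lemma ae_exists_le_encard [IsProbabilityMeasure P] (hX : IsPoissonProcess P lam X) (hlam : 0 < lam)
    (u : Plane) (k : ℕ) : ∀ᵐ ω ∂P, ∃ r : ℝ, (k : ℕ∞) ≤ {n | dist u (X n ω) ≤ r}.encard := by
  have hlim : Filter.Tendsto (fun j : ℕ => ENNReal.ofReal (exp (-(lam * (π * (j : ℝ) ^ 2))) *
      expSum k (lam * (π * (j : ℝ) ^ 2)))) Filter.atTop (nhds 0) := by
    rw [← ENNReal.ofReal_zero]
    refine ENNReal.tendsto_ofReal ((tendsto_exp_neg_mul_expSum k).comp ?_)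
    refine Filter.Tendsto.const_mul_atTop hlam (Filter.Tendsto.const_mul_atTop pi_pos ?_)
    exact (Filter.tendsto_pow_atTop two_ne_zero).comp tendsto_natCast_atTop_atTop
  refine measure_mono_null (t := ⋂ j : ℕ, {ω | count (fun n => X n ω) (Metric.closedBall u j) < k}) ?_
    (le_antisymm (ge_of_tendsto' hlim fun j => ?_) zero_le)
  · intro ω hω
    refine mem_iInter.2 fun j => ?_
    by_contra h
    exact hω ⟨j, by rw [encard_dist_le]; exact not_lt.1 h⟩
  · refine (measure_mono (iInter_subset _ j)).trans ?_
    rw [hX.measure_count_lt hlam.le Metric.isClosed_closedBall.measurableSet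
      measure_closedBall_lt_top.ne, volume_real_closedBall (Nat.cast_nonneg j)]

/-- The joint law of the distances from a fixed point to the nearest and to the `L + 1`-st nearest
point of a Poisson process. -/
lemma map_nthDist [IsProbabilityMeasure P] (hX : IsPoissonProcess P lam X) (hlam : 0 < lam)
    {L : ℕ} (hL : 1 ≤ L) (u : Plane) :
    P.map (fun ω => (nthDist 1 (fun n => X n ω) u, nthDist (L + 1) (fun n => X n ω) u)) =
      distLaw lam L := by
  have hm : Measurable fun ω => (nthDist 1 (fun n => X n ω) u, nthDist (L + 1) (fun n => X n ω) u) :=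
    (measurable_nthDist le_rfl hX.measurable measurable_const).prodMk
      (measurable_nthDist (by omega) hX.measurable measurable_const)
  have : IsProbabilityMeasure
      (P.map fun ω => (nthDist 1 (fun n => X n ω) u, nthDist (L + 1) (fun n => X n ω) u)) :=
    Measure.isProbabilityMeasure_map hm.aemeasurable
  have hK : MeasurableSet {p : ℝ × ℝ | 0 ≤ p.1 ∧ p.1 ≤ p.2} :=
    (measurableSet_le measurable_const measurable_fst).inter
      (measurableSet_le measurable_fst measurable_snd)
  refine ext_of_Ici_prod_of_ordered ?_ distLaw_compl ?_
  · rw [Measure.map_apply hm hK.compl]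
    refine measure_mono_null ?_ (hX.ae_exists_le_encard hlam u (L + 1))
    intro ω hω hex
    refine hω ⟨nthDist_nonneg le_rfl _ _, ?_⟩
    refine le_csInf hex fun r hr => nthDist_le le_rfl (le_trans ?_ hr)
    exact_mod_cast Nat.le_add_left 1 L
  · intro s t hs hst
    have ht := hs.trans hst
    rw [Measure.map_apply hm (measurableSet_Ici.prod measurableSet_Ici), distLaw_Ici hlam hL hs hst]
    set A := Metric.ball u s
    set B := Metric.ball u t \ Metric.ball u s with hBdef
    have hAm : MeasurableSet A := Metric.isOpen_ball.measurableSet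
    have hBm : MeasurableSet B := Metric.isOpen_ball.measurableSet.diff hAm
    have hAv : volume A ≠ ∞ := measure_ball_lt_top.ne
    have hBv : volume B ≠ ∞ := ne_top_of_le_ne_top measure_ball_lt_top.ne (measure_mono sdiff_subset)
    have hAB : Disjoint A B := disjoint_sdiff_right
    have hU : Metric.ball u t = A ∪ B := by
      rw [hBdef, union_sdiff_cancel (Metric.ball_subset_ball hst)]
    have hBr : volume.real B = π * (t ^ 2 - s ^ 2) := by
      have := measureReal_union (μ := volume) hAB hBm
      rw [← hU, volume_real_ball ht, volume_real_ball hs] at this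
      linarith
    have hind : IndepFun (fun ω => count (fun n => X n ω) A) (fun ω => count (fun n => X n ω) B) P := by
      have := hX.count_indep_fintype (B := fun b : Bool => if b then A else B) (by
        rintro (_ | _) <;> simpa) (by rintro (_ | _) <;> simpa) (by
        rintro (_ | _) (_ | _) h
        · exact absurd rfl h
        · exact hAB.symm
        · exact hAB
        · exact absurd rfl h)
      exact this.indepFun (i := true) (j := false) (by simp)
    -- Once the disc `A` is empty, having at most `L` points within `t` is a condition on the
    -- annulus `B` alone, whose count is independent of that of `A`.
    have hae : (fun ω => (nthDist 1 (fun n => X n ω) u, nthDist (L + 1) (fun n => X n ω) u)) ⁻¹'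
        (Ici s ×ˢ Ici t) =ᵐ[P] ({ω | count (fun n => X n ω) A ∈ ({0} : Set ℕ∞)} ∩
          {ω | count (fun n => X n ω) B ∈ Iio ((L + 1 : ℕ) : ℕ∞)} : Set Ω) := by
      filter_upwards [hX.ae_exists_le_encard hlam u 1, hX.ae_exists_le_encard hlam u (L + 1)]
        with ω h1 h2
      refine propext ?_
      change (s ≤ nthDist 1 (fun n => X n ω) u ∧ t ≤ nthDist (L + 1) (fun n => X n ω) u) ↔
        (count (fun n => X n ω) A = 0 ∧ count (fun n => X n ω) B < ((L + 1 : ℕ) : ℕ∞))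
      rw [le_nthDist_iff le_rfl h1, le_nthDist_iff (by omega) h2, hU, count_union _ hAB,
        Nat.cast_one, Order.lt_one_iff]
      refine and_congr_right fun h => ?_
      rw [h, zero_add]
    rw [measure_congr hae]
    have h3 := hind.measure_inter_preimage_eq_mul {0} (Iio ((L + 1 : ℕ) : ℕ∞))
      MeasurableSet.of_discrete MeasurableSet.of_discrete
    refine h3.trans ?_
    have h4 := hX.measure_count_eq_zero hAm hAv
    have h5 := hX.measure_count_lt hlam.le hBm hBv (L + 1)
    change P {ω | count (fun n => X n ω) A = 0} * P {ω | count (fun n => X n ω) B < (L + 1 : ℕ)} = _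
    rw [h4, h5, volume_real_ball hs, hBr, ← ENNReal.ofReal_mul (exp_pos _).le, ← mul_assoc, ← exp_add]
    ring_nf

end IsPoissonProcess

end CloudRadio

namespace CloudRadio

/-! ### The radial integral -/

/-- The contribution `∫_ρ^∞ c r / (r^α + c) dr` of a ray from distance `ρ` on. -/
noncomputable def radial (α c ρ : ℝ) : ℝ := ∫ r in Ioi ρ, r * (c / (r ^ α + c))

variable {α c : ℝ}

lemma integrableOn_radial (hα : 2 < α) (hc : 0 ≤ c) {ρ : ℝ} (hρ : 0 < ρ) :
    IntegrableOn (fun r => r * (c / (r ^ α + c))) (Ioi ρ) := by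
  refine Integrable.mono' ((integrableOn_Ioi_rpow_of_lt (a := 1 - α) (by linarith) hρ).const_mul c)
    (by fun_prop) ((ae_restrict_iff' measurableSet_Ioi).2 (.of_forall fun r hr => ?_))
  have hr : 0 < r := hρ.trans hr
  have hp : 0 < r ^ α := rpow_pos_of_pos hr α
  rw [norm_of_nonneg (by positivity), rpow_sub hr, rpow_one]
  calc r * (c / (r ^ α + c)) ≤ r * (c / r ^ α) := by gcongr; linarith
    _ = c * (r / r ^ α) := by ring

lemma radial_nonneg (hc : 0 ≤ c) {ρ : ℝ} (hρ : 0 ≤ ρ) : 0 ≤ radial α c ρ := by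
  refine setIntegral_nonneg measurableSet_Ioi fun r hr => ?_
  have hr : 0 < r := hρ.trans_lt hr
  have hp : 0 < r ^ α := rpow_pos_of_pos hr α
  positivity

lemma radial_anti (hα : 2 < α) (hc : 0 ≤ c) {ρ ρ' : ℝ} (hρ : 0 < ρ) (h : ρ ≤ ρ') :
    radial α c ρ' ≤ radial α c ρ := by
  refine setIntegral_mono_set (integrableOn_radial hα hc hρ) ?_ (Ioi_subset_Ioi h).eventuallyLE
  refine (ae_restrict_iff' measurableSet_Ioi).2 (.of_forall fun r hr => ?_)
  have hr : 0 < r := hρ.trans hr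
  have hp : 0 < r ^ α := rpow_pos_of_pos hr α
  change 0 ≤ r * (c / (r ^ α + c))
  positivity

lemma lintegral_radial (hα : 2 < α) (hc : 0 ≤ c) {ρ : ℝ} (hρ : 0 < ρ) :
    ∫⁻ r in Ioi ρ, ENNReal.ofReal (r * (c / (r ^ α + c))) = ENNReal.ofReal (radial α c ρ) := by
  rw [radial, ofReal_integral_eq_lintegral_ofReal (integrableOn_radial hα hc hρ)]
  refine (ae_restrict_iff' measurableSet_Ioi).2 (.of_forall fun r hr => ?_)
  have hr : 0 < r := hρ.trans hr
  have hp : 0 < r ^ α := rpow_pos_of_pos hr α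
  change 0 ≤ r * (c / (r ^ α + c))
  positivity

/-- Evaluation of the radial integral by the hypergeometric function. -/
lemma radial_eq (hα : 2 < α) {T s ρ : ℝ} (hT : 0 < T) (hs : 0 ≤ s) (hρ : 0 < ρ) :
    T * s ^ α * ρ ^ (2 - α) * Lam α (s / ρ) T / (α - 2) = radial α (T * s ^ α) ρ := by
  have hα0 : 0 < α := by linarith
  have hα2 : 0 < α - 2 := by linarith
  set b := (α - 2) / α with hb
  have hb0 : 0 < b := by positivity
  have hb1 : 2 - 2 / α = b + 1 := by rw [hb]; field_simp; ring
  -- By scaling, `T s^α = κ ρ^α`, and `-κ` is the argument of the hypergeometric function.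
  set κ := (s / ρ) ^ α * T with hκ
  have hκ0 : 0 ≤ κ := by positivity
  have hκc : T * s ^ α = κ * ρ ^ α := by
    rw [hκ, div_rpow hs hρ.le]; field_simp
  have hG : Gamma (b + 1) / (Gamma b * Gamma (b + 1 - b)) = b := by
    rw [Gamma_add_one hb0.ne', add_sub_cancel_left, Gamma_one, mul_one,
      mul_div_cancel_right₀ _ (Gamma_pos_of_pos hb0).ne']
  have hL : Lam α (s / ρ) T = b * ∫ t in Ioo (0 : ℝ) 1, t ^ (b - 1) * (1 + κ * t)⁻¹ := by
    rw [Lam, hb1, ← hb, ← hκ, hyp2F1, hG, intervalIntegral.integral_of_le zero_le_one,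
      integral_Ioc_eq_integral_Ioo]
    congr 1
    refine setIntegral_congr_fun measurableSet_Ioo fun t _ => ?_
    simp [rpow_neg_one]
  -- The substitution `t = (ρ / r)^α` carries `(ρ, ∞)` onto `(0, 1)` and the radial integral to
  -- Euler's integral, whose third parameter is the second plus one.
  set f : ℝ → ℝ := fun r => ρ ^ α * r ^ (-α) with hf
  have himg : f '' Ioi ρ = Ioo 0 1 := by
    ext t
    constructor
    · rintro ⟨r, hr, rfl⟩
      have hr : ρ < r := hr
      have hr0 : 0 < r := hρ.trans hr
      refine ⟨by simp only [hf]; positivity, ?_⟩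
      simp only [hf]
      rw [rpow_neg hr0.le, ← div_eq_mul_inv, div_lt_one (by positivity)]
      exact rpow_lt_rpow hρ.le hr hα0
    · rintro ⟨h0, h1⟩
      refine ⟨ρ * t ^ (-α⁻¹), ?_, ?_⟩
      · have : 1 < t ^ (-α⁻¹) := one_lt_rpow_of_pos_of_lt_one_of_neg h0 h1 (by simpa using hα0)
        change ρ < _
        nlinarith
      · simp only [hf]
        rw [mul_rpow hρ.le (by positivity), ← rpow_mul h0.le, ← mul_assoc, ← rpow_add hρ]
        simp [hα0.ne']
  have hinj : InjOn f (Ioi ρ) := by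
    intro r hr r' hr' h
    have hr0 : 0 < r := hρ.trans hr
    have hr0' : 0 < r' := hρ.trans hr'
    have h1 : r ^ (-α) = r' ^ (-α) := mul_left_cancel₀ (rpow_pos_of_pos hρ α).ne' h
    exact (rpow_left_inj hr0.le hr0'.le (by simpa using hα0.ne')).1 h1
  have hder : ∀ r ∈ Ioi ρ, HasDerivWithinAt f (ρ ^ α * (-α * r ^ (-α - 1))) (Ioi ρ) r := by
    intro r hr
    have hr0 : 0 < r := hρ.trans hr
    exact ((hasDerivAt_rpow_const (Or.inl hr0.ne')).const_mul _).hasDerivWithinAt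
  have hcv := integral_image_eq_integral_abs_deriv_smul measurableSet_Ioi hder hinj
    (fun t => t ^ (b - 1) * (1 + κ * t)⁻¹)
  rw [himg] at hcv
  have hpt : ∀ r ∈ Ioi ρ, |ρ ^ α * (-α * r ^ (-α - 1))| • (f r ^ (b - 1) * (1 + κ * f r)⁻¹) =
      α * ρ ^ (α - 2) * (r * (r ^ α + T * s ^ α)⁻¹) := by
    intro r hr
    have hr0 : 0 < r := hρ.trans hr
    have hρα := rpow_pos_of_pos hρ α
    have hrα := rpow_pos_of_pos hr0 α
    have h1 : |ρ ^ α * (-α * r ^ (-α - 1))| = ρ ^ α * (α * (r ^ (-α) / r)) := by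
      rw [abs_mul, abs_mul, abs_neg, abs_of_pos hρα, abs_of_pos hα0,
        abs_of_pos (rpow_pos_of_pos hr0 _), rpow_sub_one hr0.ne']
    have h2 : f r ^ (b - 1) = ρ ^ (-2 : ℝ) * r ^ (2 : ℝ) := by
      have hb1' : b - 1 = -2 / α := by rw [hb]; field_simp; ring
      simp only [hf]
      rw [mul_rpow hρα.le (by positivity), ← rpow_mul hρ.le, ← rpow_mul hr0.le, hb1']
      congr 2 <;> field_simp
    have h3 : (1 + κ * f r)⁻¹ = r ^ α * (r ^ α + T * s ^ α)⁻¹ := by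
      have : r ^ α + T * s ^ α = r ^ α * (1 + κ * f r) := by
        simp only [hf]
        rw [hκc, rpow_neg hr0.le]
        field_simp
      have h4 : 0 < 1 + κ * f r := by
        have : 0 < f r := by simp only [hf]; positivity
        positivity
      rw [this]
      field_simp
    rw [smul_eq_mul, h1, h2, h3, rpow_neg hr0.le, rpow_neg hρ.le, rpow_sub hρ, rpow_two, rpow_two]
    field_simp
  rw [setIntegral_congr_fun measurableSet_Ioi hpt, integral_const_mul] at hcv
  have hR : radial α (T * s ^ α) ρ = T * s ^ α * ∫ r in Ioi ρ, r * (r ^ α + T * s ^ α)⁻¹ := by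
    rw [radial, ← integral_const_mul]
    refine setIntegral_congr_fun measurableSet_Ioi fun r _ => ?_
    rw [div_eq_mul_inv]; ring
  rw [hL, hcv, hR, hb]
  have h5 : ρ ^ (2 - α) * ρ ^ (α - 2) = 1 := by
    rw [← rpow_add hρ]; simp
  field_simp
  linear_combination (s ^ α * ∫ r in Ioi ρ, r / (r ^ α + T * s ^ α)) * h5

/-! ### The residual region -/

/-- Positions, seen from the user, of the base stations outside the disc of radius `s` that are
outside of the cluster or outside of the disc of radius `t`. -/
def residualRegion (R ru s t : ℝ) : Set ℂ := {z | s < ‖z‖ ∧ (R ≤ ‖z + ru‖ ∨ t < ‖z‖)}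

lemma measurableSet_residualRegion (R ru s t : ℝ) : MeasurableSet (residualRegion R ru s t) := by
  have h1 : Measurable fun z : ℂ => ‖z‖ := measurable_norm
  have h2 : Measurable fun z : ℂ => ‖z + ru‖ := by fun_prop
  exact (measurableSet_lt measurable_const h1).inter
    ((measurableSet_le measurable_const h2).union (measurableSet_lt measurable_const h1))

/-- The exponent of the Laplace transform of the residual interference, without intensity. -/
noncomputable def exponent (α R c ru s t : ℝ) : ℝ≥0∞ :=
  ∫⁻ z in residualRegion R ru s t, ENNReal.ofReal (c / (‖z‖ ^ α + c))

/-- The starting distance of the residual region in a given direction. -/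
noncomputable def start (R ru s t φ : ℝ) : ℝ := max s (min (bdryDist R ru φ) t)

section bdryDist

variable {R ru : ℝ}

lemma abs_lt_sqrt_of_sq_lt {x y : ℝ} (h : x ^ 2 < y) : |x| < √y := by
  rwa [lt_sqrt (abs_nonneg x), sq_abs]

lemma bdryDist_discr_pos (h0 : 0 ≤ ru) (h1 : ru < R) (φ : ℝ) :
    (cos φ * ru) ^ 2 < cos φ ^ 2 * ru ^ 2 - ru ^ 2 + R ^ 2 := by
  nlinarith

/-- By the law of cosines `bdryDist` is a root in `r` of `r² + 2 r r_u cos φ + r_u² = R²`. The user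
is inside the cluster, so the other root is negative and plays no role for `r ≥ 0`. -/
lemma lt_bdryDist_iff (h0 : 0 ≤ ru) (h1 : ru < R) {r : ℝ} (hr : 0 ≤ r) (φ : ℝ) :
    r < bdryDist R ru φ ↔ r ^ 2 + 2 * r * ru * cos φ + ru ^ 2 < R ^ 2 := by
  have hD := bdryDist_discr_pos h0 h1 φ
  have h2 : -√(cos φ ^ 2 * ru ^ 2 - ru ^ 2 + R ^ 2) < cos φ * ru :=
    (abs_lt.1 (abs_lt_sqrt_of_sq_lt hD)).1
  rw [bdryDist, lt_sub_iff_add_lt]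
  constructor
  · intro h
    have : (r + cos φ * ru) ^ 2 < √(cos φ ^ 2 * ru ^ 2 - ru ^ 2 + R ^ 2) ^ 2 :=
      sq_lt_sq' (by linarith) h
    rw [sq_sqrt ((sq_nonneg _).trans hD.le)] at this
    nlinarith
  · intro h
    exact (le_abs_self _).trans_lt (abs_lt_sqrt_of_sq_lt (by nlinarith))

lemma le_bdryDist_iff (h0 : 0 ≤ ru) (h1 : ru < R) {r : ℝ} (hr : 0 ≤ r) (φ : ℝ) :
    r ≤ bdryDist R ru φ ↔ r ^ 2 + 2 * r * ru * cos φ + ru ^ 2 ≤ R ^ 2 := by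
  have hD := bdryDist_discr_pos h0 h1 φ
  have h2 : -√(cos φ ^ 2 * ru ^ 2 - ru ^ 2 + R ^ 2) < cos φ * ru :=
    (abs_lt.1 (abs_lt_sqrt_of_sq_lt hD)).1
  rw [bdryDist, le_sub_iff_add_le]
  constructor
  · intro h
    have : (r + cos φ * ru) ^ 2 ≤ √(cos φ ^ 2 * ru ^ 2 - ru ^ 2 + R ^ 2) ^ 2 :=
      sq_le_sq' (by linarith) h
    rw [sq_sqrt ((sq_nonneg _).trans hD.le)] at this
    nlinarith
  · intro h
    exact (le_abs_self _).trans (abs_le_sqrt (by nlinarith))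

lemma sub_le_bdryDist (h0 : 0 ≤ ru) (h1 : ru < R) (φ : ℝ) : R - ru ≤ bdryDist R ru φ := by
  rw [le_bdryDist_iff h0 h1 (by linarith)]
  nlinarith [cos_le_one φ, mul_nonneg (sub_nonneg.2 h1.le) h0]

lemma bdryDist_pos (h0 : 0 ≤ ru) (h1 : ru < R) (φ : ℝ) : 0 < bdryDist R ru φ :=
  (sub_pos.2 h1).trans_le (sub_le_bdryDist h0 h1 φ)

@[fun_prop] lemma continuous_bdryDist : Continuous (bdryDist R ru) := by
  unfold bdryDist; fun_prop

end bdryDist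

/-- `radial` is monotone on positive starting distances; clipping these at `a > 0` gives a monotone,
hence measurable, function on the whole line. -/
lemma measurable_radial_comp (hα : 2 < α) (hc : 0 ≤ c) {f : ℝ → ℝ} {a : ℝ} (ha : 0 < a)
    (hf : Measurable f) (hfa : ∀ φ, a ≤ f φ) : Measurable fun φ => radial α c (f φ) := by
  have h1 : Antitone fun ρ => radial α c (max a ρ) := fun ρ ρ' h =>
    radial_anti hα hc (ha.trans_le (le_max_left _ _)) (max_le_max_left a h)
  simpa only [Function.comp_def, max_eq_right (hfa _)] using h1.measurable.comp hf

lemma integrableOn_radial_comp (hα : 2 < α) (hc : 0 ≤ c) {f : ℝ → ℝ} {a : ℝ} (ha : 0 < a)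
    (hf : Measurable f) (hfa : ∀ φ, a ≤ f φ) {S : Set ℝ} (hS : volume S ≠ ∞) :
    IntegrableOn (fun φ => radial α c (f φ)) S := by
  refine Measure.integrableOn_of_bounded (M := radial α c a) hS
    (measurable_radial_comp hα hc ha hf hfa).aestronglyMeasurable (.of_forall fun φ => ?_)
  rw [norm_of_nonneg (radial_nonneg hc (ha.le.trans (hfa φ)))]
  exact radial_anti hα hc ha (hfa φ)

lemma norm_polar_add_sq (r φ ru : ℝ) :
    ‖((r : ℂ) * (cos φ + sin φ * Complex.I)) + ru‖ ^ 2 = r ^ 2 + 2 * r * ru * cos φ + ru ^ 2 := by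
  rw [← Complex.normSq_eq_norm_sq, Complex.normSq_apply]
  simp only [Complex.add_re, Complex.mul_re, Complex.ofReal_re, Complex.ofReal_im, Complex.add_im,
    Complex.mul_im, Complex.I_re, Complex.I_im]
  nlinarith [sin_sq_add_cos_sq φ]

/-- Polar coordinates around the user: on each ray the residual region is a half-line starting at
`start`, so the inner integral is `radial`. -/
lemma exponent_eq (hα : 2 < α) (hc : 0 ≤ c) {R ru s t : ℝ} (h0 : 0 ≤ ru) (h1 : ru < R) (hs : 0 < s) :
    exponent α R c ru s t = ENNReal.ofReal (∫ φ in (-π)..π, radial α c (start R ru s t φ)) := by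
  have hmR := measurableSet_residualRegion R ru s t
  have hstart : ∀ φ, s ≤ start R ru s t φ := fun φ => le_max_left _ _
  have hsm : Measurable (start R ru s t) := by
    unfold start
    exact measurable_const.max (continuous_bdryDist.measurable.min measurable_const)
  rw [exponent, ← lintegral_indicator hmR, ← Complex.lintegral_comp_polarCoord_symm,
    polarCoord_target, Measure.volume_eq_prod, ← Measure.prod_restrict, lintegral_prod_symm]
  swap
  · refine AEMeasurable.smul (f := fun p : ℝ × ℝ => ENNReal.ofReal p.1) (by fun_prop) ?_
    have : Measurable fun p : ℝ × ℝ => Complex.polarCoord.symm p := by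
      simp only [Complex.polarCoord_symm_apply]; fun_prop
    exact ((Measurable.indicator (by fun_prop) hmR).comp this).aemeasurable
  have hin : ∀ φ, ∫⁻ r in Ioi (0 : ℝ), ENNReal.ofReal (r, φ).1 •
      (residualRegion R ru s t).indicator (fun z => ENNReal.ofReal (c / (‖z‖ ^ α + c)))
        (Complex.polarCoord.symm (r, φ)) = ENNReal.ofReal (radial α c (start R ru s t φ)) := by
    intro φ
    have hρ : 0 < start R ru s t φ := hs.trans_le (hstart φ)
    rw [← lintegral_radial hα hc hρ]
    have hform : ∀ r ∈ Ioi (0 : ℝ), ENNReal.ofReal (r, φ).1 •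
      (residualRegion R ru s t).indicator (fun z => ENNReal.ofReal (c / (‖z‖ ^ α + c)))
        (Complex.polarCoord.symm (r, φ)) =
        {r | s < r ∧ (bdryDist R ru φ ≤ r ∨ t < r)}.indicator
          (fun r => ENNReal.ofReal (r * (c / (r ^ α + c)))) r := by
      intro r hr
      have hr : 0 < r := hr
      have hnorm : ‖((r : ℂ) * (cos φ + sin φ * Complex.I))‖ = r := by
        have := Complex.norm_polarCoord_symm (r, φ)
        rwa [Complex.polarCoord_symm_apply, abs_of_pos hr] at this
      have hmem : Complex.polarCoord.symm (r, φ) ∈ residualRegion R ru s t ↔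
          r ∈ {r | s < r ∧ (bdryDist R ru φ ≤ r ∨ t < r)} := by
        simp only [residualRegion, mem_ofPred_eq, Complex.polarCoord_symm_apply, hnorm]
        rw [← not_lt (a := r), lt_bdryDist_iff h0 h1 hr.le, ← norm_polar_add_sq, not_lt,
          sq_le_sq₀ (h0.trans h1.le) (norm_nonneg _)]
      by_cases h : r ∈ {r | s < r ∧ (bdryDist R ru φ ≤ r ∨ t < r)}
      · rw [indicator_of_mem (hmem.2 h), indicator_of_mem h, Complex.polarCoord_symm_apply]
        dsimp only
        rw [hnorm, ENNReal.ofReal_mul hr.le, smul_eq_mul]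
      · rw [indicator_of_notMem (fun h' => h (hmem.1 h')), indicator_of_notMem h, smul_zero]
    rw [setLIntegral_congr_fun measurableSet_Ioi hform]
    have hm : MeasurableSet {r | s < r ∧ (bdryDist R ru φ ≤ r ∨ t < r)} :=
      measurableSet_Ioi.inter (measurableSet_Ici.union measurableSet_Ioi)
    rw [lintegral_indicator hm, Measure.restrict_restrict hm]
    -- Whether the endpoint belongs to the region depends on which term attains `start`; the set is
    -- only squeezed between the open and the closed half-line, which agree almost everywhere.
    have hsub1 : Ioi (start R ru s t φ) ⊆
        {r | s < r ∧ (bdryDist R ru φ ≤ r ∨ t < r)} ∩ Ioi 0 := by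
      intro r hr
      have hr : start R ru s t φ < r := hr
      rw [start, max_lt_iff, min_lt_iff] at hr
      exact ⟨⟨hr.1, hr.2.imp le_of_lt id⟩, hs.trans hr.1⟩
    have hsub2 : {r | s < r ∧ (bdryDist R ru φ ≤ r ∨ t < r)} ∩ Ioi 0 ⊆ Ici (start R ru s t φ) := by
      rintro r ⟨⟨h1, h2⟩, -⟩
      change start R ru s t φ ≤ r
      rw [start, max_le_iff, min_le_iff]
      exact ⟨h1.le, h2.imp id le_of_lt⟩
    rw [Measure.restrict_congr_set (Filter.EventuallyLE.antisymm
      (hsub2.eventuallyLE.trans Ioi_ae_eq_Ici.symm.le) hsub1.eventuallyLE)]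
  rw [lintegral_congr hin, intervalIntegral.integral_of_le (by linarith [pi_pos]),
    integral_Ioc_eq_integral_Ioo, ofReal_integral_eq_lintegral_ofReal]
  · exact integrableOn_radial_comp hα hc hs hsm hstart (by simp)
  · exact .of_forall fun φ => radial_nonneg hc (hs.le.trans (hstart φ))

end CloudRadio

namespace CloudRadio

/-! ### The conditional coverage bound -/

/-- Conditional coverage probability of a user at distance `ru` from the centre, when the scaled
threshold is `c` and the residual interferers form a Poisson process on the residual region. -/
noncomputable def covBound (α lam σ R c ru s t : ℝ) : ℝ≥0∞ :=
  eneg (ENNReal.ofReal (c * σ ^ 2)) * eneg (ENNReal.ofReal lam * exponent α R c ru s t)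

variable {α lam σ R T : ℝ}

lemma covBound_le_one {c ru s t : ℝ} : covBound α lam σ R c ru s t ≤ 1 :=
  mul_le_one' (eneg_le_one _) (eneg_le_one _)

lemma measurable_exponent : Measurable fun p : ℝ × ℝ × ℝ =>
    exponent α R (T * p.2.1 ^ α) p.1 p.2.1 p.2.2 := by
  have hS : MeasurableSet {q : (ℝ × ℝ × ℝ) × ℂ | q.2 ∈ residualRegion R q.1.1 q.1.2.1 q.1.2.2} := by
    have hn : Measurable fun q : (ℝ × ℝ × ℝ) × ℂ => ‖q.2‖ := by fun_prop
    have hn' : Measurable fun q : (ℝ × ℝ × ℝ) × ℂ => ‖q.2 + (q.1.1 : ℂ)‖ := by fun_prop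
    exact (measurableSet_lt (by fun_prop) hn).inter
      ((measurableSet_le measurable_const hn').union (measurableSet_lt (by fun_prop) hn))
  have hf : Measurable fun q : (ℝ × ℝ × ℝ) × ℂ =>
      ENNReal.ofReal (T * q.1.2.1 ^ α / (‖q.2‖ ^ α + T * q.1.2.1 ^ α)) := by fun_prop
  have := (hf.indicator hS).lintegral_prod_right' (ν := (volume : Measure ℂ))
  refine (congrArg Measurable (funext fun p => ?_)).mp this
  rw [exponent, ← lintegral_indicator (measurableSet_residualRegion _ _ _ _)]
  rfl

lemma measurable_covBound : Measurable fun p : ℝ × ℝ × ℝ =>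
    covBound α lam σ R (T * p.2.1 ^ α) p.1 p.2.1 p.2.2 := by
  unfold covBound
  have h1 := measurable_exponent (α := α) (R := R) (T := T)
  fun_prop

lemma covBound_eq (hα : 2 < α) (hlam : 0 ≤ lam) {c ru s t : ℝ} (hc : 0 ≤ c) (h0 : 0 ≤ ru) (h1 : ru < R)
    (hs : 0 < s) : covBound α lam σ R c ru s t = ENNReal.ofReal (exp (-(c * σ ^ 2)) *
      exp (-(lam * ∫ φ in (-π)..π, radial α c (start R ru s t φ)))) := by
  have hI : 0 ≤ ∫ φ in (-π)..π, radial α c (start R ru s t φ) :=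
    intervalIntegral.integral_nonneg (by linarith [pi_pos]) fun φ _ =>
      radial_nonneg hc (hs.le.trans (le_max_left _ _))
  rw [covBound, exponent_eq hα hc h0 h1 hs, eneg_ofReal (by positivity), ← ENNReal.ofReal_mul hlam,
    eneg_ofReal (by positivity), ← ENNReal.ofReal_mul (exp_pos _).le]

/-! ### Angles at which the boundary of the cluster is crossed -/

lemma crossAngle_mem (R ru r : ℝ) : crossAngle R ru r ∈ Icc 0 π :=
  ⟨sub_nonneg.2 (arccos_le_pi _), sub_le_self _ (arccos_nonneg _)⟩

/-- After cross-multiplication the claim becomes `0 ≤ (r' - r)(r r' + R² - r_u²)`, which holds since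
the user is inside the cluster. -/
lemma crossAngle_mono {ru r r' : ℝ} (h0 : 0 < ru) (h1 : ru < R) (hr : 0 < r) (hrr : r ≤ r') :
    crossAngle R ru r ≤ crossAngle R ru r' := by
  refine sub_le_sub_left (arccos_le_arccos ?_) π
  have hr' : 0 < r' := hr.trans_le hrr
  rw [div_le_div_iff₀ (by positivity) (by positivity)]
  have h2 : 0 ≤ (r' - r) * (r * r' + (R ^ 2 - ru ^ 2)) :=
    mul_nonneg (by linarith) (by nlinarith [mul_pos hr hr'])
  nlinarith [mul_nonneg h2 h0.le]

/-- The bounds on `r` say that the two circles meet; they keep the argument of `arccos` in `[-1,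
1]`, where `cos` inverts it. -/
lemma cos_crossAngle {ru r : ℝ} (h0 : 0 < ru) (hr : 0 < r) (hl : R - ru ≤ r)
    (hu : r ≤ R + ru) (h1 : ru < R) : 2 * r * ru * cos (crossAngle R ru r) = R ^ 2 - r ^ 2 - ru ^ 2 := by
  have hq : 0 < 2 * r * ru := by positivity
  rw [crossAngle, cos_pi_sub, cos_arccos]
  · field_simp; ring
  · rw [le_div_iff₀ hq]; nlinarith
  · rw [div_le_one hq]; nlinarith

lemma bdryDist_le_of_le_crossAngle {ru r φ : ℝ} (h0 : 0 < ru) (hr : 0 < r) (hl : R - ru ≤ r)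
    (hu : r ≤ R + ru) (h1 : ru < R) (hφ0 : 0 ≤ φ) (hφ : φ ≤ crossAngle R ru r) :
    bdryDist R ru φ ≤ r := by
  have hcos := cos_le_cos_of_nonneg_of_le_pi hφ0 (crossAngle_mem R ru r).2 hφ
  have := cos_crossAngle h0 hr hl hu h1
  rw [← not_lt, lt_bdryDist_iff h0.le h1 hr.le, not_lt]
  nlinarith [mul_le_mul_of_nonneg_left hcos (by positivity : 0 ≤ 2 * r * ru)]

lemma le_bdryDist_of_crossAngle_le {ru r φ : ℝ} (h0 : 0 < ru) (hr : 0 < r) (hl : R - ru ≤ r)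
    (hu : r ≤ R + ru) (h1 : ru < R) (hφ : crossAngle R ru r ≤ φ) (hφπ : φ ≤ π) :
    r ≤ bdryDist R ru φ := by
  have hcos := cos_le_cos_of_nonneg_of_le_pi (crossAngle_mem R ru r).1 hφπ hφ
  have := cos_crossAngle h0 hr hl hu h1
  rw [le_bdryDist_iff h0.le h1 hr.le]
  nlinarith [mul_le_mul_of_nonneg_left hcos (by positivity : 0 ≤ 2 * r * ru)]

lemma integral_symm_of_even {f : ℝ → ℝ} {a : ℝ} (hf : ∀ x, f (-x) = f x)
    (hi : IntervalIntegrable f volume 0 a) : ∫ x in (-a)..a, f x = 2 * ∫ x in (0 : ℝ)..a, f x := by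
  have h1 : ∫ x in (-a)..0, f x = ∫ x in (0 : ℝ)..a, f x := by
    have := intervalIntegral.integral_comp_neg (a := 0) (b := a) f
    rw [neg_zero] at this
    rw [← this]
    exact intervalIntegral.integral_congr fun x _ => hf x
  have h2 : IntervalIntegrable f volume (-a) 0 := by
    have := hi.comp_sub_left 0
    simp only [zero_sub, sub_zero, hf] at this
    exact this.symm
  rw [← intervalIntegral.integral_add_adjacent_intervals h2 hi, h1]; ring

lemma bdryDist_neg (R ru φ : ℝ) : bdryDist R ru (-φ) = bdryDist R ru φ := by
  simp [bdryDist]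

/-! ### The three closed forms as values of the conditional bound. -/

section terms

variable {ru s t : ℝ}

lemma intervalIntegrable_radial_comp {c : ℝ} (hα : 2 < α) (hc : 0 ≤ c) {f : ℝ → ℝ} {a : ℝ} (ha : 0 < a)
    (hf : Measurable f) (hfa : ∀ φ, a ≤ f φ) (x y : ℝ) :
    IntervalIntegrable (fun φ => radial α c (f φ)) volume x y :=
  ⟨integrableOn_radial_comp hα hc ha hf hfa (by simp), integrableOn_radial_comp hα hc ha hf hfa (by simp)⟩

lemma measurable_start : Measurable (start R ru s t) := by
  unfold start
  exact measurable_const.max (continuous_bdryDist.measurable.min measurable_const)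

/-- The disc of radius `t` lies in the cluster, so the residual region starts at `t` in every
direction. -/
lemma ofReal_P1_eq (hα : 2 < α) (hlam : 0 ≤ lam) (hT : 0 < T) (h0 : 0 ≤ ru) (h1 : ru < R) (hs : 0 < s)
    (hst : s < t) (ht : t < R - ru) :
    ENNReal.ofReal (P1 α lam σ T s t) = covBound α lam σ R (T * s ^ α) ru s t := by
  have hc : 0 ≤ T * s ^ α := by positivity
  have hA : ∀ φ, start R ru s t φ = t := fun φ => by
    rw [start, min_eq_right (ht.le.trans (sub_le_bdryDist h0 h1 φ)), max_eq_right hst.le]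
  rw [covBound_eq hα hlam hc h0 h1 hs, P1, radial_eq hα hT hs.le (hs.trans hst)]
  simp only [hA, intervalIntegral.integral_const, smul_eq_mul]
  congr 3
  ring

/-- For `|φ| ≤ Θ` the cluster ends before the disc of radius `t` does, and the region starts at the
boundary of the cluster; in the remaining directions it starts at `t`. The evenness of `bdryDist` in
`φ` reduces both integrals to positive angles. -/
lemma ofReal_P2_eq (hα : 2 < α) (hlam : 0 ≤ lam) (hT : 0 < T) (h0 : 0 ≤ ru) (h1 : ru < R) (hs : 0 < s)
    (hsR : s < R - ru) (ht : R - ru < t) (ht' : t < R + ru) :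
    ENNReal.ofReal (P2 α lam σ R T ru s t) = covBound α lam σ R (T * s ^ α) ru s t := by
  -- The strict bounds on `t` exclude a user at the centre, where the crossing angle would divide by
  -- zero.
  have hru : 0 < ru := by linarith
  have ht0 : 0 < t := by linarith
  have hc : 0 ≤ T * s ^ α := by positivity
  have hRu : 0 < R - ru := by linarith
  set Θ := crossAngle R ru t with hΘ
  obtain ⟨hΘ0, hΘπ⟩ := crossAngle_mem R ru t
  have hbi := fun x y => intervalIntegrable_radial_comp hα hc hRu
    continuous_bdryDist.measurable (sub_le_bdryDist h0 h1) x y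
  have hsi := fun x y => intervalIntegrable_radial_comp hα hc hs
    (measurable_start (R := R) (ru := ru) (s := s) (t := t)) (fun φ => le_max_left _ _) x y
  have hI : ∫ φ in (-π)..π, radial α (T * s ^ α) (start R ru s t φ) =
      (∫ φ in (-Θ)..Θ, radial α (T * s ^ α) (bdryDist R ru φ)) +
        2 * (π - Θ) * radial α (T * s ^ α) t := by
    rw [integral_symm_of_even (fun φ => by simp only [start, bdryDist_neg]) (hsi _ _),
      integral_symm_of_even (fun φ => by simp only [bdryDist_neg]) (hbi _ _),
      ← intervalIntegral.integral_add_adjacent_intervals (hsi 0 Θ) (hsi Θ π)]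
    have e1 : ∫ φ in (0 : ℝ)..Θ, radial α (T * s ^ α) (start R ru s t φ) =
        ∫ φ in (0 : ℝ)..Θ, radial α (T * s ^ α) (bdryDist R ru φ) := by
      refine intervalIntegral.integral_congr fun φ hφ => ?_
      rw [uIcc_of_le hΘ0] at hφ
      rw [start, min_eq_left (bdryDist_le_of_le_crossAngle hru ht0 ht.le ht'.le h1 hφ.1 hφ.2),
        max_eq_right (hsR.le.trans (sub_le_bdryDist h0 h1 φ))]
    have e2 : ∫ φ in Θ..π, radial α (T * s ^ α) (start R ru s t φ) =
        ∫ _φ in Θ..π, radial α (T * s ^ α) t := by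
      refine intervalIntegral.integral_congr fun φ hφ => ?_
      rw [uIcc_of_le hΘπ] at hφ
      rw [start, min_eq_right (le_bdryDist_of_crossAngle_le hru ht0 ht.le ht'.le h1 hφ.1 hφ.2),
        max_eq_right (by linarith)]
    rw [e1, e2, intervalIntegral.integral_const, smul_eq_mul]
    ring
  rw [covBound_eq hα hlam hc h0 h1 hs, P2, radial_eq hα hT hs.le ht0]
  simp only [radial_eq hα hT hs.le (bdryDist_pos h0 h1 _)]
  rw [hI, mul_assoc, ← exp_add]
  congr 3
  ring

/-- Going from the outward direction to the opposite one, the region starts at `s` while the cluster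
ends inside the disc of radius `s` (up to `Θ'`), then at the boundary of the cluster (up to `Θ`),
then at `t`. -/
lemma ofReal_P3_eq (hα : 2 < α) (hlam : 0 ≤ lam) (hT : 0 < T) (h0 : 0 ≤ ru) (h1 : ru < R) (hs : 0 < s)
    (hsR : R - ru < s) (hsR' : s < R + ru) (hst : s ≤ t) (ht' : t ≤ R + ru) :
    ENNReal.ofReal (P3 α lam σ R T ru s t) = covBound α lam σ R (T * s ^ α) ru s t := by
  have hru : 0 < ru := by linarith
  have ht0 : 0 < t := by linarith
  have ht : R - ru < t := hsR.trans_le hst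
  have hc : 0 ≤ T * s ^ α := by positivity
  have hRu : 0 < R - ru := by linarith
  have h12 := crossAngle_mono hru h1 hs hst
  set Θ := crossAngle R ru t with hΘ
  set Θ' := crossAngle R ru s with hΘ'
  obtain ⟨hΘ0, hΘπ⟩ := crossAngle_mem R ru t
  obtain ⟨hΘ0', hΘπ'⟩ := crossAngle_mem R ru s
  have hbi := fun x y => intervalIntegrable_radial_comp hα hc hRu
    continuous_bdryDist.measurable (sub_le_bdryDist h0 h1) x y
  have hsi := fun x y => intervalIntegrable_radial_comp hα hc hs
    (measurable_start (R := R) (ru := ru) (s := s) (t := t)) (fun φ => le_max_left _ _) x y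
  have hI : ∫ φ in (-π)..π, radial α (T * s ^ α) (start R ru s t φ) =
      2 * (∫ φ in Θ'..Θ, radial α (T * s ^ α) (bdryDist R ru φ)) +
        2 * Θ' * radial α (T * s ^ α) s + (2 * π - Θ - Θ) * radial α (T * s ^ α) t := by
    rw [integral_symm_of_even (fun φ => by simp only [start, bdryDist_neg]) (hsi _ _),
      ← intervalIntegral.integral_add_adjacent_intervals (hsi 0 Θ) (hsi Θ π),
      ← intervalIntegral.integral_add_adjacent_intervals (hsi 0 Θ') (hsi Θ' Θ)]
    have e0 : ∫ φ in (0 : ℝ)..Θ', radial α (T * s ^ α) (start R ru s t φ) =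
        ∫ _φ in (0 : ℝ)..Θ', radial α (T * s ^ α) s := by
      refine intervalIntegral.integral_congr fun φ hφ => ?_
      rw [uIcc_of_le hΘ0'] at hφ
      rw [start, max_eq_left ((min_le_left _ _).trans
        (bdryDist_le_of_le_crossAngle hru hs hsR.le hsR'.le h1 hφ.1 hφ.2))]
    have e1 : ∫ φ in Θ'..Θ, radial α (T * s ^ α) (start R ru s t φ) =
        ∫ φ in Θ'..Θ, radial α (T * s ^ α) (bdryDist R ru φ) := by
      refine intervalIntegral.integral_congr fun φ hφ => ?_
      rw [uIcc_of_le h12] at hφ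
      rw [start, min_eq_left (bdryDist_le_of_le_crossAngle hru ht0 ht.le ht' h1
        (hΘ0'.trans hφ.1) hφ.2), max_eq_right
        (le_bdryDist_of_crossAngle_le hru hs hsR.le hsR'.le h1 hφ.1 (hφ.2.trans hΘπ))]
    have e2 : ∫ φ in Θ..π, radial α (T * s ^ α) (start R ru s t φ) =
        ∫ _φ in Θ..π, radial α (T * s ^ α) t := by
      refine intervalIntegral.integral_congr fun φ hφ => ?_
      rw [uIcc_of_le hΘπ] at hφ
      rw [start, min_eq_right (le_bdryDist_of_crossAngle_le hru ht0 ht.le ht' h1 hφ.1 hφ.2),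
        max_eq_right hst]
    rw [e0, e1, e2, intervalIntegral.integral_const, intervalIntegral.integral_const, smul_eq_mul,
      smul_eq_mul]
    ring
  -- A ray starting at `s` itself has distance ratio `1`, and the powers combine to `s^α s^{2-α} =
  -- s²`.
  have hs1 : T * s ^ 2 * Lam α 1 T / (α - 2) = radial α (T * s ^ α) s := by
    have h2 : s ^ α * s ^ (2 - α) = s ^ 2 := by
      rw [← rpow_add hs, add_sub_cancel, rpow_two]
    rw [← radial_eq hα hT hs.le hs, div_self hs.ne', ← h2, mul_assoc T]
    ring
  rw [covBound_eq hα hlam hc h0 h1 hs, P3, radial_eq hα hT hs.le ht0, hs1]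
  simp only [radial_eq hα hT hs.le (bdryDist_pos h0 h1 _), intervalIntegral.integral_const, smul_eq_mul]
  rw [hI, mul_assoc, mul_assoc, ← exp_add, ← exp_add]
  congr 3
  ring

lemma P1_nonneg : 0 ≤ P1 α lam σ T s t := by unfold P1; positivity
lemma P2_nonneg : 0 ≤ P2 α lam σ R T ru s t := by unfold P2; positivity
lemma P3_nonneg : 0 ≤ P3 α lam σ R T ru s t := by unfold P3; positivity

/-- The indicator form, here and for the other two terms, also settles measurability: it reduces to
that of `covBound`, with no need to study integrals with variable endpoints. -/
lemma term1_eq (hα : 2 < α) (hlam : 0 ≤ lam) (hT : 0 < T) (h0 : 0 ≤ ru) (h1 : ru < R) (hs : 0 < s) :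
    term1 α lam σ R T ru s t = {p : ℝ × ℝ × ℝ | p.2.1 < R - p.1 ∧ p.2.1 < p.2.2 ∧ p.2.2 < R - p.1}.indicator
      (fun p => (covBound α lam σ R (T * p.2.1 ^ α) p.1 p.2.1 p.2.2).toReal) (ru, s, t) := by
  by_cases h : s < R - ru ∧ s < t ∧ t < R - ru
  · rw [term1, if_pos h, indicator_of_mem (by exact h)]
    rw [← ofReal_P1_eq hα hlam hT h0 h1 hs h.2.1 h.2.2, ENNReal.toReal_ofReal P1_nonneg]
  · rw [term1, if_neg h, indicator_of_notMem (by exact h)]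

lemma term2_eq (hα : 2 < α) (hlam : 0 ≤ lam) (hT : 0 < T) (h0 : 0 ≤ ru) (h1 : ru < R) (hs : 0 < s) :
    term2 α lam σ R T ru s t =
      {p : ℝ × ℝ × ℝ | p.2.1 < R - p.1 ∧ R - p.1 < p.2.2 ∧ p.2.2 < R + p.1}.indicator
      (fun p => (covBound α lam σ R (T * p.2.1 ^ α) p.1 p.2.1 p.2.2).toReal) (ru, s, t) := by
  by_cases h : s < R - ru ∧ R - ru < t ∧ t < R + ru
  · rw [term2, if_pos h, indicator_of_mem (by exact h)]
    rw [← ofReal_P2_eq hα hlam hT h0 h1 hs h.1 h.2.1 h.2.2, ENNReal.toReal_ofReal P2_nonneg]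
  · rw [term2, if_neg h, indicator_of_notMem (by exact h)]

lemma term3_eq (hα : 2 < α) (hlam : 0 ≤ lam) (hT : 0 < T) (h0 : 0 ≤ ru) (h1 : ru < R) (hs : 0 < s) :
    term3 α lam σ R T ru s t =
      {p : ℝ × ℝ × ℝ | (R - p.1 < p.2.1 ∧ p.2.1 < R + p.1) ∧ p.2.1 ≤ p.2.2 ∧ p.2.2 ≤ R + p.1}.indicator
      (fun p => (covBound α lam σ R (T * p.2.1 ^ α) p.1 p.2.1 p.2.2).toReal) (ru, s, t) := by
  by_cases h : (R - ru < s ∧ s < R + ru) ∧ s ≤ t ∧ t ≤ R + ru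
  · rw [term3, if_pos h, indicator_of_mem (by exact h)]
    rw [← ofReal_P3_eq hα hlam hT h0 h1 hs h.1.1 h.1.2 h.2.1 h.2.2, ENNReal.toReal_ofReal P3_nonneg]
  · rw [term3, if_neg h, indicator_of_notMem (by exact h)]

/-- The regions of the three terms are pairwise disjoint and each term equals `covBound` on its own;
elsewhere nonnegativity suffices, for instance when `t > R + r_u`. -/
lemma add_terms_le (hα : 2 < α) (hlam : 0 ≤ lam) (hT : 0 < T) (h0 : 0 ≤ ru) (h1 : ru < R) (hs : 0 < s) :
    term1 α lam σ R T ru s t + term2 α lam σ R T ru s t + term3 α lam σ R T ru s t ≤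
      (covBound α lam σ R (T * s ^ α) ru s t).toReal := by
  rw [term1_eq hα hlam hT h0 h1 hs, term2_eq hα hlam hT h0 h1 hs, term3_eq hα hlam hT h0 h1 hs]
  simp only [indicator, mem_ofPred_eq]
  have := (covBound α lam σ R (T * s ^ α) ru s t).toReal_nonneg
  split_ifs <;> grind

end terms

end CloudRadio

namespace CloudRadio

/-! ### The residual interference seen from the user -/

/-- Rotating the user onto the nonnegative real axis makes the polar angle the angle from the
outward radial direction. -/
lemma exists_linearIsometryEquiv_norm (u : Plane) : ∃ e : ℂ ≃ₗᵢ[ℝ] Plane, e (‖u‖ : ℂ) = u := by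
  set e0 : ℂ ≃ₗᵢ[ℝ] Plane := Complex.orthonormalBasisOneI.repr
  set w := e0.symm u with hw
  have hwn : ‖w‖ = ‖u‖ := e0.symm.norm_map u
  refine ⟨(rotation (Circle.exp w.arg)).trans e0, ?_⟩
  rw [LinearIsometryEquiv.trans_apply, rotation_apply, ← hwn, Circle.coe_exp, mul_comm,
    Complex.norm_mul_exp_arg_mul_I, hw, LinearIsometryEquiv.apply_symm_apply]

/-- Positions of the residual interferers of a user at `u`. -/
def residualSet (R : ℝ) (u : Plane) (s t : ℝ) : Set Plane :=
  {y | s < dist u y ∧ (y ∉ cluster R ∨ t < dist u y)}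

lemma measurableSet_residualSet (R : ℝ) (u : Plane) (s t : ℝ) : MeasurableSet (residualSet R u s t) := by
  have h1 : Measurable fun y : Plane => dist u y := by fun_prop
  exact (measurableSet_lt measurable_const h1).inter
    (Metric.isOpen_ball.measurableSet.compl.union (measurableSet_lt measurable_const h1))

lemma lintegral_residualSet (R : ℝ) (u : Plane) (s t : ℝ) (g : ℝ → ℝ≥0∞) :
    ∫⁻ y, (residualSet R u s t).indicator (fun y => g (dist u y)) y =
      ∫⁻ z in residualRegion R ‖u‖ s t, g ‖z‖ := by
  obtain ⟨e, he⟩ := exists_linearIsometryEquiv_norm u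
  rw [← lintegral_add_left_eq_self _ u, ← lintegral_indicator (measurableSet_residualRegion _ _ _ _),
    ← e.measurePreserving.lintegral_comp_emb e.toMeasurableEquiv.measurableEmbedding]
  refine lintegral_congr fun z => ?_
  have hd : dist u (u + e z) = ‖z‖ := by simp
  have hn : ‖u + e z‖ = ‖z + ‖u‖‖ := by
    nth_rw 1 [← he]
    rw [← map_add, e.norm_map, add_comm]
  have hmem : u + e z ∈ residualSet R u s t ↔ z ∈ residualRegion R ‖u‖ s t := by
    simp only [residualSet, residualRegion, mem_ofPred_eq, hd, cluster, mem_ball_zero_iff, hn, not_lt]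
  by_cases h : z ∈ residualRegion R ‖u‖ s t
  · rw [indicator_of_mem h, indicator_of_mem (hmem.2 h), hd]
  · rw [indicator_of_notMem h, indicator_of_notMem (fun h' => h (hmem.1 h'))]

/-- The exponential weight of an interferer at `y` in the Laplace transform. -/
noncomputable def weight (α R c : ℝ) (u : Plane) (s t : ℝ) : Plane → ℝ≥0∞ :=
  (residualSet R u s t).indicator fun y => ENNReal.ofReal (log (1 + c * dist u y ^ (-α)))

lemma measurable_weight {α R c : ℝ} {u : Plane} {s t : ℝ} : Measurable (weight α R c u s t) :=
  Measurable.indicator (by fun_prop) (measurableSet_residualSet R u s t)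

/-- Each point contributes `1 - 1 / (1 + c d^{-α}) = c / (d^α + c)`, so the exponent of the Laplace
functional of `weight` is `exponent`. -/
lemma lintegral_one_sub_weight {α R c : ℝ} (hc : 0 ≤ c) {u : Plane} {s t : ℝ} (hs : 0 ≤ s) :
    ∫⁻ y, (1 - eneg (weight α R c u s t y)) = exponent α R c ‖u‖ s t := by
  rw [exponent, ← lintegral_residualSet R u s t fun r => ENNReal.ofReal (c / (r ^ α + c))]
  refine lintegral_congr fun y => ?_
  by_cases h : y ∈ residualSet R u s t
  · have hd : 0 < dist u y := hs.trans_lt h.1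
    have hp := rpow_pos_of_pos hd α
    rw [weight, indicator_of_mem h, indicator_of_mem h, rpow_neg hd.le]
    have h1 : 1 ≤ 1 + c * (dist u y ^ α)⁻¹ := by
      have : 0 ≤ c * (dist u y ^ α)⁻¹ := by positivity
      linarith
    rw [eneg_ofReal (log_nonneg h1), exp_neg, exp_log (by linarith), ← ENNReal.ofReal_one,
      ← ENNReal.ofReal_sub _ (by positivity)]
    congr 1
    field_simp
    ring
  · rw [weight, indicator_of_notMem h, indicator_of_notMem h, eneg_zero, tsub_self]

/-! ### Configurations with known serving station -/

/-- A half-open annulus around the user. -/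
def annulus (u : Plane) (a b : ℝ) : Set Plane := Metric.closedBall u b \ Metric.closedBall u a

lemma mem_annulus {u y : Plane} {a b : ℝ} : y ∈ annulus u a b ↔ a < dist u y ∧ dist u y ≤ b := by
  simp [annulus, dist_comm u, and_comm]

lemma measurableSet_annulus {u : Plane} {a b : ℝ} : MeasurableSet (annulus u a b) :=
  Metric.isClosed_closedBall.measurableSet.diff Metric.isClosed_closedBall.measurableSet

/-- The single point of the first annulus is the strictly nearest station, and all others lie beyond
`s`. One of these that is in the cluster and within `t` belongs to a set of at most `L` points, so
it is cancelled. -/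
lemma exists_isServing {x : ℕ → Plane} {u : Plane} {R s' s t : ℝ} {L : ℕ}
    (h0 : count x (Metric.closedBall u s') = 0) (h1 : count x (annulus u s' s) = 1)
    (hL : count x (cluster R ∩ annulus u s t) ≤ L) :
    ∃ b, IsServing x u b ∧ s' < dist u (x b) ∧ dist u (x b) ≤ s ∧
      ∀ j, j ≠ b → j ∉ cancelled R L x u b → x j ∈ residualSet R u s t := by
  obtain ⟨b, hb⟩ := encard_eq_one.1 h1
  have hbm : x b ∈ annulus u s' s := by
    have : b ∈ {n | x n ∈ annulus u s' s} := hb ▸ mem_singleton b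
    exact this
  rw [mem_annulus] at hbm
  have h2 : ∀ j, s' < dist u (x j) := by
    intro j
    by_contra h
    have : j ∈ {n | x n ∈ Metric.closedBall u s'} := by
      change x j ∈ Metric.closedBall u s'
      rw [Metric.mem_closedBall, dist_comm]
      exact not_lt.1 h
    rw [encard_eq_zero.1 h0] at this
    exact this
  have h3 : ∀ j, j ≠ b → s < dist u (x j) := by
    intro j hj
    by_contra h
    have : j ∈ {n | x n ∈ annulus u s' s} := mem_annulus.2 ⟨h2 j, not_lt.1 h⟩
    rw [hb] at this
    exact hj this
  refine ⟨b, fun j hj => hbm.2.trans_lt (h3 j hj), hbm.1, hbm.2, fun j hj hjc => ⟨h3 j hj, ?_⟩⟩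
  by_contra hcon
  rw [not_or, not_not, not_lt] at hcon
  refine hjc ⟨hj, hcon.1, ?_⟩
  set A := {k | x k ∈ cluster R ∩ annulus u s t} with hA
  have hjA : j ∈ A := ⟨hcon.1, mem_annulus.2 ⟨h3 j hj, hcon.2⟩⟩
  have hsub : {k | k ≠ b ∧ x k ∈ cluster R ∧ dist u (x k) < dist u (x j)} ⊆ A \ {j} := by
    rintro k ⟨hkb, hkC, hkd⟩
    exact ⟨⟨hkC, mem_annulus.2 ⟨h3 k hkb, hkd.le.trans hcon.2⟩⟩, fun h => absurd hkd (by
      rw [show k = j from h]; exact lt_irrefl _)⟩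
  -- The station `j` itself lies in `A`, so fewer than `L` in-cluster interferers are strictly
  -- nearer.
  have hlt : (A \ {j}).encard < A.encard := by
    have hfin : A.Finite := finite_of_encard_le_coe hL
    exact (hfin.subset sdiff_subset).encard_lt_encard
      ⟨sdiff_subset, fun h => (h hjA).2 rfl⟩
  exact (encard_le_encard hsub).trans_lt (hlt.trans_le hL)

lemma nthDist_one_of_isServing {x : ℕ → Plane} {u : Plane} {b : ℕ} (h : IsServing x u b) :
    nthDist 1 x u = dist u (x b) := by
  have hb : ((1 : ℕ) : ℕ∞) ≤ {n | dist u (x n) ≤ dist u (x b)}.encard := by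
    rw [Nat.cast_one, one_le_encard_iff_nonempty]
    exact ⟨b, le_refl (dist u (x b))⟩
  refine le_antisymm (nthDist_le le_rfl hb) (le_csInf ⟨_, hb⟩ fun r hr => ?_)
  have hr : ((1 : ℕ) : ℕ∞) ≤ {n | dist u (x n) ≤ r}.encard := hr
  rw [Nat.cast_one, one_le_encard_iff_nonempty] at hr
  obtain ⟨n, hn⟩ := hr
  by_cases hnb : n = b
  · exact hnb ▸ hn
  · exact (h n hnb).le.trans hn

/-- The nearest station and `L` in-cluster interferers are `L + 1` points of the plane. Here the
distance that counts interferers everywhere is compared with the one that counts them in the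
cluster. -/
lemma nthDist_le_of_count {x : ℕ → Plane} {u : Plane} {R s' s t : ℝ} {L : ℕ} (hst : s ≤ t)
    (h1 : count x (annulus u s' s) = 1) (hL : count x (cluster R ∩ annulus u s t) = L) :
    nthDist (L + 1) x u ≤ t := by
  refine nthDist_le (by omega) ?_
  rw [encard_dist_le]
  have hd : Disjoint (annulus u s' s) (cluster R ∩ annulus u s t) :=
    disjoint_left.2 fun y h h' => not_lt.2 (mem_annulus.1 h).2 (mem_annulus.1 h'.2).1
  calc ((L + 1 : ℕ) : ℕ∞) = count x (annulus u s' s) + count x (cluster R ∩ annulus u s t) := by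
        rw [h1, hL, Nat.cast_add, Nat.cast_one, add_comm]
    _ = count x (annulus u s' s ∪ (cluster R ∩ annulus u s t)) := (count_union x hd).symm
    _ ≤ count x (Metric.closedBall u t) := by
        refine count_mono x (union_subset (fun y hy => ?_) fun y hy => ?_)
        · rw [Metric.mem_closedBall, dist_comm]
          exact (mem_annulus.1 hy).2.trans hst
        · rw [Metric.mem_closedBall, dist_comm]
          exact (mem_annulus.1 hy.2).2

end CloudRadio

namespace CloudRadio

/-! ### The coverage event -/

/-- The user at `u` is covered. -/
def IsCovered (α σ R : ℝ) (L : ℕ) (T : ℝ) (u : Plane) (g : ℕ → ℂ) (x : ℕ → Plane) : Prop :=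
  ∃ b, IsServing x u b ∧ ENNReal.ofReal T < sinr α σ R L x g u b

lemma interference_eq (α R : ℝ) (L : ℕ) (x : ℕ → Plane) (g : ℕ → ℂ) (u : Plane) (b : ℕ) :
    interference α R L x g u b = ∑' j, {j | j ≠ b ∧ j ∉ cancelled R L x u b}.indicator
      (fun j => ‖g j‖ₑ ^ 2 * edist u (x j) ^ (-α)) j := by
  rw [← tsum_subtype]
  rfl

lemma measurableSet_isCovered (α σ R : ℝ) (L : ℕ) (T : ℝ) :
    MeasurableSet {p : Plane × (ℕ → ℂ) × (ℕ → Plane) | IsCovered α σ R L T p.1 p.2.1 p.2.2} := by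
  have hx : ∀ j, Measurable fun p : Plane × (ℕ → ℂ) × (ℕ → Plane) => p.2.2 j := fun j => by fun_prop
  have hd : ∀ j, Measurable fun p : Plane × (ℕ → ℂ) × (ℕ → Plane) => dist p.1 (p.2.2 j) :=
    fun j => measurable_fst.dist (hx j)
  have hcl : ∀ j, MeasurableSet {p : Plane × (ℕ → ℂ) × (ℕ → Plane) | p.2.2 j ∈ cluster R} :=
    fun j => hx j Metric.isOpen_ball.measurableSet
  have hserv : ∀ b, MeasurableSet
      {p : Plane × (ℕ → ℂ) × (ℕ → Plane) | IsServing p.2.2 p.1 b} := by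
    intro b
    simp only [IsServing, ofPred_forall]
    exact MeasurableSet.iInter fun j => MeasurableSet.iInter fun _ => measurableSet_lt (hd b) (hd j)
  have hcanc : ∀ b j, MeasurableSet
      {p : Plane × (ℕ → ℂ) × (ℕ → Plane) | j ∈ cancelled R L p.2.2 p.1 b} := by
    intro b j
    have h1 : Measurable fun p : Plane × (ℕ → ℂ) × (ℕ → Plane) =>
        {k | k ≠ b ∧ p.2.2 k ∈ cluster R ∧ dist p.1 (p.2.2 k) < dist p.1 (p.2.2 j)}.encard :=
      measurable_encard_setOf fun k =>
        (MeasurableSet.const _).inter ((hcl k).inter (measurableSet_lt (hd k) (hd j)))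
    exact (MeasurableSet.const _).inter ((hcl j).inter
      (h1 (MeasurableSet.of_discrete (s := Iio (L : ℕ∞)))))
  have hint : ∀ b, Measurable fun p : Plane × (ℕ → ℂ) × (ℕ → Plane) =>
      interference α R L p.2.2 p.2.1 p.1 b := by
    intro b
    simp only [interference_eq]
    refine Measurable.tsum fun j => ?_
    have hS : MeasurableSet {p : Plane × (ℕ → ℂ) × (ℕ → Plane) |
        j ≠ b ∧ j ∉ cancelled R L p.2.2 p.1 b} := (MeasurableSet.const _).inter (hcanc b j).compl
    have hf : Measurable fun p : Plane × (ℕ → ℂ) × (ℕ → Plane) =>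
        ‖p.2.1 j‖ₑ ^ 2 * edist p.1 (p.2.2 j) ^ (-α) := by fun_prop
    exact hf.indicator hS
  simp only [IsCovered, ofPred_exists]
  refine MeasurableSet.iUnion fun b => ?_
  have hs : Measurable fun p : Plane × (ℕ → ℂ) × (ℕ → Plane) => sinr α σ R L p.2.2 p.2.1 p.1 b := by
    unfold sinr
    have := hint b
    fun_prop
  have hlt : MeasurableSet {p : Plane × (ℕ → ℂ) × (ℕ → Plane) |
      ENNReal.ofReal T < sinr α σ R L p.2.2 p.2.1 p.1 b} := measurableSet_lt measurable_const hs
  exact (hserv b).inter hlt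

/-! ### Coverage on events described by counts. -/

section fading

variable {Ω : Type*} [MeasurableSpace Ω] {P : Measure Ω} [IsProbabilityMeasure P]
  {lam α σ R T : ℝ} {L : ℕ} {X : ℕ → Ω → Plane} {h : ℕ → Ω → ℂ}

/-- The serving distance is rounded up to `s`, which raises the scaled threshold. Every uncancelled
station lies in the residual set, where `weight` is its exact exponent; other points there are
charged needlessly, which only lowers the bound. -/
lemma le_measure_isCovered (hm : ∀ n, Measurable (h n))
    (hlaw : ∀ n, P.map (h n) = stdComplexGaussian) (hi : iIndepFun h P) (hα : 2 < α) (hT : 0 < T)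
    {x : ℕ → Plane} {u : Plane} {s' s t : ℝ} (hs' : 0 ≤ s')
    (h0 : count x (Metric.closedBall u s') = 0) (h1 : count x (annulus u s' s) = 1)
    (hL : count x (cluster R ∩ annulus u s t) ≤ L) :
    eneg (ENNReal.ofReal (T * s ^ α * σ ^ 2)) * eneg (∑' n, weight α R (T * s ^ α) u s t (x n)) ≤
      P {ω | IsCovered α σ R L T u (fun n => h n ω) x} := by
  obtain ⟨b, hb, hb1, hb2, hres⟩ := exists_isServing h0 h1 hL
  have hd : 0 < dist u (x b) := hs'.trans_lt hb1
  have hs : 0 < s := hd.trans_le hb2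
  have hc : 0 ≤ T * s ^ α := by positivity
  have hw : ∀ j, 0 < dist u (x j) →
      edist u (x j) ^ (-α) = ENNReal.ofReal (dist u (x j) ^ (-α)) := fun j hj => by
    rw [edist_dist, ENNReal.ofReal_rpow_of_pos hj]
  refine le_trans ?_ (measure_mono (s := {ω | ENNReal.ofReal T <
    sinr α σ R L x (fun n => h n ω) u b}) fun ω hω => ⟨b, hb, hω⟩)
  rw [ENNReal.ofReal_mul hc]
  refine le_measure_sinr hm hlaw hi b {j | j ≠ b ∧ j ∉ cancelled R L x u b} (fun hb => hb.1 rfl)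
    (fun j => edist u (x j) ^ (-α)) (fun n => weight α R (T * s ^ α) u s t (x n)) ?_ ?_ hT hc ?_ ?_ _
  · rw [hw b hd]
    simpa using rpow_pos_of_pos hd _
  · rw [hw b hd]
    exact ENNReal.ofReal_ne_top
  · rw [hw b hd, ← ENNReal.ofReal_mul hc]
    refine ENNReal.ofReal_le_ofReal ?_
    have h2 : dist u (x b) ^ α ≤ s ^ α := rpow_le_rpow hd.le hb2 (by linarith)
    have h3 := rpow_pos_of_pos hd α
    rw [rpow_neg hd.le, mul_assoc, ← div_eq_mul_inv]
    exact le_mul_of_one_le_right hT.le ((one_le_div h3).2 h2)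
  · rintro j ⟨hjb, hjc⟩
    have hj := hres j hjb hjc
    have hdj : 0 < dist u (x j) := hs.trans hj.1
    refine ⟨dist u (x j) ^ (-α), by positivity, hw j hdj, ?_⟩
    rw [weight, indicator_of_mem hj]

/-- The contribution of configurations prescribed by the numbers of points in finitely many sets. -/
lemma mul_covBound_le (hX : IsPoissonProcess P lam X) (hlam : 0 ≤ lam) (hm : ∀ n, Measurable (h n))
    (hlaw : ∀ n, P.map (h n) = stdComplexGaussian) (hi : iIndepFun h P) (hα : 2 < α) (hT : 0 < T)
    {u : Plane} {s' s t : ℝ} (hs' : 0 ≤ s') (hs : s' ≤ s)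
    {ι : Type*} [Fintype ι] {Q : ι → Set Plane} (hQ : ∀ i, MeasurableSet (Q i))
    (hv : ∀ i, volume (Q i) ≠ ∞) (hd : Pairwise fun i j => Disjoint (Q i) (Q j))
    (hQr : ∀ i, Disjoint (Q i) (residualSet R u s t)) (E : Set (ι → ℕ∞))
    (hE : ∀ ω, (fun i => count (fun n => X n ω) (Q i)) ∈ E →
      count (fun n => X n ω) (Metric.closedBall u s') = 0 ∧
      count (fun n => X n ω) (annulus u s' s) = 1 ∧
      count (fun n => X n ω) (cluster R ∩ annulus u s t) ≤ L) :
    ∫⁻ _ω in {ω | (fun i => count (fun n => X n ω) (Q i)) ∈ E},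
        covBound α lam σ R (T * s ^ α) ‖u‖ s t ∂P ≤
      ∫⁻ ω in {ω | (fun i => count (fun n => X n ω) (Q i)) ∈ E},
        P {ω' | IsCovered α σ R L T u (fun n => h n ω') (fun n => X n ω)} ∂P := by
  have hc : 0 ≤ T * s ^ α := mul_nonneg hT.le (rpow_nonneg (hs'.trans hs) _)
  have hA : MeasurableSet {ω | (fun i => count (fun n => X n ω) (Q i)) ∈ E} := by
    have : Measurable fun ω i => count (fun n => X n ω) (Q i) :=
      measurable_pi_lambda _ fun i => measurable_count hX.measurable (hQ i)
    exact this MeasurableSet.of_discrete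
  -- The weight is supported on the residual set, disjoint from all `Q i`; this separates the event
  -- from the interference.
  have h1 := hX.laplace_le hlam hQ hv hd E (f := weight α R (T * s ^ α) u s t) measurable_weight
    fun i y hy => indicator_of_notMem (disjoint_left.1 (hQr i) hy) _
  rw [lintegral_one_sub_weight hc (hs'.trans hs)] at h1
  rw [setLIntegral_const, covBound, mul_assoc, mul_comm (eneg (ENNReal.ofReal lam * _))]
  refine (mul_le_mul_right h1 _).trans ?_
  rw [← lintegral_const_mul' _ _ (eneg_ne_top _)]
  refine setLIntegral_mono' hA fun ω hω => ?_
  obtain ⟨e0, e1, e2⟩ := hE ω hω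
  exact le_measure_isCovered hm hlaw hi hα hT hs' e0 e1 e2

end fading

/-! ### The configurations of a grid of annuli -/

/-- Radii of annuli of equal area. -/
noncomputable def gridRadius (M : ℝ) (N j : ℕ) : ℝ := M * √(j / N)

section grid

variable {M : ℝ} {N : ℕ} {u : Plane} {R : ℝ} {L : ℕ} {x : ℕ → Plane}

lemma gridRadius_nonneg (hM : 0 ≤ M) (N j : ℕ) : 0 ≤ gridRadius M N j := by
  unfold gridRadius; positivity

lemma gridRadius_mono (hM : 0 ≤ M) : Monotone (gridRadius M N) := fun i j h => by
  unfold gridRadius; gcongr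

lemma gridRadius_zero : gridRadius M N 0 = 0 := by simp [gridRadius]

lemma gridRadius_self (hN : 0 < N) : gridRadius M N N = M := by
  have : (N : ℝ) ≠ 0 := by positivity
  simp [gridRadius, this]

lemma gridRadius_sq (j : ℕ) : gridRadius M N j ^ 2 = M ^ 2 * (j / N) := by
  rw [gridRadius, mul_pow, sq_sqrt (by positivity)]

/-- The configuration in which the nearest point lies in the annulus `i` and the `L`-th nearest
interferer in the cluster lies in the annulus `k` or, for `k = N`, in none of the annuli. -/
def IsBin (M : ℝ) (N : ℕ) (R : ℝ) (L : ℕ) (u : Plane) (i k : ℕ) (x : ℕ → Plane) : Prop :=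
  count x (Metric.closedBall u (gridRadius M N i)) = 0 ∧
  count x (annulus u (gridRadius M N i) (gridRadius M N (i + 1))) = 1 ∧
  count x (cluster R ∩ annulus u (gridRadius M N (i + 1)) (gridRadius M N k)) < L ∧
  (k < N → count x (cluster R ∩ annulus u (gridRadius M N (i + 1)) (gridRadius M N k)) +
    count x (cluster R ∩ annulus u (gridRadius M N k) (gridRadius M N (k + 1))) = L)

lemma annulus_union {a b c : ℝ} (hab : a ≤ b) (hbc : b ≤ c) :
    annulus u a b ∪ annulus u b c = annulus u a c := by
  ext y
  simp only [mem_union, mem_annulus]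
  constructor
  · rintro (⟨h1, h2⟩ | ⟨h1, h2⟩)
    · exact ⟨h1, h2.trans hbc⟩
    · exact ⟨hab.trans_lt h1, h2⟩
  · rintro ⟨h1, h2⟩
    rcases le_or_gt (dist u y) b with h | h
    · exact Or.inl ⟨h1, h⟩
    · exact Or.inr ⟨h, h2⟩

lemma disjoint_annulus {a b c d : ℝ} (hbc : b ≤ c) : Disjoint (annulus u a b) (annulus u c d) :=
  disjoint_left.2 fun _ h h' =>
    absurd ((mem_annulus.1 h).2.trans hbc) (not_le.2 (mem_annulus.1 h').1)

lemma count_inter_annulus (C : Set Plane) {a b c : ℝ} (hab : a ≤ b) (hbc : b ≤ c) :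
    count x (C ∩ annulus u a c) = count x (C ∩ annulus u a b) + count x (C ∩ annulus u b c) := by
  rw [← annulus_union hab hbc, inter_union_distrib_left, count_union]
  exact (disjoint_annulus le_rfl).mono inter_subset_right inter_subset_right

lemma count_closedBall {a b : ℝ} (hab : a ≤ b) :
    count x (Metric.closedBall u b) = count x (Metric.closedBall u a) + count x (annulus u a b) := by
  rw [annulus, ← count_union x disjoint_sdiff_right,
    union_sdiff_cancel (Metric.closedBall_subset_closedBall hab)]

lemma cluster_inter_annulus_eq_empty (hu : u ∈ cluster R) (hM : 2 * R ≤ M) {b : ℝ} :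
    cluster R ∩ annulus u M b = ∅ := by
  rw [eq_empty_iff_forall_notMem]
  rintro y ⟨hy, hy'⟩
  have h1 := dist_triangle_right u y 0
  have h2 : dist u 0 < R := hu
  have h3 : dist y 0 < R := hy
  linarith [(mem_annulus.1 hy').1]

/-- For `k = N` the next annulus lies beyond `M ≥ 2R`, hence outside the cluster, and adds no
in-cluster point. -/
lemma IsBin.count_le {i k : ℕ} (hM : 0 < M) (hu : u ∈ cluster R) (hMR : 2 * R ≤ M) (hik : i + 1 ≤ k)
    (hkN : k ≤ N) (h : IsBin M N R L u i k x) :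
    count x (cluster R ∩ annulus u (gridRadius M N (i + 1)) (gridRadius M N (k + 1))) ≤ L := by
  rw [count_inter_annulus _ (gridRadius_mono hM.le hik) (gridRadius_mono hM.le k.le_succ)]
  rcases hkN.lt_or_eq with hk | rfl
  · exact (h.2.2.2 hk).le
  · rw [gridRadius_self (by omega), cluster_inter_annulus_eq_empty hu hMR, count_empty, add_zero]
    have := h.2.2.1.le
    rwa [gridRadius_self (by omega)] at this

/-- A larger `i'` would require a disc containing the nonempty annulus of `i` to be empty; a larger
`k'` would require fewer than `L` in-cluster interferers where `L` have been counted. -/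
lemma IsBin.unique (hM : 0 < M) {i k i' k' : ℕ} (hik : i + 1 ≤ k) (hik' : i' + 1 ≤ k') (hk : k ≤ N)
    (hk' : k' ≤ N) (h : IsBin M N R L u i k x) (h' : IsBin M N R L u i' k' x) : i = i' ∧ k = k' := by
  have hi : ∀ {i k i' k' : ℕ}, IsBin M N R L u i k x → IsBin M N R L u i' k' x → ¬ i < i' := by
    intro i k i' k' h h' hlt
    have h1 := count_mono x (Metric.closedBall_subset_closedBall (x := u)
      (gridRadius_mono (N := N) hM.le (Nat.succ_le_of_lt hlt)))
    rw [h'.1, count_closedBall (gridRadius_mono hM.le i.le_succ), h.1, h.2.1] at h1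
    simp at h1
  have hii : i = i' := le_antisymm (not_lt.1 (hi h' h)) (not_lt.1 (hi h h'))
  subst hii
  have hkk : ∀ {k k' : ℕ}, i + 1 ≤ k → k' ≤ N → IsBin M N R L u i k x → IsBin M N R L u i k' x →
      ¬ k < k' := by
    intro k k' hik hk' h h' hlt
    have h1 := h.2.2.2 (hlt.trans_le hk')
    have h2 := h'.2.2.1
    rw [count_inter_annulus _ (gridRadius_mono hM.le (hik.trans k.le_succ))
      (gridRadius_mono hM.le (Nat.succ_le_of_lt hlt)),
      count_inter_annulus _ (gridRadius_mono hM.le hik) (gridRadius_mono hM.le k.le_succ), h1] at h2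
    exact absurd h2 (not_lt.2 le_self_add)
  exact ⟨rfl, le_antisymm (not_lt.1 (hkk hik' hk h' h)) (not_lt.1 (hkk hik hk' h h'))⟩

/-- The indices are those at which the disc first becomes nonempty and the in-cluster count first
reaches `L`. Since no annulus holds two points, these counts jump to exactly `1` and `L`. -/
lemma exists_isBin (hM : 0 < M) (hN : 0 < N) (hL : 1 ≤ L)
    (h0 : count x (Metric.closedBall u 0) = 0) (h1 : count x (Metric.closedBall u M) ≠ 0)
    (h2 : ∀ j < N, count x (annulus u (gridRadius M N j) (gridRadius M N (j + 1))) ≤ 1) :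
    ∃ i k, i + 1 ≤ k ∧ k ≤ N ∧ IsBin M N R L u i k x := by
  classical
  have hex : ∃ m, count x (Metric.closedBall u (gridRadius M N m)) ≠ 0 :=
    ⟨N, by rwa [gridRadius_self hN]⟩
  obtain ⟨i, hi⟩ : ∃ i, Nat.find hex = i + 1 := by
    refine Nat.exists_eq_succ_of_ne_zero fun h => ?_
    have := Nat.find_spec hex
    rw [h, gridRadius_zero] at this
    exact this h0
  have hiN : i + 1 ≤ N := hi ▸ Nat.find_min' hex (by rwa [gridRadius_self hN])
  have e0 : count x (Metric.closedBall u (gridRadius M N i)) = 0 :=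
    not_not.1 (Nat.find_min hex (hi ▸ i.lt_succ_self))
  have e1 : count x (annulus u (gridRadius M N i) (gridRadius M N (i + 1))) = 1 := by
    have := Nat.find_spec hex
    rw [hi, count_closedBall (gridRadius_mono hM.le i.le_succ), e0, zero_add] at this
    exact le_antisymm (h2 i (by omega)) (Order.one_le_iff_ne_zero.2 this)
  -- If even the full disc has fewer than `L` in-cluster interferers, the bin is the one with `k =
  -- N`.
  by_cases hP : count x (cluster R ∩ annulus u (gridRadius M N (i + 1)) (gridRadius M N N)) < L
  · exact ⟨i, N, hiN, le_rfl, e0, e1, hP, fun h => absurd h (lt_irrefl _)⟩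
  · have hex' : ∃ m, ¬ count x (cluster R ∩ annulus u (gridRadius M N (i + 1)) (gridRadius M N m)) < L :=
      ⟨N, hP⟩
    have hfind : ∀ m, ¬ count x (cluster R ∩ annulus u (gridRadius M N (i + 1)) (gridRadius M N m)) < L →
        i + 1 < m := by
      intro m hm
      by_contra hle
      refine hm ?_
      have : annulus u (gridRadius M N (i + 1)) (gridRadius M N m) = ∅ := by
        rw [eq_empty_iff_forall_notMem]
        intro y hy
        rw [mem_annulus] at hy
        exact absurd (hy.1.trans_le hy.2) (not_lt.2 (gridRadius_mono hM.le (not_lt.1 hle)))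
      rw [this, inter_empty, count_empty]
      exact_mod_cast hL
    obtain ⟨k, hk⟩ : ∃ k, Nat.find hex' = k + 1 :=
      Nat.exists_eq_succ_of_ne_zero (by have := hfind _ (Nat.find_spec hex'); omega)
    have hik : i + 1 ≤ k := by have := hfind _ (Nat.find_spec hex'); omega
    have hkN : k + 1 ≤ N := hk ▸ Nat.find_min' hex' hP
    have e2 : count x (cluster R ∩ annulus u (gridRadius M N (i + 1)) (gridRadius M N k)) < L :=
      not_not.1 (Nat.find_min hex' (hk ▸ k.lt_succ_self))
    have e3 := Nat.find_spec hex'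
    rw [hk, count_inter_annulus _ (gridRadius_mono hM.le hik) (gridRadius_mono hM.le k.le_succ),
      not_lt] at e3
    have e4 := (count_mono x (inter_subset_right (s := cluster R)
      (t := annulus u (gridRadius M N k) (gridRadius M N (k + 1))))).trans (h2 k (by omega))
    refine ⟨i, k, hik, by omega, e0, e1, e2, fun _ => le_antisymm ?_ e3⟩
    calc _ ≤ count x (cluster R ∩ annulus u (gridRadius M N (i + 1)) (gridRadius M N k)) + 1 := by
          gcongr
      _ ≤ L := Order.add_one_le_of_lt e2

end grid

end CloudRadio

namespace CloudRadio

/-! ### Passing to the limit of fine grids -/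

/-- The bound `covBound` with the scaled threshold in the exponent replaced by a larger `κ`. -/
noncomputable def relaxedBound (α lam σ R κ c ru s t : ℝ) : ℝ≥0∞ :=
  eneg (ENNReal.ofReal (κ * σ ^ 2)) *
    eneg (ENNReal.ofReal lam * (ENNReal.ofReal (κ / c) * exponent α R c ru s t))

lemma relaxedBound_le_one {α lam σ R κ c ru s t : ℝ} : relaxedBound α lam σ R κ c ru s t ≤ 1 :=
  mul_le_one' (eneg_le_one _) (eneg_le_one _)

lemma residualRegion_mono {R ru s t s' t' : ℝ} (hs : s ≤ s') (ht : t ≤ t') :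
    residualRegion R ru s' t' ⊆ residualRegion R ru s t :=
  fun _ hz => ⟨hs.trans_lt hz.1, hz.2.imp id ht.trans_lt⟩

lemma residualRegion_subset_of_two_mul_le {R ru s t s' t' : ℝ} (h0 : 0 ≤ ru) (h1 : ru < R) (hs : s ≤ s')
    (ht' : 2 * R ≤ t') : residualRegion R ru s' t' ⊆ residualRegion R ru s t := by
  rintro z ⟨hz1, hz2⟩
  refine ⟨hs.trans_lt hz1, Or.inl (hz2.elim id fun hz => ?_)⟩
  have h2 := norm_sub_le (z + ru) (ru : ℂ)
  rw [add_sub_cancel_right, Complex.norm_real, norm_of_nonneg h0] at h2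
  linarith

/-- Pointwise, `c' / (x + c') ≤ κ / (x + c) = (κ / c) · c / (x + c)`. A change of threshold thus
becomes a scalar factor, with the residual region left at the true distances, so that no continuity
in the region is needed later. -/
lemma relaxedBound_le_covBound {α lam σ R κ c c' ru s t s' t' : ℝ} (hc : 0 < c) (hcc : c ≤ c')
    (hκ : c' ≤ κ) (hsub : residualRegion R ru s' t' ⊆ residualRegion R ru s t) :
    relaxedBound α lam σ R κ c ru s t ≤ covBound α lam σ R c' ru s' t' := by
  have hκ0 : 0 < κ := hc.trans_le (hcc.trans hκ)
  refine mul_le_mul' (eneg_antitone ?_) (eneg_antitone ?_)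
  · gcongr
  · gcongr
    rw [exponent, exponent, ← lintegral_const_mul' _ _ ENNReal.ofReal_ne_top]
    refine (lintegral_mono_set hsub).trans (lintegral_mono fun z => ?_)
    rw [← ENNReal.ofReal_mul (by positivity)]
    refine ENNReal.ofReal_le_ofReal ?_
    have hp : 0 ≤ ‖z‖ ^ α := by positivity
    have h1 : κ / c * (c / (‖z‖ ^ α + c)) = κ / (‖z‖ ^ α + c) := by field_simp
    rw [h1]
    gcongr

lemma tendsto_relaxedBound {α lam σ R c ru s t : ℝ} (hc : 0 < c) {κ : ℕ → ℝ}
    (hκ : Filter.Tendsto κ Filter.atTop (nhds c)) :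
    Filter.Tendsto (fun N => relaxedBound α lam σ R (κ N) c ru s t) Filter.atTop
      (nhds (covBound α lam σ R c ru s t)) := by
  refine ENNReal.Tendsto.mul ?_ (Or.inr (eneg_ne_top _)) ?_ (Or.inr (eneg_ne_top _))
  · exact (continuous_eneg.tendsto _).comp (ENNReal.tendsto_ofReal (hκ.mul_const _))
  · refine (continuous_eneg.tendsto _).comp (ENNReal.Tendsto.const_mul ?_ (Or.inr ENNReal.ofReal_ne_top))
    have h1 : Filter.Tendsto (fun N => ENNReal.ofReal (κ N / c)) Filter.atTop (nhds 1) := by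
      rw [← ENNReal.ofReal_one, ← div_self hc.ne']
      exact ENNReal.tendsto_ofReal (hκ.div_const c)
    simpa using ENNReal.Tendsto.mul_const (b := exponent α R c ru s t) h1 (Or.inl one_ne_zero)

/-- The scaled threshold at the end of the annulus that contains the serving station. -/
noncomputable def gridThreshold (α T M : ℝ) (N : ℕ) (s : ℝ) : ℝ := T * (s ^ 2 + M ^ 2 / N) ^ (α / 2)

lemma rpow_eq_sq_rpow {s α : ℝ} (hs : 0 ≤ s) : s ^ α = (s ^ 2) ^ (α / 2) := by
  rw [← rpow_natCast, ← rpow_mul hs]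
  congr 1
  push_cast
  ring

lemma tendsto_gridThreshold {α T M s : ℝ} (hs : 0 < s) :
    Filter.Tendsto (fun N : ℕ => gridThreshold α T M N s) Filter.atTop (nhds (T * s ^ α)) := by
  rw [rpow_eq_sq_rpow hs.le]
  have h1 : Filter.Tendsto (fun N : ℕ => s ^ 2 + M ^ 2 / (N : ℝ)) Filter.atTop (nhds (s ^ 2)) := by
    simpa using (tendsto_const_div_atTop_nhds_zero_nat (M ^ 2)).const_add (s ^ 2)
  exact (h1.rpow_const (Or.inl (pow_pos hs 2).ne')).const_mul T

section limit

variable {Ω : Type*} [MeasurableSpace Ω] {P : Measure Ω}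
  {lam α σ R T M : ℝ} {L N : ℕ} {X : ℕ → Ω → Plane} {h : ℕ → Ω → ℂ} {u : Plane}

lemma relaxedBound_le_of_isBin (hM : 0 < M) (hMR : 2 * R ≤ M) (hα : 2 < α) (hT : 0 < T)
    (hu : u ∈ cluster R) {x : ℕ → Plane} {i k : ℕ} (hik : i + 1 ≤ k) (hkN : k ≤ N)
    (hx : IsBin M N R L u i k x) :
    relaxedBound α lam σ R (gridThreshold α T M N (nthDist 1 x u)) (T * nthDist 1 x u ^ α) ‖u‖
        (nthDist 1 x u) (nthDist (L + 1) x u) ≤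
      covBound α lam σ R (T * gridRadius M N (i + 1) ^ α) ‖u‖ (gridRadius M N (i + 1))
        (gridRadius M N (k + 1)) := by
  obtain ⟨b, hb, hb1, hb2, -⟩ := exists_isServing hx.1 hx.2.1 (hx.count_le hM hu hMR hik hkN)
  have hrb := nthDist_one_of_isServing hb
  have h0 : 0 ≤ gridRadius M N i := gridRadius_nonneg hM.le N i
  rw [← hrb] at hb1 hb2
  have hN : (0 : ℝ) < N := by
    have : 0 < N := by omega
    exact_mod_cast this
  have hpos : 0 < nthDist 1 x u := h0.trans_lt hb1
  have hs := hpos.trans_le hb2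
  have hu' : ‖u‖ < R := by simpa [cluster] using hu
  refine relaxedBound_le_covBound (by positivity) (by gcongr) ?_ ?_
  · rw [gridThreshold, rpow_eq_sq_rpow hs.le]
    gcongr
    -- Equal areas make consecutive squared radii differ by `M² / N`, and the serving station lies
    -- beyond the inner radius.
    have h3 : gridRadius M N (i + 1) ^ 2 = gridRadius M N i ^ 2 + M ^ 2 / N := by
      rw [gridRadius_sq, gridRadius_sq]; push_cast; ring
    rw [h3]
    gcongr
  -- For `k < N` the `L`-th interferer of the plane is within the outer radius; for `k = N` that
  -- radius exceeds `2R`, so lying beyond it already means lying outside the cluster.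
  · rcases hkN.lt_or_eq with hk | rfl
    · refine residualRegion_mono hb2 (nthDist_le_of_count (R := R) (gridRadius_mono hM.le (by omega))
        hx.2.1 ?_)
      rw [count_inter_annulus _ (gridRadius_mono hM.le hik) (gridRadius_mono hM.le k.le_succ)]
      exact hx.2.2.2 hk
    · refine residualRegion_subset_of_two_mul_le (norm_nonneg u) hu' hb2 (hMR.trans ?_)
      calc M = gridRadius M k k := (gridRadius_self (by omega)).symm
        _ ≤ gridRadius M k (k + 1) := gridRadius_mono hM.le k.le_succ

/-- The sets of points that determine a configuration. -/
noncomputable def binSets (M : ℝ) (N : ℕ) (R : ℝ) (u : Plane) (i k : ℕ) : Fin 4 → Set Plane :=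
  ![Metric.closedBall u (gridRadius M N i), annulus u (gridRadius M N i) (gridRadius M N (i + 1)),
    cluster R ∩ annulus u (gridRadius M N (i + 1)) (gridRadius M N k),
    cluster R ∩ annulus u (gridRadius M N k) (gridRadius M N (k + 1))]

lemma disjoint_closedBall_annulus {a b c : ℝ} (h : a ≤ b) :
    Disjoint (Metric.closedBall u a) (annulus u b c) :=
  disjoint_left.2 fun y hy hy' => by
    rw [Metric.mem_closedBall, dist_comm] at hy
    exact absurd (hy.trans h) (not_le.2 (mem_annulus.1 hy').1)

lemma pairwise_disjoint_binSets (hM : 0 < M) {i k : ℕ} (hik : i + 1 ≤ k) :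
    Pairwise fun a b => Disjoint (binSets M N R u i k a) (binSets M N R u i k b) := by
  have m1 := gridRadius_mono (N := N) hM.le i.le_succ
  have m2 := gridRadius_mono (N := N) hM.le hik
  have d01 := disjoint_closedBall_annulus (u := u) (c := gridRadius M N (i + 1))
    (le_refl (gridRadius M N i))
  have d02 := (disjoint_closedBall_annulus (u := u) (c := gridRadius M N k) m1).mono_right
    (inter_subset_right (s := cluster R))
  have d03 := (disjoint_closedBall_annulus (u := u) (c := gridRadius M N (k + 1))
    (m1.trans m2)).mono_right (inter_subset_right (s := cluster R))
  have d12 := (disjoint_annulus (u := u) (a := gridRadius M N i) (d := gridRadius M N k)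
    (le_refl (gridRadius M N (i + 1)))).mono_right (inter_subset_right (s := cluster R))
  have d13 := (disjoint_annulus (u := u) (a := gridRadius M N i) (d := gridRadius M N (k + 1))
    m2).mono_right (inter_subset_right (s := cluster R))
  have d23 := (disjoint_annulus (u := u) (a := gridRadius M N (i + 1)) (d := gridRadius M N (k + 1))
    (le_refl (gridRadius M N k))).mono (inter_subset_right (s := cluster R))
    (inter_subset_right (s := cluster R))
  intro a b hab
  fin_cases a <;> fin_cases b
  · exact absurd rfl hab
  · exact d01
  · exact d02
  · exact d03
  · exact d01.symm
  · exact absurd rfl hab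
  · exact d12
  · exact d13
  · exact d02.symm
  · exact d12.symm
  · exact absurd rfl hab
  · exact d23
  · exact d03.symm
  · exact d13.symm
  · exact d23.symm
  · exact absurd rfl hab

/-- The vectors of numbers of points that belong to a configuration. -/
def binCounts (N L k : ℕ) : Set (Fin 4 → ℕ∞) :=
  {v | v 0 = 0 ∧ v 1 = 1 ∧ v 2 < L ∧ (k < N → v 2 + v 3 = L)}

lemma measurableSet_binSets {i k : ℕ} (a : Fin 4) : MeasurableSet (binSets M N R u i k a) := by
  have hC : MeasurableSet (cluster R) := Metric.isOpen_ball.measurableSet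
  fin_cases a
  · exact Metric.isClosed_closedBall.measurableSet
  · exact measurableSet_annulus
  · exact hC.inter measurableSet_annulus
  · exact hC.inter measurableSet_annulus

lemma volume_annulus_ne_top {a b : ℝ} : volume (annulus u a b) ≠ ∞ :=
  ne_top_of_le_ne_top (measure_closedBall_lt_top (x := u) (r := b)).ne (measure_mono sdiff_subset)

lemma volume_binSets_ne_top {i k : ℕ} (a : Fin 4) : volume (binSets M N R u i k a) ≠ ∞ := by
  fin_cases a
  · exact measure_closedBall_lt_top.ne
  · exact volume_annulus_ne_top
  · exact ne_top_of_le_ne_top (volume_annulus_ne_top (u := u)) (measure_mono inter_subset_right)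
  · exact ne_top_of_le_ne_top (volume_annulus_ne_top (u := u)) (measure_mono inter_subset_right)

lemma disjoint_binSets_residualSet (hM : 0 < M) {i k : ℕ} (a : Fin 4) :
    Disjoint (binSets M N R u i k a)
      (residualSet R u (gridRadius M N (i + 1)) (gridRadius M N (k + 1))) := by
  have m1 := gridRadius_mono (N := N) hM.le i.le_succ
  have m2 := gridRadius_mono (N := N) hM.le k.le_succ
  rw [disjoint_left]
  intro y hy hr
  fin_cases a
  · have hy : y ∈ Metric.closedBall u (gridRadius M N i) := hy
    rw [Metric.mem_closedBall, dist_comm] at hy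
    exact absurd (hy.trans m1) (not_le.2 hr.1)
  · have hy : y ∈ annulus u (gridRadius M N i) (gridRadius M N (i + 1)) := hy
    exact absurd (mem_annulus.1 hy).2 (not_le.2 hr.1)
  · have hy : y ∈ cluster R ∩ annulus u (gridRadius M N (i + 1)) (gridRadius M N k) := hy
    exact hr.2.elim (fun h => h hy.1) fun h =>
      absurd ((mem_annulus.1 hy.2).2.trans m2) (not_le.2 h)
  · have hy : y ∈ cluster R ∩ annulus u (gridRadius M N k) (gridRadius M N (k + 1)) := hy
    exact hr.2.elim (fun h => h hy.1) fun h => absurd (mem_annulus.1 hy.2).2 (not_le.2 h)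

lemma measurableSet_isBin (hX : IsPoissonProcess P lam X) (i k : ℕ) :
    MeasurableSet {ω | IsBin M N R L u i k (fun n => X n ω)} := by
  change MeasurableSet {ω | (fun a => count (fun n => X n ω) (binSets M N R u i k a)) ∈ binCounts N L k}
  have : Measurable fun ω a => count (fun n => X n ω) (binSets M N R u i k a) :=
    measurable_pi_lambda _ fun a => measurable_count hX.measurable (measurableSet_binSets a)
  exact this MeasurableSet.of_discrete

variable [IsProbabilityMeasure P]

lemma lintegral_isBin_le (hX : IsPoissonProcess P lam X) (hlam : 0 ≤ lam) (hm : ∀ n, Measurable (h n))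
    (hlaw : ∀ n, P.map (h n) = stdComplexGaussian) (hi : iIndepFun h P) (hα : 2 < α) (hT : 0 < T)
    (hM : 0 < M) (hMR : 2 * R ≤ M) (hu : u ∈ cluster R) {i k : ℕ} (hik : i + 1 ≤ k) (hkN : k ≤ N) :
    ∫⁻ ω in {ω | IsBin M N R L u i k (fun n => X n ω)},
        relaxedBound α lam σ R (gridThreshold α T M N (nthDist 1 (fun n => X n ω) u))
          (T * nthDist 1 (fun n => X n ω) u ^ α) ‖u‖ (nthDist 1 (fun n => X n ω) u)
          (nthDist (L + 1) (fun n => X n ω) u) ∂P ≤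
      ∫⁻ ω in {ω | IsBin M N R L u i k (fun n => X n ω)},
        P {ω' | IsCovered α σ R L T u (fun n => h n ω') (fun n => X n ω)} ∂P := by
  refine (setLIntegral_mono' (measurableSet_isBin hX i k) fun ω hω =>
    relaxedBound_le_of_isBin hM hMR hα hT hu hik hkN hω).trans ?_
  exact mul_covBound_le hX hlam hm hlaw hi hα hT (gridRadius_nonneg hM.le N i)
    (gridRadius_mono hM.le i.le_succ) measurableSet_binSets volume_binSets_ne_top
    (pairwise_disjoint_binSets hM hik) (disjoint_binSets_residualSet hM) (binCounts N L k)
    fun ω hω => ⟨hω.1, hω.2.1, IsBin.count_le (x := fun n => X n ω) hM hu hMR hik hkN hω⟩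

lemma volume_real_annulus (hM : 0 < M) (j : ℕ) :
    volume.real (annulus u (gridRadius M N j) (gridRadius M N (j + 1))) = π * M ^ 2 / N := by
  rw [annulus, measureReal_sdiff
    (Metric.closedBall_subset_closedBall (gridRadius_mono hM.le j.le_succ))
    Metric.isClosed_closedBall.measurableSet measure_closedBall_lt_top.ne,
    volume_real_closedBall (gridRadius_nonneg hM.le _ _),
    volume_real_closedBall (gridRadius_nonneg hM.le _ _), gridRadius_sq, gridRadius_sq]
  push_cast
  ring

/-- A configuration outside all bins has a point at the user (null), no point in the disc of radius
`M`, or two points in one annulus. The last has probability at most `N (λπM²/N)²`. -/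
lemma measure_compl_isBin_le (hX : IsPoissonProcess P lam X) (hlam : 0 ≤ lam) (hM : 0 < M) (hN : 0 < N)
    (hL : 1 ≤ L) :
    P {ω | ∃ i k, i + 1 ≤ k ∧ k ≤ N ∧ IsBin M N R L u i k (fun n => X n ω)}ᶜ ≤
      ENNReal.ofReal (exp (-(lam * (π * M ^ 2))) + (lam * (π * M ^ 2)) ^ 2 / N) := by
  have hsub : {ω | ∃ i k, i + 1 ≤ k ∧ k ≤ N ∧ IsBin M N R L u i k (fun n => X n ω)}ᶜ ⊆
      ({ω | count (fun n => X n ω) (Metric.closedBall u 0) = 0}ᶜ ∪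
        {ω | count (fun n => X n ω) (Metric.closedBall u M) = 0}) ∪
        ⋃ j ∈ Finset.range N, {ω | 2 ≤ count (fun n => X n ω)
          (annulus u (gridRadius M N j) (gridRadius M N (j + 1)))} := by
    intro ω hω
    by_contra hcon
    simp only [mem_union, mem_compl_iff, mem_ofPred_eq, mem_iUnion, not_or, not_not, not_exists,
      not_le] at hcon
    refine hω (exists_isBin hM hN hL hcon.1.1 hcon.1.2 fun j hj => ?_)
    have := hcon.2 j (Finset.mem_range.2 hj)
    exact (ENat.lt_add_one_iff ENat.one_ne_top).1 (by simpa [one_add_one_eq_two] using this)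
  have hB : ∀ r : ℝ, MeasurableSet (Metric.closedBall u r) := fun r =>
    Metric.isClosed_closedBall.measurableSet
  have e1 : P {ω | count (fun n => X n ω) (Metric.closedBall u 0) = 0}ᶜ = 0 := by
    have hm : MeasurableSet {ω | count (fun n => X n ω) (Metric.closedBall u 0) = 0} :=
      measurable_count hX.measurable (hB 0) (measurableSet_singleton 0)
    rw [prob_compl_eq_zero_iff hm, hX.measure_count_eq_zero (hB 0) measure_closedBall_lt_top.ne,
      volume_real_closedBall le_rfl]
    simp
  refine (measure_mono hsub).trans ((measure_union_le _ _).trans ?_)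
  rw [ENNReal.ofReal_add (exp_pos _).le (by positivity)]
  gcongr
  · refine (measure_union_le _ _).trans ?_
    rw [e1, zero_add, hX.measure_count_eq_zero (hB M) measure_closedBall_lt_top.ne,
      volume_real_closedBall hM.le]
  · refine (measure_biUnion_finset_le _ _).trans ?_
    refine (Finset.sum_le_sum fun j _ =>
      hX.measure_two_le_count_le hlam measurableSet_annulus volume_annulus_ne_top).trans ?_
    have hN' : (N : ℝ) ≠ 0 := by positivity
    simp only [volume_real_annulus hM, Finset.sum_const, Finset.card_range, nsmul_eq_mul]
    rw [← ENNReal.ofReal_natCast, ← ENNReal.ofReal_mul (by positivity)]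
    refine ENNReal.ofReal_le_ofReal (le_of_eq ?_)
    field_simp

lemma lintegral_relaxedBound_le (hX : IsPoissonProcess P lam X) (hlam : 0 ≤ lam)
    (hm : ∀ n, Measurable (h n)) (hlaw : ∀ n, P.map (h n) = stdComplexGaussian) (hi : iIndepFun h P)
    (hα : 2 < α) (hT : 0 < T) (hL : 1 ≤ L) (hM : 0 < M) (hMR : 2 * R ≤ M) (hN : 0 < N)
    (hu : u ∈ cluster R) :
    ∫⁻ ω, relaxedBound α lam σ R (gridThreshold α T M N (nthDist 1 (fun n => X n ω) u))
          (T * nthDist 1 (fun n => X n ω) u ^ α) ‖u‖ (nthDist 1 (fun n => X n ω) u)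
          (nthDist (L + 1) (fun n => X n ω) u) ∂P ≤
      ∫⁻ ω, P {ω' | IsCovered α σ R L T u (fun n => h n ω') (fun n => X n ω)} ∂P +
        ENNReal.ofReal (exp (-(lam * (π * M ^ 2))) + (lam * (π * M ^ 2)) ^ 2 / N) := by
  classical
  set I : Finset (ℕ × ℕ) :=
    (Finset.range (N + 1) ×ˢ Finset.range (N + 1)).filter fun p => p.1 + 1 ≤ p.2 with hI
  set B : ℕ × ℕ → Set Ω := fun p => {ω | IsBin M N R L u p.1 p.2 (fun n => X n ω)} with hB
  have hmem : ∀ p, p ∈ I ↔ p.1 + 1 ≤ p.2 ∧ p.2 ≤ N := by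
    intro p
    simp only [hI, Finset.mem_filter, Finset.mem_product, Finset.mem_range]
    omega
  have hunion : (⋃ p ∈ I, B p) =
      {ω | ∃ i k, i + 1 ≤ k ∧ k ≤ N ∧ IsBin M N R L u i k (fun n => X n ω)} := by
    ext ω
    simp only [mem_iUnion, hmem, exists_prop, Prod.exists, hB, mem_ofPred_eq, and_assoc]
  have hdisj : (I : Set (ℕ × ℕ)).PairwiseDisjoint B := by
    intro p hp q hq hpq
    have hp := (hmem p).1 hp
    have hq := (hmem q).1 hq
    refine disjoint_left.2 fun ω h1 h2 => hpq ?_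
    obtain ⟨e1, e2⟩ := IsBin.unique hM hp.1 hq.1 hp.2 hq.2 h1 h2
    exact Prod.ext e1 e2
  have hBm : ∀ p ∈ I, MeasurableSet (B p) := fun p _ => measurableSet_isBin hX p.1 p.2
  have hUm : MeasurableSet (⋃ p ∈ I, B p) := Finset.measurableSet_biUnion I hBm
  rw [← lintegral_add_compl _ hUm]
  refine add_le_add ?_ ?_
  · rw [lintegral_biUnion_finset hdisj hBm]
    refine le_trans (Finset.sum_le_sum fun p hp => lintegral_isBin_le hX hlam hm hlaw hi hα hT hM hMR hu
      ((hmem p).1 hp).1 ((hmem p).1 hp).2) ?_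
    rw [← lintegral_biUnion_finset hdisj hBm]
    exact setLIntegral_le_lintegral _ _
  · refine (lintegral_mono fun _ => relaxedBound_le_one).trans ?_
    rw [lintegral_const, one_mul, Measure.restrict_apply_univ, hunion]
    exact measure_compl_isBin_le hX hlam hM hN hL

lemma distLaw_nonpos : distLaw lam L {p | p.1 ≤ 0} = 0 := by
  have hm : MeasurableSet {p : ℝ × ℝ | p.1 ≤ 0} := measurableSet_le measurable_fst measurable_const
  rw [distLaw, withDensity_apply _ hm, setLIntegral_congr_fun (g := fun _ => 0) hm, lintegral_zero]
  intro p hp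
  have hp : p.1 ≤ 0 := hp
  have : pdfServing lam p.1 = 0 := by
    rw [pdfServing]
    split_ifs with h
    · simp [le_antisymm hp h]
    · rfl
  simp [this]

lemma ae_nthDist_pos (hX : IsPoissonProcess P lam X) (hlam : 0 < lam) (u : Plane) :
    ∀ᵐ ω ∂P, 0 < nthDist 1 (fun n => X n ω) u := by
  -- The second distance is auxiliary: the joint law is used with `L = 1` just to read off its first
  -- coordinate.
  have hm : Measurable fun ω => (nthDist 1 (fun n => X n ω) u, nthDist (1 + 1) (fun n => X n ω) u) :=
    (measurable_nthDist le_rfl hX.measurable measurable_const).prodMk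
      (measurable_nthDist (by omega) hX.measurable measurable_const)
  have h1 := distLaw_nonpos (lam := lam) (L := 1)
  rw [← hX.map_nthDist hlam le_rfl u, Measure.map_apply hm
    (measurableSet_le measurable_fst measurable_const)] at h1
  refine measure_mono_null (fun ω hω => ?_) h1
  exact not_lt.1 (show ¬ 0 < nthDist 1 (fun n => X n ω) u from hω)

/-- Lower bound for the coverage probability of a user at a fixed position. -/
theorem lintegral_covBound_le (hX : IsPoissonProcess P lam X) (hlam : 0 < lam)
    (hm : ∀ n, Measurable (h n)) (hlaw : ∀ n, P.map (h n) = stdComplexGaussian) (hi : iIndepFun h P)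
    (hα : 2 < α) (hT : 0 < T) (hL : 1 ≤ L) (hu : u ∈ cluster R) :
    ∫⁻ ω, covBound α lam σ R (T * nthDist 1 (fun n => X n ω) u ^ α) ‖u‖
        (nthDist 1 (fun n => X n ω) u) (nthDist (L + 1) (fun n => X n ω) u) ∂P ≤
      ∫⁻ ω, P {ω' | IsCovered α σ R L T u (fun n => h n ω') (fun n => X n ω)} ∂P := by
  have hm1 : Measurable fun ω => nthDist 1 (fun n => X n ω) u :=
    measurable_nthDist le_rfl hX.measurable measurable_const
  have hm2 : Measurable fun ω => nthDist (L + 1) (fun n => X n ω) u :=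
    measurable_nthDist (by omega) hX.measurable measurable_const
  -- First `N → ∞` for fixed `M`, which removes the rounding and the annuli with two points; the
  -- empty disc disappears afterwards as `M → ∞`.
  have hfix : ∀ M : ℝ, 0 < M → 2 * R ≤ M →
      ∫⁻ ω, covBound α lam σ R (T * nthDist 1 (fun n => X n ω) u ^ α) ‖u‖
        (nthDist 1 (fun n => X n ω) u) (nthDist (L + 1) (fun n => X n ω) u) ∂P ≤
      ∫⁻ ω, P {ω' | IsCovered α σ R L T u (fun n => h n ω') (fun n => X n ω)} ∂P +
        ENNReal.ofReal (exp (-(lam * (π * M ^ 2)))) := by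
    intro M hM hMR
    have hlim1 : Filter.Tendsto (fun N : ℕ => ∫⁻ ω, relaxedBound α lam σ R
        (gridThreshold α T M N (nthDist 1 (fun n => X n ω) u))
          (T * nthDist 1 (fun n => X n ω) u ^ α) ‖u‖ (nthDist 1 (fun n => X n ω) u)
          (nthDist (L + 1) (fun n => X n ω) u) ∂P) Filter.atTop
        (nhds (∫⁻ ω, covBound α lam σ R (T * nthDist 1 (fun n => X n ω) u ^ α) ‖u‖
          (nthDist 1 (fun n => X n ω) u) (nthDist (L + 1) (fun n => X n ω) u) ∂P)) := by
      refine tendsto_lintegral_of_dominated_convergence (fun _ => 1) (fun N => ?_)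
        (fun N => .of_forall fun _ => relaxedBound_le_one) (by simp) ?_
      · have h1 : Measurable fun ω => exponent α R (T * nthDist 1 (fun n => X n ω) u ^ α) ‖u‖
            (nthDist 1 (fun n => X n ω) u) (nthDist (L + 1) (fun n => X n ω) u) :=
          measurable_exponent.comp (measurable_const.prodMk (hm1.prodMk hm2))
        unfold relaxedBound gridThreshold
        fun_prop
      · filter_upwards [ae_nthDist_pos hX hlam u] with ω hω
        exact tendsto_relaxedBound (by positivity) (tendsto_gridThreshold hω)
    have hlim2 : Filter.Tendsto (fun N : ℕ =>
        ∫⁻ ω, P {ω' | IsCovered α σ R L T u (fun n => h n ω') (fun n => X n ω)} ∂P +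
        ENNReal.ofReal (exp (-(lam * (π * M ^ 2))) + (lam * (π * M ^ 2)) ^ 2 / N)) Filter.atTop
        (nhds (∫⁻ ω, P {ω' | IsCovered α σ R L T u (fun n => h n ω') (fun n => X n ω)} ∂P +
        ENNReal.ofReal (exp (-(lam * (π * M ^ 2)))))) := by
      refine Filter.Tendsto.const_add _ (ENNReal.tendsto_ofReal ?_)
      simpa using (tendsto_const_div_atTop_nhds_zero_nat ((lam * (π * M ^ 2)) ^ 2)).const_add
        (exp (-(lam * (π * M ^ 2))))
    refine le_of_tendsto_of_tendsto hlim1 hlim2 ?_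
    filter_upwards [Filter.eventually_gt_atTop 0] with N hN
    exact lintegral_relaxedBound_le hX hlam.le hm hlaw hi hα hT hL hM hMR hN hu
  have hlim : Filter.Tendsto (fun M : ℝ =>
      ∫⁻ ω, P {ω' | IsCovered α σ R L T u (fun n => h n ω') (fun n => X n ω)} ∂P +
        ENNReal.ofReal (exp (-(lam * (π * M ^ 2))))) Filter.atTop
      (nhds (∫⁻ ω, P {ω' | IsCovered α σ R L T u (fun n => h n ω') (fun n => X n ω)} ∂P + 0)) := by
    refine Filter.Tendsto.const_add _ ?_
    rw [← ENNReal.ofReal_zero]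
    refine ENNReal.tendsto_ofReal (tendsto_exp_neg_atTop_nhds_zero.comp ?_)
    exact Filter.Tendsto.const_mul_atTop hlam
      (Filter.Tendsto.const_mul_atTop pi_pos (Filter.tendsto_pow_atTop two_ne_zero))
  rw [add_zero] at hlim
  refine ge_of_tendsto hlim ?_
  filter_upwards [Filter.eventually_gt_atTop 0, Filter.eventually_ge_atTop (2 * R)] with M h1 h2
  exact hfix M h1 h2

end limit

end CloudRadio

/-! ### The user's distance to the centre and the laws of the three distances. -/

namespace CloudRadio

section user

lemma measurable_pdfUser (R : ℝ) : Measurable (pdfUser R) :=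
  Measurable.ite (measurableSet_Ici.inter measurableSet_Iic) (by fun_prop) measurable_const

lemma pdfUser_nonneg (R r : ℝ) : 0 ≤ pdfUser R r := by
  unfold pdfUser
  split_ifs with h
  · have := h.1
    positivity
  · rfl

lemma lintegral_pdfUser_Iic {R : ℝ} (hR : 0 < R) {a : ℝ} (ha : 0 ≤ a) (haR : a ≤ R) :
    ∫⁻ r in Iic a, ENNReal.ofReal (pdfUser R r) = ENNReal.ofReal (a ^ 2 / R ^ 2) := by
  have h1 : ∀ r, (Iic a).indicator (fun r => ENNReal.ofReal (pdfUser R r)) r =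
      (Icc 0 a).indicator (fun r => ENNReal.ofReal (2 * r / R ^ 2)) r := by
    intro r
    simp only [indicator, mem_Iic, mem_Icc, pdfUser]
    split_ifs <;> first | rfl | grind | simp_all
  rw [← lintegral_indicator measurableSet_Iic, lintegral_congr h1,
    lintegral_indicator measurableSet_Icc, ← Measure.restrict_congr_set Ico_ae_eq_Icc,
    lintegral_Ico_deriv (G := fun r => r ^ 2 / R ^ 2) ha]
  · simp
  · intro x
    simpa using (hasDerivAt_pow 2 x).div_const (R ^ 2)
  · fun_prop
  · intro x hx
    have := hx.1
    positivity

variable {Ω : Type*} [MeasurableSpace Ω] {P : Measure Ω} {R : ℝ} {U : Ω → Plane}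

lemma ae_mem_cluster (hU : Measurable U) (hunif : pdf.IsUniform U (cluster R) P volume) :
    ∀ᵐ ω ∂P, U ω ∈ cluster R := by
  have hm : MeasurableSet (cluster R) := Metric.isOpen_ball.measurableSet
  have h : ∀ᵐ u ∂(P.map U), u ∈ cluster R := by
    rw [hunif]
    exact ae_cond_mem hm
  exact ae_of_ae_map hU.aemeasurable h

/-- The law of the distance of a uniformly distributed user to the centre of the cluster. -/
lemma map_norm_of_isUniform [IsProbabilityMeasure P] (hU : Measurable U)
    (hunif : pdf.IsUniform U (cluster R) P volume) (hR : 0 < R) :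
    P.map (fun ω => ‖U ω‖) = volume.withDensity fun r => ENNReal.ofReal (pdfUser R r) := by
  have hm : MeasurableSet (cluster R) := Metric.isOpen_ball.measurableSet
  have hP : IsProbabilityMeasure (P.map fun ω => ‖U ω‖) :=
    Measure.isProbabilityMeasure_map hU.norm.aemeasurable
  have hle : ∀ a, 0 ≤ a → a < R →
      P.map (fun ω => ‖U ω‖) (Iic a) = ENNReal.ofReal (a ^ 2 / R ^ 2) := by
    intro a ha haR
    have hball : cluster R ∩ (fun u : Plane => ‖u‖) ⁻¹' Iic a = Metric.closedBall 0 a := by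
      ext u
      simp only [cluster, mem_inter_iff, mem_ball_zero_iff, mem_preimage, mem_Iic,
        mem_closedBall_zero_iff]
      exact ⟨fun h => h.2, fun h => ⟨h.trans_lt haR, h⟩⟩
    have hcomp : P.map (fun ω => ‖U ω‖) = (P.map U).map (fun u => ‖u‖) :=
      (Measure.map_map measurable_norm hU).symm
    rw [hcomp, Measure.map_apply measurable_norm measurableSet_Iic, hunif, cond_apply hm, hball,
      ← ENNReal.ofReal_toReal (measure_closedBall_lt_top (μ := volume) (x := (0 : Plane)) (r := a)).ne,
      cluster, ← ENNReal.ofReal_toReal (measure_ball_lt_top (μ := volume) (x := (0 : Plane)) (r := R)).ne]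
    change (ENNReal.ofReal (volume.real (Metric.ball (0 : Plane) R)))⁻¹ *
      ENNReal.ofReal (volume.real (Metric.closedBall (0 : Plane) a)) = _
    rw [volume_real_ball hR.le, volume_real_closedBall ha, ← ENNReal.ofReal_inv_of_pos (by positivity),
      ← ENNReal.ofReal_mul (by positivity)]
    congr 1
    have := pi_ne_zero
    field_simp
  have hge : ∀ a, R ≤ a → P.map (fun ω => ‖U ω‖) (Iic a) = 1 := by
    intro a ha
    rw [Measure.map_apply hU.norm measurableSet_Iic]
    refine (prob_compl_eq_zero_iff (hU.norm measurableSet_Iic)).1 ?_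
    refine measure_mono_null ?_ (ae_iff.1 (ae_mem_cluster hU hunif))
    intro ω hω hmem
    exact hω ((mem_ball_zero_iff.1 hmem).le.trans ha)
  refine Measure.ext_of_Iic _ _ fun a => ?_
  rw [withDensity_apply _ measurableSet_Iic]
  rcases lt_or_ge a 0 with ha | ha
  · rw [Measure.map_apply hU.norm measurableSet_Iic, setLIntegral_congr_fun (g := fun _ => 0)
      measurableSet_Iic, lintegral_zero]
    · convert measure_empty (μ := P)
      ext ω
      simpa using ha.trans_le (norm_nonneg _)
    · intro r hr
      have : ¬ 0 ≤ r := not_le.2 (lt_of_le_of_lt hr ha)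
      simp [pdfUser, this]
  rcases lt_or_ge a R with haR | haR
  · rw [hle a ha haR, lintegral_pdfUser_Iic hR ha haR.le]
  · rw [hge a haR]
    have h1 : ∀ r, (Iic a).indicator (fun r => ENNReal.ofReal (pdfUser R r)) r =
        (Iic R).indicator (fun r => ENNReal.ofReal (pdfUser R r)) r := by
      intro r
      simp only [indicator, mem_Iic, pdfUser]
      split_ifs <;> first | rfl | grind | simp_all
    rw [← lintegral_indicator measurableSet_Iic, lintegral_congr h1,
      lintegral_indicator measurableSet_Iic, lintegral_pdfUser_Iic hR hR.le le_rfl,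
      div_self (by positivity), ENNReal.ofReal_one]

end user

section conditional

variable {lam : ℝ} {L : ℕ}

lemma lintegral_pdfInterferer_univ (hlam : 0 < lam) (hL : 1 ≤ L) {r : ℝ} (hr : 0 ≤ r) :
    ∫⁻ y, ENNReal.ofReal (pdfInterferer lam L r y) = 1 := by
  obtain ⟨n, rfl⟩ := Nat.exists_eq_add_of_le' hL
  rw [← setLIntegral_eq_of_support_subset (s := Ici r), lintegral_pdfInterferer hlam hL hr le_rfl]
  · simp [expSum_zero_right]
  · intro y hy
    by_contra h
    exact hy (by simp [pdfInterferer, show ¬ r ≤ y from h])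

/-- The conditional law of the distance to the `L`-th nearest interferer, given the distance to the
nearest base station. -/
noncomputable def interfererKernel (lam : ℝ) (L : ℕ) : Kernel ℝ ℝ :=
  Kernel.withDensity (Kernel.const ℝ volume)
    fun r y => ENNReal.ofReal (pdfInterferer lam L (max r 0) y)

lemma interfererKernel_apply (r : ℝ) : interfererKernel lam L r =
    volume.withDensity fun y => ENNReal.ofReal (pdfInterferer lam L (max r 0) y) := by
  rw [interfererKernel, Kernel.withDensity_apply, Kernel.const_apply]
  exact (measurable_pdfInterferer.comp
    ((measurable_fst.max measurable_const).prodMk measurable_snd)).ennreal_ofReal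

/-- Clipping `r` at `0` gives mass `1` for negative `r` too; those values are irrelevant, since
`pdfServing` vanishes there. -/
lemma isMarkovKernel_interfererKernel (hlam : 0 < lam) (hL : 1 ≤ L) :
    IsMarkovKernel (interfererKernel lam L) :=
  ⟨fun r => ⟨by rw [interfererKernel_apply, withDensity_apply _ .univ, Measure.restrict_univ,
    lintegral_pdfInterferer_univ hlam hL (le_max_right _ _)]⟩⟩

lemma distLaw_eq_compProd (hlam : 0 < lam) (hL : 1 ≤ L) [IsFiniteMeasure (distLaw lam L)] :
    distLaw lam L =
      (volume.withDensity fun r => ENNReal.ofReal (pdfServing lam r)) ⊗ₘ interfererKernel lam L := by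
  have := isMarkovKernel_interfererKernel hlam hL
  have hms : Measurable fun r => ENNReal.ofReal (pdfServing lam r) :=
    measurable_pdfServing.ennreal_ofReal
  refine Measure.ext_prod fun {A B} hA hB => ?_
  rw [distLaw_prod hlam hA hB, Measure.compProd_apply_prod hA hB,
    setLIntegral_withDensity_eq_setLIntegral_mul _ hms (Kernel.measurable_coe _ hB) hA]
  refine lintegral_congr fun r => ?_
  rcases lt_or_ge r 0 with hr | hr
  · simp [pdfServing, not_le.2 hr]
  · rw [Pi.mul_apply, interfererKernel_apply, withDensity_apply _ hB, max_eq_left hr]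

lemma map_fst_distLaw (hlam : 0 < lam) (hL : 1 ≤ L) : (distLaw lam L).map Prod.fst =
    volume.withDensity fun r => ENNReal.ofReal (pdfServing lam r) := by
  ext A hA
  rw [Measure.map_apply measurable_fst hA, ← prod_univ, distLaw_prod hlam hA .univ,
    withDensity_apply _ hA]
  refine lintegral_congr fun r => ?_
  rcases lt_or_ge r 0 with hr | hr
  · simp [pdfServing, not_le.2 hr]
  · rw [Measure.restrict_univ, lintegral_pdfInterferer_univ hlam hL hr, mul_one]

end conditional

section independence

/-- If the law of `D u Y` does not depend on the value `u` of a variable `U` independent of `Y`,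
then `D U Y` is independent of `U`. -/
lemma map_prod_of_indepFun {Ω β γ δ ε : Type*} [MeasurableSpace Ω] [MeasurableSpace β]
    [MeasurableSpace γ] [MeasurableSpace δ] [MeasurableSpace ε] {P : Measure Ω}
    [IsProbabilityMeasure P] {U : Ω → β} {Y : Ω → γ} (hU : Measurable U) (hY : Measurable Y)
    (hi : IndepFun U Y P) {f : β → δ} (hf : Measurable f) {D : β → γ → ε}
    (hD : Measurable (Function.uncurry D)) {ν : Measure ε}
    (hν : ∀ u, P.map (fun ω => D u (Y ω)) = ν) :
    P.map (fun ω => (f (U ω), D (U ω) (Y ω))) = (P.map fun ω => f (U ω)).prod ν := by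
  have hfU : Measurable fun ω => f (U ω) := hf.comp hU
  have hDU : Measurable fun ω => D (U ω) (Y ω) := hD.comp (hU.prodMk hY)
  have hDu : ∀ u, Measurable fun ω => D u (Y ω) := fun u => hD.comp (measurable_const.prodMk hY)
  have := Measure.isProbabilityMeasure_map (μ := P) (hfU.prodMk hDU).aemeasurable
  have := Measure.isProbabilityMeasure_map (μ := P) hY.aemeasurable
  have := Measure.isProbabilityMeasure_map (μ := P) hfU.aemeasurable
  have : SFinite ν := by
    have := nonempty_of_isProbabilityMeasure P
    rw [← hν (U (Classical.arbitrary Ω))]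
    infer_instance
  refine Measure.ext_prod fun {A B} hA hB => ?_
  have hS : MeasurableSet {p : β × γ | f p.1 ∈ A ∧ D p.1 p.2 ∈ B} :=
    (hf.comp measurable_fst hA).inter (hD hB)
  have hpre : P.map (fun ω => (f (U ω), D (U ω) (Y ω))) (A ×ˢ B) =
      P.map (fun ω => (U ω, Y ω)) {p : β × γ | f p.1 ∈ A ∧ D p.1 p.2 ∈ B} := by
    rw [Measure.map_apply (hfU.prodMk hDU) (hA.prod hB),
      Measure.map_apply (hU.prodMk hY) hS]
    rfl
  have hsec : ∀ u : β, P.map Y (Prod.mk u ⁻¹' {p : β × γ | f p.1 ∈ A ∧ D p.1 p.2 ∈ B}) =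
      (f ⁻¹' A).indicator (fun _ => ν B) u := by
    intro u
    by_cases hu : f u ∈ A
    · rw [indicator_of_mem (by exact hu), ← hν u, Measure.map_apply hY (measurable_prodMk_left hS),
        Measure.map_apply (hDu u) hB]
      congr 1
      ext ω
      exact and_iff_right hu
    · rw [indicator_of_notMem (by exact hu)]
      convert measure_empty (μ := P.map Y)
      ext x
      exact iff_of_false (fun hx => hu hx.1) (notMem_empty x)
  rw [hpre, (indepFun_iff_map_prod_eq_prod_map_map hU.aemeasurable hY.aemeasurable).1 hi,
    Measure.prod_apply hS, lintegral_congr hsec, lintegral_indicator_const (hf hA), mul_comm,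
    Measure.prod_prod, Measure.map_apply hfU hA, Measure.map_apply hU (hf hA)]
  rfl

end independence

namespace IsNetwork

variable {Ω : Type*} [MeasurableSpace Ω] {P : Measure Ω} {lam R α σ T : ℝ}
  {L : ℕ} {X : ℕ → Ω → Plane} {h : ℕ → Ω → ℂ} {U : Ω → Plane}

lemma measurable_stations (hnet : IsNetwork P lam R X h U) : Measurable fun ω n => X n ω :=
  measurable_pi_lambda _ hnet.poisson.measurable

lemma measurable_fading (hnet : IsNetwork P lam R X h U) : Measurable fun ω n => h n ω :=
  measurable_pi_lambda _ hnet.fading_measurable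

lemma measurable_rUser (hnet : IsNetwork P lam R X h U) : Measurable (rUser U) :=
  hnet.user_measurable.norm

lemma measurable_rServing (hnet : IsNetwork P lam R X h U) : Measurable (rServing X U) :=
  measurable_nthDist le_rfl hnet.poisson.measurable hnet.user_measurable

lemma measurable_rInterferer (hnet : IsNetwork P lam R X h U) : Measurable (rInterferer L X U) :=
  measurable_nthDist (by omega) hnet.poisson.measurable hnet.user_measurable

variable [IsProbabilityMeasure P]

lemma map_user_stations (hnet : IsNetwork P lam R X h U) :
    P.map (fun ω => (U ω, fun n => X n ω)) = (P.map U).prod (P.map fun ω n => X n ω) :=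
  (indepFun_iff_map_prod_eq_prod_map_map hnet.user_measurable.aemeasurable
    hnet.measurable_stations.aemeasurable).1 (hnet.indep_user.comp measurable_id measurable_snd)

lemma map_model (hnet : IsNetwork P lam R X h U) :
    P.map (fun ω => (U ω, (fun n => h n ω), fun n => X n ω)) =
      (P.map U).prod ((P.map fun ω n => h n ω).prod (P.map fun ω n => X n ω)) := by
  rw [← (indepFun_iff_map_prod_eq_prod_map_map hnet.measurable_fading.aemeasurable
    hnet.measurable_stations.aemeasurable).1 hnet.indep_fading_stations]
  exact (indepFun_iff_map_prod_eq_prod_map_map hnet.user_measurable.aemeasurable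
    (hnet.measurable_fading.prodMk hnet.measurable_stations).aemeasurable).1 hnet.indep_user

/-- By `map_nthDist` the law of the two distances from a fixed point is the same for every point, so
it is unaffected by conditioning on the user's position. -/
lemma map_distances_eq_prod (hnet : IsNetwork P lam R X h U) (hlam : 0 < lam) (hL : 1 ≤ L) :
    P.map (fun ω => (rUser U ω, rServing X U ω, rInterferer L X U ω)) =
      (P.map fun ω => ‖U ω‖).prod (distLaw lam L) := by
  have hX : ∀ n, Measurable fun p : Plane × (ℕ → Plane) => p.2 n := fun n => by fun_prop
  exact map_prod_of_indepFun hnet.user_measurable hnet.measurable_stations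
    (hnet.indep_user.comp measurable_id measurable_snd) measurable_norm
    (D := fun u x => (nthDist 1 x u, nthDist (L + 1) x u))
    ((measurable_nthDist le_rfl hX measurable_fst).prodMk
      (measurable_nthDist (by omega) hX measurable_fst))
    (fun u => hnet.poisson.map_nthDist hlam hL u)

/-- The joint law of the distance of the user to the centre, to its nearest base station, and to
its `L`-th nearest interferer. -/
lemma map_distances (hnet : IsNetwork P lam R X h U) (hlam : 0 < lam) (hR : 0 < R) (hL : 1 ≤ L) :
    P.map (fun ω => (rUser U ω, rServing X U ω, rInterferer L X U ω)) =
      (volume : Measure (ℝ × ℝ × ℝ)).withDensity (fun p => ENNReal.ofReal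
        (pdfUser R p.1 * pdfServing lam p.2.1 * pdfInterferer lam L p.2.1 p.2.2)) := by
  have hser : Measurable fun q : ℝ × ℝ =>
      ENNReal.ofReal (pdfServing lam q.1 * pdfInterferer lam L q.1 q.2) :=
    ((measurable_pdfServing.comp measurable_fst).mul measurable_pdfInterferer).ennreal_ofReal
  rw [map_distances_eq_prod hnet hlam hL, map_norm_of_isUniform hnet.user_measurable
    hnet.user_uniform hR, distLaw, prod_withDensity (measurable_pdfUser R).ennreal_ofReal hser,
    ← Measure.volume_eq_prod]
  congr 1
  funext p
  rw [mul_assoc, ENNReal.ofReal_mul (pdfUser_nonneg R p.1)]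

end IsNetwork

end CloudRadio

/-! ### Averaging over the user. -/

namespace CloudRadio

lemma measurable_covBound_comp {β : Type*} [MeasurableSpace β] {α lam σ R T : ℝ} {f g k : β → ℝ}
    (hf : Measurable f) (hg : Measurable g) (hk : Measurable k) :
    Measurable fun a => covBound α lam σ R (T * g a ^ α) (f a) (g a) (k a) := by
  have := (measurable_covBound (α := α) (lam := lam) (σ := σ) (R := R) (T := T)).comp
    (hf.prodMk (hg.prodMk hk))
  exact this

namespace IsNetwork

variable {Ω : Type*} [MeasurableSpace Ω] {P : Measure Ω} {lam R α σ T : ℝ}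
  {L : ℕ} {X : ℕ → Ω → Plane} {h : ℕ → Ω → ℂ} {U : Ω → Plane}

lemma measurable_covBound_distances (hnet : IsNetwork P lam R X h U) :
    Measurable fun ω => covBound α lam σ R (T * rServing X U ω ^ α) (rUser U ω) (rServing X U ω)
      (rInterferer L X U ω) :=
  measurable_covBound_comp hnet.measurable_rUser hnet.measurable_rServing hnet.measurable_rInterferer

variable [IsProbabilityMeasure P]

lemma isProbabilityMeasure_map_norm (hnet : IsNetwork P lam R X h U) :
    IsProbabilityMeasure (P.map fun ω => ‖U ω‖) :=
  Measure.isProbabilityMeasure_map hnet.user_measurable.norm.aemeasurable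

/-- It is the law of two actual distances, so its total mass needs no integration. -/
lemma isProbabilityMeasure_distLaw (hnet : IsNetwork P lam R X h U) (hlam : 0 < lam) (hL : 1 ≤ L) :
    IsProbabilityMeasure (distLaw lam L) := by
  rw [← hnet.poisson.map_nthDist hlam hL 0]
  exact Measure.isProbabilityMeasure_map ((measurable_nthDist le_rfl hnet.poisson.measurable
    measurable_const).prodMk (measurable_nthDist (by omega) hnet.poisson.measurable
    measurable_const)).aemeasurable

lemma map_rServing_rInterferer (hnet : IsNetwork P lam R X h U) (hlam : 0 < lam) (hL : 1 ≤ L) :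
    P.map (fun ω => (rServing X U ω, rInterferer L X U ω)) = distLaw lam L := by
  have := hnet.isProbabilityMeasure_map_norm
  have := hnet.isProbabilityMeasure_distLaw hlam hL
  have hm : Measurable fun ω => (rUser U ω, rServing X U ω, rInterferer L X U ω) :=
    hnet.measurable_rUser.prodMk (hnet.measurable_rServing.prodMk hnet.measurable_rInterferer)
  have h1 := congrArg (Measure.map Prod.snd) (hnet.map_distances_eq_prod hlam hL)
  rw [Measure.map_map measurable_snd hm, Measure.map_snd_prod, measure_univ, one_smul] at h1
  exact h1

lemma map_rServing (hnet : IsNetwork P lam R X h U) (hlam : 0 < lam) :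
    P.map (rServing X U) = volume.withDensity fun r => ENNReal.ofReal (pdfServing lam r) := by
  have h1 := congrArg (Measure.map Prod.fst) (hnet.map_rServing_rInterferer hlam le_rfl)
  rw [map_fst_distLaw hlam le_rfl, Measure.map_map measurable_fst
    (hnet.measurable_rServing.prodMk hnet.measurable_rInterferer)] at h1
  exact h1

/-- The conditional law of the distance to the `L`-th nearest interferer, given the distance to the
nearest base station. -/
lemma condDistrib_rInterferer (hnet : IsNetwork P lam R X h U) (hlam : 0 < lam) (hL : 1 ≤ L) :
    ∀ᵐ rb ∂(P.map (rServing X U)), condDistrib (rInterferer L X U) (rServing X U) P rb =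
      volume.withDensity fun rl => ENNReal.ofReal (pdfInterferer lam L rb rl) := by
  have := hnet.isProbabilityMeasure_distLaw hlam hL
  have := isMarkovKernel_interfererKernel hlam hL
  have hcond := condDistrib_ae_eq_of_measure_eq_compProd (rServing X U)
    (hnet.measurable_rInterferer (L := L)).aemeasurable (κ := interfererKernel lam L) (by
      rw [hnet.map_rServing_rInterferer hlam hL, hnet.map_rServing hlam,
        distLaw_eq_compProd hlam hL])
  have hnn : ∀ᵐ rb ∂(P.map (rServing X U)), 0 ≤ rb :=
    (ae_map_iff hnet.measurable_rServing.aemeasurable measurableSet_Ici).2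
      (.of_forall fun ω => nthDist_nonneg le_rfl _ _)
  filter_upwards [hcond, hnn] with rb h1 h2
  rw [h1, interfererKernel_apply, max_eq_left h2]

lemma ae_rServing_pos (hnet : IsNetwork P lam R X h U) (hlam : 0 < lam) :
    ∀ᵐ ω ∂P, 0 < rServing X U ω := by
  have h1 := distLaw_nonpos (lam := lam) (L := 1)
  rw [← hnet.map_rServing_rInterferer hlam le_rfl, Measure.map_apply
    (hnet.measurable_rServing.prodMk hnet.measurable_rInterferer)
    (measurableSet_le measurable_fst measurable_const)] at h1
  exact measure_mono_null (fun ω hω => not_lt.1 (show ¬ 0 < rServing X U ω from hω)) h1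

lemma ae_distances (hnet : IsNetwork P lam R X h U) (hlam : 0 < lam) :
    ∀ᵐ ω ∂P, 0 ≤ rUser U ω ∧ rUser U ω < R ∧ 0 < rServing X U ω := by
  filter_upwards [hnet.ae_rServing_pos hlam,
    ae_mem_cluster hnet.user_measurable hnet.user_uniform] with ω h1 h2
  exact ⟨norm_nonneg _, mem_ball_zero_iff.1 h2, h1⟩

lemma integrable_covBound (hnet : IsNetwork P lam R X h U) :
    Integrable (fun ω => (covBound α lam σ R (T * rServing X U ω ^ α) (rUser U ω) (rServing X U ω)
      (rInterferer L X U ω)).toReal) P :=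
  .of_bound hnet.measurable_covBound_distances.ennreal_toReal.aestronglyMeasurable 1
    (.of_forall fun _ => by
      rw [norm_of_nonneg ENNReal.toReal_nonneg]
      exact ENNReal.toReal_le_of_le_ofReal zero_le_one (by simpa using covBound_le_one))

/-- A function of the distances which agrees with the coverage bound on a Borel region, and vanishes
outside, is integrable. -/
lemma integrable_of_eq_indicator (hnet : IsNetwork P lam R X h U) (hlam : 0 < lam)
    {f : ℝ → ℝ → ℝ → ℝ} {S : Set (ℝ × ℝ × ℝ)} (hS : MeasurableSet S)
    (hf : ∀ {ru s t}, 0 ≤ ru → ru < R → 0 < s → f ru s t = S.indicator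
      (fun p => (covBound α lam σ R (T * p.2.1 ^ α) p.1 p.2.1 p.2.2).toReal) (ru, s, t)) :
    Integrable (fun ω => f (rUser U ω) (rServing X U ω) (rInterferer L X U ω)) P := by
  have hm : Measurable fun ω => (rUser U ω, rServing X U ω, rInterferer L X U ω) :=
    hnet.measurable_rUser.prodMk (hnet.measurable_rServing.prodMk hnet.measurable_rInterferer)
  refine (hnet.integrable_covBound (α := α) (σ := σ) (T := T) (L := L)).indicator (hm hS) |>.congr ?_
  filter_upwards [hnet.ae_distances hlam] with ω hω
  rw [hf hω.1 hω.2.1 hω.2.2]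
  rfl

/-- User, fading and stations are independent, so both sides are integrals over the user's law of
their values at a fixed position, where `lintegral_covBound_le` applies to almost every position. -/
lemma lintegral_covBound_le_measure (hnet : IsNetwork P lam R X h U) (hlam : 0 < lam) (hα : 2 < α)
    (hT : 0 < T) (hL : 1 ≤ L) :
    ∫⁻ ω, covBound α lam σ R (T * rServing X U ω ^ α) (rUser U ω) (rServing X U ω)
        (rInterferer L X U ω) ∂P ≤
      P {ω | IsCovered α σ R L T (U ω) (fun n => h n ω) (fun n => X n ω)} := by
  have hmX := hnet.measurable_stations
  have hmh := hnet.measurable_fading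
  have := Measure.isProbabilityMeasure_map (μ := P) hmX.aemeasurable
  have := Measure.isProbabilityMeasure_map (μ := P) hmh.aemeasurable
  have hS := measurableSet_isCovered α σ R L T
  let F : Plane × (ℕ → Plane) → ℝ≥0∞ := fun p => covBound α lam σ R (T * nthDist 1 p.2 p.1 ^ α) ‖p.1‖
    (nthDist 1 p.2 p.1) (nthDist (L + 1) p.2 p.1)
  have hX : ∀ n, Measurable fun p : Plane × (ℕ → Plane) => p.2 n := fun n => by fun_prop
  have hF : Measurable F := measurable_covBound_comp measurable_fst.norm
    (measurable_nthDist le_rfl hX measurable_fst) (measurable_nthDist (by omega) hX measurable_fst)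
  have h1 : ∫⁻ ω, covBound α lam σ R (T * rServing X U ω ^ α) (rUser U ω) (rServing X U ω)
      (rInterferer L X U ω) ∂P = ∫⁻ u, ∫⁻ ω, F (u, fun n => X n ω) ∂P ∂(P.map U) := by
    change ∫⁻ ω, F (U ω, fun n => X n ω) ∂P = _
    rw [← lintegral_map hF (hnet.user_measurable.prodMk hmX), hnet.map_user_stations,
      lintegral_prod _ hF.aemeasurable]
    exact lintegral_congr fun u => lintegral_map (hF.comp measurable_prodMk_left) hmX
  have h2 : P {ω | IsCovered α σ R L T (U ω) (fun n => h n ω) (fun n => X n ω)} =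
      ∫⁻ u, ∫⁻ ω, P {ω' | IsCovered α σ R L T u (fun n => h n ω') (fun n => X n ω)} ∂P
        ∂(P.map U) := by
    have : P {ω | IsCovered α σ R L T (U ω) (fun n => h n ω) (fun n => X n ω)} =
        P.map (fun ω => (U ω, (fun n => h n ω), fun n => X n ω)) {p | IsCovered α σ R L T p.1 p.2.1 p.2.2} := by
      rw [Measure.map_apply (hnet.user_measurable.prodMk (hmh.prodMk hmX)) hS]
      rfl
    rw [this, hnet.map_model, Measure.prod_apply hS]
    refine lintegral_congr fun u => ?_
    have hSu := measurable_prodMk_left (x := u) hS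
    rw [Measure.prod_apply_symm hSu, lintegral_map (measurable_measure_prodMk_right hSu) hmX]
    refine lintegral_congr fun ω => ?_
    rw [Measure.map_apply hmh (measurable_prodMk_right hSu)]
    rfl
  rw [h1, h2]
  refine lintegral_mono_ae ?_
  have hu : ∀ᵐ u ∂(P.map U), u ∈ cluster R :=
    (ae_map_iff hnet.user_measurable.aemeasurable Metric.isOpen_ball.measurableSet).2
      (ae_mem_cluster hnet.user_measurable hnet.user_uniform)
  filter_upwards [hu] with u hu
  exact lintegral_covBound_le hnet.poisson hlam hnet.fading_measurable hnet.fading_law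
    hnet.fading_indep hα hT hL hu

lemma integral_covBound_le_coverage (hnet : IsNetwork P lam R X h U) (hlam : 0 < lam) (hα : 2 < α)
    (hT : 0 < T) (hL : 1 ≤ L) :
    ∫ ω, (covBound α lam σ R (T * rServing X U ω ^ α) (rUser U ω) (rServing X U ω)
      (rInterferer L X U ω)).toReal ∂P ≤ coverage P α σ R L T X h U := by
  rw [integral_toReal hnet.measurable_covBound_distances.aemeasurable
    (.of_forall fun _ => covBound_le_one.trans_lt ENNReal.one_lt_top)]
  exact ENNReal.toReal_mono (measure_ne_top _ _)
    (hnet.lintegral_covBound_le_measure hlam hα hT hL)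

lemma integrable_term1 (hnet : IsNetwork P lam R X h U) (hlam : 0 < lam) (hα : 2 < α) (hT : 0 < T) :
    Integrable (fun ω => term1 α lam σ R T (rUser U ω) (rServing X U ω) (rInterferer L X U ω)) P :=
  hnet.integrable_of_eq_indicator hlam (by measurability) (term1_eq hα hlam.le hT)

lemma integrable_term2 (hnet : IsNetwork P lam R X h U) (hlam : 0 < lam) (hα : 2 < α) (hT : 0 < T) :
    Integrable (fun ω => term2 α lam σ R T (rUser U ω) (rServing X U ω) (rInterferer L X U ω)) P :=
  hnet.integrable_of_eq_indicator hlam (by measurability) (term2_eq hα hlam.le hT)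

lemma integrable_term3 (hnet : IsNetwork P lam R X h U) (hlam : 0 < lam) (hα : 2 < α) (hT : 0 < T) :
    Integrable (fun ω => term3 α lam σ R T (rUser U ω) (rServing X U ω) (rInterferer L X U ω)) P :=
  hnet.integrable_of_eq_indicator hlam (by measurability) (term3_eq hα hlam.le hT)

end IsNetwork

end CloudRadio

theorem lemma3 {Ω : Type*} [MeasurableSpace Ω] (P : Measure Ω) [IsProbabilityMeasure P]
    (lam R α σ T : ℝ) (L : ℕ) (hlam : 0 < lam) (hR : 0 < R) (hα : 2 < α) (hT : 0 < T)
    (hL : 1 ≤ L)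
    (X : ℕ → Ω → CloudRadio.Plane) (h : ℕ → Ω → ℂ) (U : Ω → CloudRadio.Plane)
    (hnet : CloudRadio.IsNetwork P lam R X h U) :
    -- the joint law of the three distances
    P.map (fun ω => (CloudRadio.rUser U ω, CloudRadio.rServing X U ω,
        CloudRadio.rInterferer L X U ω)) =
      (volume : Measure (ℝ × ℝ × ℝ)).withDensity (fun p => ENNReal.ofReal
        (CloudRadio.pdfUser R p.1 * CloudRadio.pdfServing lam p.2.1 *
          CloudRadio.pdfInterferer lam L p.2.1 p.2.2)) ∧
    -- the conditional law of the third distance given the second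
    (∀ᵐ rb ∂(P.map (CloudRadio.rServing X U)),
      condDistrib (CloudRadio.rInterferer L X U) (CloudRadio.rServing X U) P rb =
        (volume : Measure ℝ).withDensity
          (fun rl => ENNReal.ofReal (CloudRadio.pdfInterferer lam L rb rl))) ∧
    -- the three expectations are well defined
    Integrable (fun ω => CloudRadio.term1 α lam σ R T (CloudRadio.rUser U ω)
      (CloudRadio.rServing X U ω) (CloudRadio.rInterferer L X U ω)) P ∧
    Integrable (fun ω => CloudRadio.term2 α lam σ R T (CloudRadio.rUser U ω)
      (CloudRadio.rServing X U ω) (CloudRadio.rInterferer L X U ω)) P ∧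
    Integrable (fun ω => CloudRadio.term3 α lam σ R T (CloudRadio.rUser U ω)
      (CloudRadio.rServing X U ω) (CloudRadio.rInterferer L X U ω)) P ∧
    -- the lower bound
    (∫ ω, CloudRadio.term1 α lam σ R T (CloudRadio.rUser U ω)
        (CloudRadio.rServing X U ω) (CloudRadio.rInterferer L X U ω) ∂P) +
      (∫ ω, CloudRadio.term2 α lam σ R T (CloudRadio.rUser U ω)
        (CloudRadio.rServing X U ω) (CloudRadio.rInterferer L X U ω) ∂P) +
      (∫ ω, CloudRadio.term3 α lam σ R T (CloudRadio.rUser U ω)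
        (CloudRadio.rServing X U ω) (CloudRadio.rInterferer L X U ω) ∂P) ≤
    CloudRadio.coverage P α σ R L T X h U := by
  have hi1 := hnet.integrable_term1 (σ := σ) (L := L) hlam hα hT
  have hi2 := hnet.integrable_term2 (σ := σ) (L := L) hlam hα hT
  have hi3 := hnet.integrable_term3 (σ := σ) (L := L) hlam hα hT
  refine ⟨hnet.map_distances hlam hR hL, hnet.condDistrib_rInterferer hlam hL, hi1, hi2, hi3, ?_⟩
  rw [← integral_add' hi1 hi2, ← integral_add' (hi1.add hi2) hi3]
  refine (integral_mono_ae ((hi1.add hi2).add hi3) hnet.integrable_covBound ?_).trans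
    (hnet.integral_covBound_le_coverage hlam hα hT hL)
  filter_upwards [hnet.ae_distances hlam] with ω hω
  exact CloudRadio.add_terms_le hα hlam.le hT hω.1 hω.2.1 hω.2.2
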